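/- **Theorem.** Let $\mathbb S^1=\mathbb R/2\pi\mathbb Z$ and let $s>\tfrac32$ be real. Let $H^s(\mathbb S^1)$ be the Sobolev space of real functions on $\mathbb S^1$, with norm $\|f\|_s^2=\sum_{n\in\mathbb Z}(1+n^2)^s|\hat f(n)|^2$, and let $\mathcal D^s(\mathbb S^1)$ be the manifold of bijections $\eta:\mathbb S^1\to\mathbb S^1$ such that $\eta$ and $\eta^{-1}$ are of class $H^s$ (that is, differ from $x\mapsto dx$, for some $d\in\mathbb Z$, by a function in $H^s(\mathbb S^1)$, modulo $2\pi$), with the charts $g\mapsto \eta+g \bmod 2\pi$, for $g$ near $0$ in $H^s(\mathbb S^1)$, around $\eta$; its tangent vectors are thereby identified with elements of $H^s(\mathbb S^1)$. For $u_0\in H^s(\mathbb S^1)$ consider the Camassa–Holm equation in Lagrangian form $$\ddot\eta=-\Big[(1-\partial_y^2)^{-1}\partial_y\Big(u^2+\tfrac12 u_y^2\Big)\Big]\circ\eta,\qquad u=\dot\eta\circ\eta^{-1},\qquad \eta(0)=e,\quad \dot\eta(0)=u_0,\tag{1}$$ where $e$ is the identity map. A solution of (1) on an interval $I\ni 0$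 is a pair $(\eta,\dot\eta):I\to\mathcal D^s(\mathbb S^1)\times H^s(\mathbb S^1)$, continuously differentiable in time, that satisfies (1) on $I$. (a) (Uniqueness.) For every $u_0\in H^s(\mathbb S^1)$ and every interval $I\ni0$, any two solutions of (1) on $I$ coincide on $I$. (b) (Existence and dependence on the data.) For every $u_0\in H^s(\mathbb S^1)$ there are $T>0$ and an open neighbourhood $U$ of $u_0$ in $H^s(\mathbb S^1)$ such that for every $w\in U$ problem (1) with $\dot\eta(0)=w$ has a solution $(\eta(t,w),\dot\eta(t,w))$ on $(-T,T)$. The map $(t,w)\mapsto(\eta(t,w),\dot\eta(t,w))$ is of class $C^1$ from $(-T,T)\times U$ to $\mathcal D^s(\mathbb S^1)\times H^s(\mathbb S^1)$, and for every $t\in(-T,T)$ the map $w\mapsto(\eta(t,w),\dot\eta(t,w))$ is of class $C^\infty$ from $U$ to $\mathcal D^s(\mathbb S^1)\times H^s(\mathbb S^1)$. -/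

import Mathlib

open Set Filter Topology
open scoped ContDiff

noncomputable section

namespace CamassaHolm

instance fact_two_pi_pos : Fact (0 < 2 * Real.pi) := ⟨Real.two_pi_pos⟩

/-- The circle `S¹ = ℝ / 2πℤ`. -/
abbrev S1 : Type := AddCircle (2 * Real.pi)

/-- The `n`-th Fourier coefficient `(2π)⁻¹ ∫ h(y) e^{-iny} dy` of a real function on the circle. -/
def coeff (h : S1 → ℝ) (n : ℤ) : ℂ := fourierCoeff (fun y : S1 => (h y : ℂ)) n

theorem coeff_add (f g : C(S1, ℝ)) (n : ℤ) : coeff ⇑(f + g) n = coeff f n + coeff g n := by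
  have hf : MeasureTheory.Integrable (fun y : S1 => (f y : ℂ)) AddCircle.haarAddCircle :=
    (Complex.continuous_ofReal.comp f.continuous).integrable_of_hasCompactSupport
      (HasCompactSupport.of_compactSpace _)
  have hg : MeasureTheory.Integrable (fun y : S1 => (g y : ℂ)) AddCircle.haarAddCircle :=
    (Complex.continuous_ofReal.comp g.continuous).integrable_of_hasCompactSupport
      (HasCompactSupport.of_compactSpace _)
  have := congrFun (fourierCoeff.add hf hg) n
  rw [Pi.add_apply] at this
  simp only [coeff]
  rw [← this]
  congr 1
  funext y
  simp

theorem coeff_smul (c : ℝ) (f : C(S1, ℝ)) (n : ℤ) : coeff ⇑(c • f) n = (c : ℂ) * coeff f n := by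
  simp only [coeff]
  rw [← fourierCoeff.const_mul]
  congr 1
  funext y
  simp

theorem coeff_injective {f : C(S1, ℝ)} (h : ∀ n, coeff f n = 0) : f = 0 := by
  let F : C(S1, ℂ) := ⟨fun y => (f y : ℂ), Complex.continuous_ofReal.comp f.continuous⟩
  have hF : fourierCoeff (F : S1 → ℂ) = 0 := funext h
  have hs : Summable (fourierCoeff (F : S1 → ℂ)) := by rw [hF]; exact summable_zero
  have h1 := hasSum_fourier_series_of_summable hs
  have h2 : F = 0 := by
    refine h1.unique ?_
    simp only [hF, Pi.zero_apply, zero_smul]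
    exact hasSum_zero
  ext y
  have h3 : (f y : ℂ) = 0 := congrArg (fun G : C(S1, ℂ) => G y) h2
  exact_mod_cast h3

/-- The weight `(1 + n²)^{s/2}`. -/
def weight (s : ℝ) (n : ℤ) : ℝ := (1 + (n : ℝ) ^ 2) ^ (s / 2)

theorem memlp_add {s : ℝ} {f g : C(S1, ℝ)}
    (hf : Memℓp (fun n => (weight s n : ℂ) * coeff f n) 2)
    (hg : Memℓp (fun n => (weight s n : ℂ) * coeff g n) 2) :
    Memℓp (fun n => (weight s n : ℂ) * coeff ⇑(f + g) n) 2 := by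
  have h := hf.add hg
  refine (congrArg (fun q : ℤ → ℂ => Memℓp q 2) ?_).mp h
  funext n
  simp only [Pi.add_apply, coeff_add, mul_add]

theorem memlp_smul {s : ℝ} (c : ℝ) {f : C(S1, ℝ)}
    (hf : Memℓp (fun n => (weight s n : ℂ) * coeff f n) 2) :
    Memℓp (fun n => (weight s n : ℂ) * coeff ⇑(c • f) n) 2 := by
  have h := hf.const_smul (c : ℂ)
  refine (congrArg (fun q : ℤ → ℂ => Memℓp q 2) ?_).mp h
  funext n
  simp only [Pi.smul_apply, coeff_smul, smul_eq_mul]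
  ring

/-- The real continuous functions `f` on the circle with `∑ₙ (1 + n²)^s |f̂(n)|² < ∞`. -/
def hsSubmodule (s : ℝ) : Submodule ℝ C(S1, ℝ) where
  carrier := {f | Memℓp (fun n => (weight s n : ℂ) * coeff f n) 2}
  add_mem' := fun hf hg => memlp_add hf hg
  zero_mem' := by
    have h0 := memlp_smul (s := s) (f := 0) 0
    have hz : (fun n => (weight s n : ℂ) * coeff ⇑(0 : C(S1, ℝ)) n) = 0 := by
      funext n
      have := coeff_smul 0 0 n
      rw [zero_smul, Complex.ofReal_zero, zero_mul] at this
      rw [this, mul_zero, Pi.zero_apply]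
    change Memℓp _ 2
    rw [hz]
    exact zero_memℓp
  smul_mem' := fun c _ hf => memlp_smul c hf

/-- The Sobolev space `H^s(S¹)` of real functions, used for `s > 1/2`, where every class has a
unique continuous representative, so that an element is an actual function on the circle. -/
def Hs (s : ℝ) : Type := ↥(hsSubmodule s)

namespace Hs

variable {s : ℝ}

instance : AddCommGroup (Hs s) := inferInstanceAs (AddCommGroup ↥(hsSubmodule s))

instance : Module ℝ (Hs s) := inferInstanceAs (Module ℝ ↥(hsSubmodule s))

/-- The underlying continuous function. -/
def toCont (f : Hs s) : C(S1, ℝ) := f.1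

instance : CoeFun (Hs s) (fun _ => S1 → ℝ) := ⟨fun f => ⇑f.toCont⟩

/-- The weighted Fourier transform `f ↦ ((1 + n²)^{s/2} f̂(n))ₙ` into `ℓ²(ℤ)`. -/
def toLp (s : ℝ) : Hs s →ₗ[ℝ] lp (fun _ : ℤ => ℂ) 2 where
  toFun f := ⟨fun n => (weight s n : ℂ) * coeff f n, f.2⟩
  map_add' f g := by
    apply Subtype.ext
    funext n
    change (weight s n : ℂ) * coeff ⇑(f.toCont + g.toCont) n =
      (weight s n : ℂ) * coeff f n + (weight s n : ℂ) * coeff g n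
    rw [coeff_add, mul_add]
  map_smul' c f := by
    apply Subtype.ext
    funext n
    change (weight s n : ℂ) * coeff ⇑(c • f.toCont) n = c • ((weight s n : ℂ) * coeff f n)
    rw [coeff_smul, Complex.real_smul]
    ring

theorem toLp_injective (s : ℝ) : Function.Injective (toLp s) := by
  rw [injective_iff_map_eq_zero]
  intro f hf
  apply Subtype.ext
  apply coeff_injective
  intro n
  have h : (weight s n : ℂ) * coeff f n = 0 :=
    congrArg (fun q : lp (fun _ : ℤ => ℂ) 2 => (q : ℤ → ℂ) n) hf
  have hw : (weight s n : ℂ) ≠ 0 := by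
    have : 0 < weight s n := Real.rpow_pos_of_pos (by positivity) _
    exact_mod_cast this.ne'
  exact (mul_eq_zero.mp h).resolve_left hw

/-- The Sobolev norm, `‖f‖² = ∑ₙ (1 + n²)^s |f̂(n)|²`. -/
instance : NormedAddCommGroup (Hs s) :=
  NormedAddCommGroup.induced (Hs s) (lp (fun _ : ℤ => ℂ) 2) (toLp s) (toLp_injective s)

instance : NormedSpace ℝ (Hs s) := NormedSpace.induced ℝ (Hs s) (lp (fun _ : ℤ => ℂ) 2) (toLp s)

theorem norm_sq_eq (f : Hs s) :
    ‖f‖ ^ 2 = ∑' n : ℤ, (1 + (n : ℝ) ^ 2) ^ s * ‖coeff f n‖ ^ 2 := by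
  have h := lp.norm_rpow_eq_tsum (p := 2) (by norm_num) (toLp s f)
  have e : ‖f‖ = ‖toLp s f‖ := rfl
  simp only [ENNReal.toReal_ofNat, Real.rpow_ofNat] at h
  rw [e, h]
  refine tsum_congr fun n => ?_
  change ‖(weight s n : ℂ) * coeff f n‖ ^ 2 = _
  have h1 : (0 : ℝ) ≤ 1 + (n : ℝ) ^ 2 := by positivity
  rw [norm_mul, mul_pow, Complex.norm_real, Real.norm_eq_abs, sq_abs, weight,
    ← Real.rpow_natCast, ← Real.rpow_mul h1]
  norm_num

end Hs

/-- `φ : S¹ → S¹` is of Sobolev class `H^s`: it has a degree `d` and differs from `x ↦ d x` by a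
real function in `H^s(S¹)`. -/
def IsHsMap (s : ℝ) (φ : S1 → S1) : Prop :=
  ∃ (d : ℤ) (f : Hs s), ∀ x, φ x = d • x + ((f x : ℝ) : S1)

/-- `𝒟^s(S¹)`: the bijections of the circle that are of class `H^s` together with their inverse. -/
def Ds (s : ℝ) : Type := {η : S1 ≃ S1 // IsHsMap s η ∧ IsHsMap s η.symm}

namespace Ds

variable {s : ℝ}

instance : CoeFun (Ds s) (fun _ => S1 → S1) := ⟨fun η => ⇑η.1⟩

/-- The inverse diffeomorphism, as a map. -/
def inv (η : Ds s) : S1 → S1 := η.1.symm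

theorem isHsMap_id (s : ℝ) : IsHsMap s (id : S1 → S1) := by
  refine ⟨1, 0, fun x => ?_⟩
  have h : ((0 : Hs s) x : ℝ) = 0 := rfl
  rw [h]
  simp

/-- The identity `e`. -/
def e (s : ℝ) : Ds s := ⟨Equiv.refl S1, isHsMap_id s, isHsMap_id s⟩

/-- The curve `η` in the manifold `𝒟^s(S¹)` has, at time `t` and within `I`, the velocity `v`.
Tangent vectors of `𝒟^s(S¹)` at `η` are identified with functions in `H^s(S¹)` through the
trivialization `TS¹ = S¹ × ℝ`, and the derivative is taken in the exponential chart
`g ↦ exp_{η t} g = η t + g mod 2π` of `𝒟^s(S¹)` around `η t`. -/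
def HasVelocityWithinAt (η : ℝ → Ds s) (v : Hs s) (I : Set ℝ) (t : ℝ) : Prop :=
  ∃ g : ℝ → Hs s, g t = 0 ∧
    (∀ᶠ τ in 𝓝[I] t, ∀ x, η τ x = η t x + ((g τ x : ℝ) : S1)) ∧
    HasDerivWithinAt g v I t

/-- The map `Φ` into the manifold `𝒟^s(S¹)` is of class `C^k` on `A`: around every point `p` of
`A` it is so in the exponential chart of `𝒟^s(S¹)` around `Φ p`. -/
def IsContDiffOn {E : Type*} [NormedAddCommGroup E] [NormedSpace ℝ E] (k : ℕ∞)
    (Φ : E → Ds s) (A : Set E) : Prop :=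
  ∀ p ∈ A, ∃ g : E → Hs s, g p = 0 ∧
    (∀ᶠ q in 𝓝[A] p, ∀ x, Φ q x = Φ p x + ((g q x : ℝ) : S1)) ∧
    ContDiffWithinAt ℝ k g A p

end Ds

/-- The derivative `h_y` of a function on the circle. -/
def dy (h : S1 → ℝ) (y : S1) : ℝ := deriv (fun τ : ℝ => h (y + (τ : S1))) 0

/-- The operator `(1 - ∂_y²)⁻¹ ∂_y`, which multiplies the `n`-th Fourier coefficient by
`i n / (1 + n²)`. -/
def invHelmholtzDy (h : S1 → ℝ) (y : S1) : ℝ :=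
  (∑' n : ℤ, ((1 + (n : ℂ) ^ 2)⁻¹ * (Complex.I * (n : ℂ)) * coeff h n) * fourier n y).re

/-- The right-hand side `-[(1 - ∂_y²)⁻¹ ∂_y (u² + ½ (u_y)²)] ∘ η`, with `u = v ∘ η⁻¹`, of the
Lagrangian Camassa-Holm equation at the state `(η, η̇) = (η, v)`. -/
def chSpray {s : ℝ} (η : Ds s) (v : Hs s) : S1 → ℝ :=
  let u : S1 → ℝ := fun y => v (η.inv y)
  fun x => -(invHelmholtzDy (fun y => u y ^ 2 + 1 / 2 * dy u y ^ 2) (η x))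

/-- `(η, v)` is, on the set of times `I` containing `0`, a solution that is `C¹` in time with
values in `𝒟^s(S¹) × H^s(S¹)` of the Lagrangian Camassa-Holm equation with `η(0) = e`,
`η̇(0) = u₀`, where `v = η̇`. -/
structure IsSolution (s : ℝ) (I : Set ℝ) (u₀ : Hs s) (η : ℝ → Ds s) (v : ℝ → Hs s) : Prop where
  init_pos : η 0 = Ds.e s
  init_vel : v 0 = u₀
  velocity : ∀ t ∈ I, Ds.HasVelocityWithinAt η (v t) I t
  acceleration : ∃ a : ℝ → Hs s, ContinuousOn a I ∧
    ∀ t ∈ I, HasDerivWithinAt v (a t) I t ∧ ∀ x, a t x = chSpray (η t) (v t) x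

end CamassaHolm

end

/-!
Written for `f = η - id` and `v = ∂ₜ η`, the Camassa-Holm equation is an ordinary differential
equation `∂ₜ f = v`, `∂ₜ v = S(f, v)` without loss of derivatives, and the theorem is the theory of
smooth ordinary differential equations on the Banach space `H^s × H^s`. Below, primes are
derivatives in the space variable.

*The spray.* Since `1 - ∂² = (1 - ∂)(1 + ∂)`, the operator `(1 - ∂²)⁻¹ ∂` is half the difference of
`(1 - ∂)⁻¹` and `(1 + ∂)⁻¹` (`invHelmholtzDy_eq`). Composition with a diffeomorphism `η` of
derivative `a` turns the resolvent equations `p ∓ p' = h` into first-order equations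
`a q ∓ q' = a (h ∘ η)`, and for `h = u² + ½ u_y²`, `u = v ∘ η⁻¹`, the right-hand side is
`a v² + ½ v'² / a`: the inverse of `η` is gone (`exists_chSpray_eq`). For `η = id + f` the operators
`q ↦ (1 + f') q ∓ q'` from `H^s` to `H^{s-1}` depend affinely on `f`, because `H^{s-1}` is an
algebra for `s > 3/2`, and they are invertible at `f = 0`, where they are Fourier multipliers. As
the inversion of operators is smooth, the spray is a smooth map into `H^s` near `f = 0`
(`contDiffOn_sprayHs`, `sprayHs_apply`).

*Diffeomorphisms near the identity.* If `|f'| < 1/2`, then `id + f` is a bijection by the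
contraction principle. Its inverse `ζ` satisfies `ζ = id - f ∘ ζ`, so that it is of class `H^s` as
soon as composition with `ζ` is bounded in `H^s` (`PosDiffeo.compBounded`). This holds in `L²` by
substitution and in `H¹` by the chain rule; in between, it follows by interpolation, with the norm
of `H^ρ` expressed through the `K`-functional of `L²` and `H¹` (`lintegral_kSq`). The chain rule
`(F ∘ ζ)' = (b F') ∘ ζ`, with `b` in `H^{s-1}`, leads from `H^{ρ-1}` to `H^ρ` for `1 ≤ ρ ≤ s`.

*Existence.* The flow of a smooth vector field on a Banach space is smooth in time and initial value
together: the integral equation for the path, rescaled to `[0, 1]`, is solved by the implicit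
function theorem in `C([0, 1], E)`, where superposition operators are smooth (`exists_smooth_flow`).

*Uniqueness.* A solution may leave the chart around the identity, so two solutions are compared near
an arbitrary time at which they agree. There the `C¹` norm suffices: the maximum principle for
`a q - κ q' = b` (`HasCircleDeriv.abs_le`) shows that the spray is locally Lipschitz in `C¹`
(`exists_spray_lipschitz`), and Grönwall's inequality applies. Hence the set of times of agreement
is open and closed in the interval.
-/

noncomputable section

namespace CamassaHolm

section FourierSeries

open scoped ENNReal NNReal

/-! ### Sobolev weights and weighted square sums -/

theorem weight_pos (s : ℝ) (n : ℤ) : 0 < weight s n := Real.rpow_pos_of_pos (by positivity) _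

theorem weight_add (s r : ℝ) (n : ℤ) : weight (s + r) n = weight s n * weight r n := by
  rw [weight, weight, weight, ← Real.rpow_add (by positivity)]
  ring_nf

theorem weight_zero (n : ℤ) : weight 0 n = 1 := by simp [weight]

theorem weight_neg_index (s : ℝ) (n : ℤ) : weight s (-n) = weight s n := by simp [weight]

theorem weight_mono {s r : ℝ} (h : s ≤ r) (n : ℤ) : weight s n ≤ weight r n := by
  unfold weight
  exact Real.rpow_le_rpow_of_exponent_le (by nlinarith [sq_nonneg (n : ℝ)]) (by linarith)

theorem weight_two (n : ℤ) : weight 2 n = 1 + (n : ℝ) ^ 2 := by simp [weight]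

theorem weight_one_sq (n : ℤ) : weight 1 n ^ 2 = 1 + (n : ℝ) ^ 2 := by
  rw [sq, ← weight_add, ← weight_two]
  norm_num

theorem weight_le_of_sq_le {ρ : ℝ} (hρ : 0 ≤ ρ) {n m : ℤ} (h : (n : ℝ) ^ 2 ≤ 4 * (m : ℝ) ^ 2) :
    weight ρ n ≤ 4 ^ (ρ / 2) * weight ρ m := by
  unfold weight
  rw [← Real.mul_rpow (by norm_num) (by positivity)]
  exact Real.rpow_le_rpow (by positivity) (by linarith) (by linarith)

/-- A form of Peetre's inequality adapted to products of functions of different regularity. -/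
theorem weight_le_add {ρ σ : ℝ} (h0 : 0 ≤ ρ) (h : ρ ≤ σ) (n k : ℤ) :
    weight ρ n ≤ 4 ^ (ρ / 2) *
      (weight ρ (n - k) + weight σ k * (weight (-σ) (n - k) * weight ρ (n - k))) := by
  have hc : (0 : ℝ) < 4 ^ (ρ / 2) := Real.rpow_pos_of_pos (by norm_num) _
  rw [← weight_add]
  -- `|n|` is at most twice the larger one of `|k|` and `|n - k|`
  rcases le_total ((k : ℝ) ^ 2) (((n - k : ℤ) : ℝ) ^ 2) with hk | hk
  · refine (weight_le_of_sq_le h0 (m := n - k) ?_).trans ?_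
    · push_cast at hk ⊢
      nlinarith [sq_nonneg ((n : ℝ) - 2 * k)]
    · gcongr
      exact le_add_of_nonneg_right (mul_pos (weight_pos _ _) (weight_pos _ _)).le
  · refine (weight_le_of_sq_le h0 (m := k) ?_).trans ?_
    · push_cast at hk ⊢
      nlinarith [sq_nonneg ((n : ℝ) - 2 * k)]
    · gcongr
      refine le_trans ?_ (le_add_of_nonneg_left (weight_pos _ _).le)
      have h1 : weight ρ k = weight σ k * weight (-σ + ρ) k := by
        rw [← weight_add]
        ring_nf
      rw [h1]
      refine mul_le_mul_of_nonneg_left ?_ (weight_pos _ _).le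
      unfold weight
      exact Real.rpow_le_rpow_of_nonpos (by positivity) (by linarith) (by linarith)

theorem summable_weight_neg {σ : ℝ} (hσ : 1 / 2 < σ) : Summable fun n : ℤ => weight (-σ) n ^ 2 := by
  have h1 : Summable fun n : ℤ => |(n : ℝ)| ^ (-(2 * σ)) :=
    Real.summable_abs_int_rpow (by linarith)
  refine Summable.of_norm_bounded_eventually (g := fun n : ℤ => |(n : ℝ)| ^ (-(2 * σ))) h1 ?_
  have h0 : ∀ᶠ n : ℤ in cofinite, n ≠ 0 := (finite_singleton (0 : ℤ)).eventually_cofinite_notMem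
  filter_upwards [h0] with n hn
  have hn' : (0 : ℝ) < |(n : ℝ)| := by positivity
  rw [Real.norm_of_nonneg (by positivity), weight, ← Real.rpow_natCast,
    ← Real.rpow_mul (by positivity)]
  have h2 : |(n : ℝ)| ^ (-(2 * σ)) = ((n : ℝ) ^ 2) ^ (-σ) := by
    rw [← sq_abs, ← Real.rpow_natCast, ← Real.rpow_mul (abs_nonneg _)]
    push_cast
    ring_nf
  rw [h2]
  have h3 : -σ / 2 * ((2 : ℕ) : ℝ) = -σ := by push_cast; ring
  rw [h3]
  have : (0 : ℝ) < (n : ℝ) ^ 2 := by positivity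
  exact Real.rpow_le_rpow_of_nonpos this (by linarith) (by linarith)

theorem ennreal_two_mul_le_add_sq (x y : ℝ≥0∞) : 2 * (x * y) ≤ x ^ 2 + y ^ 2 := by
  rcases eq_or_ne x ⊤ with rfl | hx
  · simp
  rcases eq_or_ne y ⊤ with rfl | hy
  · simp
  lift x to NNReal using hx
  lift y to NNReal using hy
  norm_cast
  rw [← NNReal.coe_le_coe]
  push_cast
  nlinarith [sq_nonneg ((x : ℝ) - y)]

theorem ennreal_add_sq_le (x y : ℝ≥0∞) : (x + y) ^ 2 ≤ 2 * (x ^ 2 + y ^ 2) := by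
  have h := ennreal_two_mul_le_add_sq x y
  calc (x + y) ^ 2 = x ^ 2 + y ^ 2 + 2 * (x * y) := by ring
    _ ≤ x ^ 2 + y ^ 2 + (x ^ 2 + y ^ 2) := by gcongr
    _ = _ := by ring

/-- Jensen's inequality for the square and the weights `α`. -/
theorem sq_tsum_mul_le {ι : Type*} (α β : ι → ℝ≥0∞) :
    (∑' k, α k * β k) ^ 2 ≤ (∑' k, α k) * ∑' k, α k * β k ^ 2 := by
  have h1 : 2 * (∑' k, α k * β k) ^ 2 = ∑' k, ∑' l, α k * α l * (2 * (β k * β l)) := by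
    rw [sq, ← ENNReal.tsum_mul_right, ← ENNReal.tsum_mul_left]
    refine tsum_congr fun k => ?_
    rw [← ENNReal.tsum_mul_left, ← ENNReal.tsum_mul_left]
    exact tsum_congr fun l => by ring
  have h2 : ∑' k, ∑' l, α k * α l * (β k ^ 2 + β l ^ 2)
      = 2 * ((∑' k, α k) * ∑' k, α k * β k ^ 2) := by
    have e1 : ∑' k, ∑' l, α k * α l * β k ^ 2 = (∑' k, α k) * ∑' k, α k * β k ^ 2 := by
      rw [← ENNReal.tsum_mul_left]
      refine tsum_congr fun k => ?_
      rw [← ENNReal.tsum_mul_right]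
      exact tsum_congr fun l => by ring
    have e2 : ∑' k, ∑' l, α k * α l * β l ^ 2 = (∑' k, α k) * ∑' k, α k * β k ^ 2 := by
      rw [ENNReal.tsum_comm, ← e1]
      exact tsum_congr fun k => tsum_congr fun l => by ring
    rw [two_mul]
    nth_rewrite 1 [← e1]
    rw [← e2, ← ENNReal.tsum_add]
    refine tsum_congr fun k => ?_
    rw [← ENNReal.tsum_add]
    exact tsum_congr fun l => by ring
  have h3 : 2 * (∑' k, α k * β k) ^ 2 ≤ 2 * ((∑' k, α k) * ∑' k, α k * β k ^ 2) := by
    rw [h1, ← h2]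
    gcongr
    exact ennreal_two_mul_le_add_sq _ _
  exact (ENNReal.mul_le_mul_iff_right (by norm_num) (by norm_num)).mp h3

/-- Young's inequality `ℓ¹ * ℓ² ⊆ ℓ²`. -/
theorem tsum_sq_conv_le (α β : ℤ → ℝ≥0∞) :
    ∑' n, (∑' k, α k * β (n - k)) ^ 2 ≤ (∑' k, α k) ^ 2 * ∑' n, β n ^ 2 := by
  calc ∑' n, (∑' k, α k * β (n - k)) ^ 2
      ≤ ∑' n, (∑' k, α k) * ∑' k, α k * β (n - k) ^ 2 :=
        ENNReal.tsum_le_tsum fun n => sq_tsum_mul_le _ _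
    _ = (∑' k, α k) * ∑' k, ∑' n, α k * β (n - k) ^ 2 := by
        rw [ENNReal.tsum_mul_left, ENNReal.tsum_comm]
    _ = (∑' k, α k) * ∑' k, α k * ∑' n, β n ^ 2 := by
        congr 1
        refine tsum_congr fun k => ?_
        rw [ENNReal.tsum_mul_left]
        congr 1
        exact (Equiv.subRight k).tsum_eq fun m => β m ^ 2
    _ = _ := by
        rw [ENNReal.tsum_mul_right]
        ring

theorem tsum_sq_conv_le' (α β : ℤ → ℝ≥0∞) :
    ∑' n, (∑' k, α k * β (n - k)) ^ 2 ≤ (∑' n, α n ^ 2) * (∑' k, β k) ^ 2 := by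
  have h := tsum_sq_conv_le β α
  rw [mul_comm] at h
  refine le_of_eq_of_le (tsum_congr fun n => ?_) h
  congr 1
  rw [← (Equiv.subLeft n).tsum_eq]
  refine tsum_congr fun k => ?_
  simp [mul_comm]

/-- The squared Sobolev norm `∑ₙ (1 + n²)^ρ |cₙ|²`, possibly infinite, of a sequence of Fourier
coefficients. -/
def sobSq (ρ : ℝ) (c : ℤ → ℂ) : ℝ≥0∞ := ∑' n, (ENNReal.ofReal (weight ρ n) * ‖c n‖ₑ) ^ 2

/-- The squared norm of `ℓ²(ℤ) → ℓ¹(ℤ)`, multiplication by the weight of order `-σ`. -/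
def embConst (σ : ℝ) : ℝ≥0∞ := ∑' n, ENNReal.ofReal (weight (-σ) n) ^ 2

theorem embConst_ne_top {σ : ℝ} (hσ : 1 / 2 < σ) : embConst σ ≠ ⊤ := by
  have h := (summable_weight_neg hσ).tsum_ofReal_ne_top
  convert h using 1
  refine tsum_congr fun n => ?_
  rw [ENNReal.ofReal_pow (weight_pos _ _).le]

theorem sq_tsum_weight_mul_le (σ : ℝ) (x : ℤ → ℝ≥0∞) :
    (∑' n, ENNReal.ofReal (weight (-σ) n) * x n) ^ 2 ≤ embConst σ * ∑' n, x n ^ 2 := by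
  have hw : ∀ n, ENNReal.ofReal (weight (-σ) n) * ENNReal.ofReal (weight σ n) = 1 := fun n => by
    rw [← ENNReal.ofReal_mul (weight_pos _ _).le, ← weight_add]
    simp [weight_zero]
  have h := sq_tsum_mul_le (fun n => ENNReal.ofReal (weight (-σ) n) ^ 2)
    (fun n => ENNReal.ofReal (weight σ n) * x n)
  refine (le_of_eq ?_).trans (h.trans_eq ?_)
  · congr 1
    refine tsum_congr fun n => ?_
    rw [sq, mul_assoc, ← mul_assoc _ _ (x n), hw, one_mul]
  · rw [embConst]
    congr 1
    refine tsum_congr fun n => ?_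
    rw [mul_pow, ← mul_assoc, ← mul_pow, hw, one_pow, one_mul]

/-- `H^σ ⊆ A(S¹)` for `σ > 1/2`, where `A(S¹)` is the Wiener algebra. -/
theorem sq_tsum_enorm_le (σ : ℝ) (c : ℤ → ℂ) :
    (∑' n, ‖c n‖ₑ) ^ 2 ≤ embConst σ * sobSq σ c := by
  refine (le_of_eq ?_).trans (sq_tsum_weight_mul_le σ _)
  congr 1
  refine tsum_congr fun n => ?_
  rw [← mul_assoc, ← ENNReal.ofReal_mul (weight_pos _ _).le, ← weight_add]
  simp [weight_zero]

theorem summable_of_sobSq_ne_top {σ : ℝ} (hσ : 1 / 2 < σ) {c : ℤ → ℂ} (hc : sobSq σ c ≠ ⊤) :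
    Summable c := by
  have h : ∑' n, ‖c n‖ₑ ≠ ⊤ := by
    intro h
    have := sq_tsum_enorm_le σ c
    rw [h] at this
    simp only [ne_eq, OfNat.ofNat_ne_zero, not_false_eq_true, ENNReal.top_pow, top_le_iff] at this
    exact ENNReal.mul_ne_top (embConst_ne_top hσ) hc this
  exact Summable.of_enorm h

/-- The convolution of two sequences. -/
def conv (a b : ℤ → ℂ) (n : ℤ) : ℂ := ∑' k, a k * b (n - k)

/-- Multiplication is bounded from `H^σ × H^ρ` to `H^ρ` for `σ > 1/2` and `0 ≤ ρ ≤ σ`. -/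
theorem exists_sobSq_conv_le {ρ σ : ℝ} (h0 : 0 ≤ ρ) (h : ρ ≤ σ) (hσ : 1 / 2 < σ) :
    ∃ K : ℝ≥0∞, K ≠ ⊤ ∧ ∀ a b, sobSq ρ (conv a b) ≤ K * (sobSq σ a * sobSq ρ b) := by
  set C : ℝ≥0∞ := ENNReal.ofReal (4 ^ (ρ / 2)) with hC
  refine ⟨C ^ 2 * (4 * embConst σ), ?_, fun a b => ?_⟩
  · exact ENNReal.mul_ne_top (by simp [hC])
      (ENNReal.mul_ne_top (by norm_num) (embConst_ne_top hσ))
  -- the two terms of `weight_le_add` give convolutions of a sequence in `ℓ²` with one in `ℓ¹`: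
  -- `B * |a|` and `A * B'`, where `|a|` and `B'` are summable by the embedding for `σ > 1/2`
  let B : ℤ → ℝ≥0∞ := fun m => ENNReal.ofReal (weight ρ m) * ‖b m‖ₑ
  let A : ℤ → ℝ≥0∞ := fun m => ENNReal.ofReal (weight σ m) * ‖a m‖ₑ
  let B' : ℤ → ℝ≥0∞ := fun m => ENNReal.ofReal (weight (-σ) m) * B m
  have hpt : ∀ n, ENNReal.ofReal (weight ρ n) * ‖conv a b n‖ₑ ≤
      C * ((∑' k, ‖a k‖ₑ * B (n - k)) + ∑' k, A k * B' (n - k)) := by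
    intro n
    calc ENNReal.ofReal (weight ρ n) * ‖conv a b n‖ₑ
        ≤ ENNReal.ofReal (weight ρ n) * ∑' k, ‖a k * b (n - k)‖ₑ := by
          gcongr
          exact enorm_tsum_le_tsum_enorm
      _ = ∑' k, ENNReal.ofReal (weight ρ n) * (‖a k‖ₑ * ‖b (n - k)‖ₑ) := by
          rw [← ENNReal.tsum_mul_left]
          simp only [enorm_mul]
      _ ≤ ∑' k, C * (‖a k‖ₑ * B (n - k) + A k * B' (n - k)) := by
          refine ENNReal.tsum_le_tsum fun k => ?_
          have h1 := ENNReal.ofReal_le_ofReal (weight_le_add h0 h n k)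
          rw [ENNReal.ofReal_mul (by positivity), ENNReal.ofReal_add (weight_pos _ _).le
            (mul_pos (weight_pos _ _) (mul_pos (weight_pos _ _) (weight_pos _ _))).le,
            ENNReal.ofReal_mul (weight_pos _ _).le, ENNReal.ofReal_mul (weight_pos _ _).le] at h1
          calc _ ≤ _ := mul_le_mul_left h1 _
            _ = _ := by simp only [A, B, B']; ring
      _ = _ := by rw [ENNReal.tsum_mul_left, ENNReal.tsum_add]
  calc sobSq ρ (conv a b)
      ≤ ∑' n, C ^ 2 * (2 * ((∑' k, ‖a k‖ₑ * B (n - k)) ^ 2 + (∑' k, A k * B' (n - k)) ^ 2)) := by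
        refine ENNReal.tsum_le_tsum fun n => ?_
        calc _ ≤ _ := pow_le_pow_left₀ zero_le (hpt n) 2
          _ = C ^ 2 * ((∑' k, ‖a k‖ₑ * B (n - k)) + ∑' k, A k * B' (n - k)) ^ 2 := mul_pow _ _ _
          _ ≤ _ := by
            gcongr
            exact ennreal_add_sq_le _ _
    _ = C ^ 2 * (2 * ((∑' n, (∑' k, ‖a k‖ₑ * B (n - k)) ^ 2) +
          ∑' n, (∑' k, A k * B' (n - k)) ^ 2)) := by
        rw [ENNReal.tsum_mul_left, ENNReal.tsum_mul_left, ENNReal.tsum_add]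
    _ ≤ C ^ 2 * (2 * ((∑' k, ‖a k‖ₑ) ^ 2 * (∑' n, B n ^ 2) +
          (∑' n, A n ^ 2) * (∑' k, B' k) ^ 2)) := by
        gcongr
        · exact tsum_sq_conv_le _ _
        · exact tsum_sq_conv_le' _ _
    _ ≤ C ^ 2 * (2 * ((embConst σ * sobSq σ a) * sobSq ρ b +
          sobSq σ a * (embConst σ * sobSq ρ b))) := by
        gcongr
        · exact sq_tsum_enorm_le σ a
        · exact le_rfl
        · exact le_rfl
        · exact sq_tsum_weight_mul_le σ B
    _ = _ := by ring

/-! ### Fourier coefficients of continuous functions -/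

/-- The `n`-th Fourier coefficient as a continuous linear functional on continuous functions. -/
def coeffL (n : ℤ) : C(S1, ℂ) →L[ℂ] ℂ :=
  LinearMap.mkContinuous
    { toFun := fun F => fourierCoeff (F : S1 → ℂ) n
      map_add' := fun F G => by
        have hF : MeasureTheory.Integrable (F : S1 → ℂ) AddCircle.haarAddCircle :=
          F.continuous.integrable_of_hasCompactSupport (HasCompactSupport.of_compactSpace _)
        have hG : MeasureTheory.Integrable (G : S1 → ℂ) AddCircle.haarAddCircle :=
          G.continuous.integrable_of_hasCompactSupport (HasCompactSupport.of_compactSpace _)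
        exact congrFun (fourierCoeff.add hF hG) n
      map_smul' := fun c F => fourierCoeff.const_smul (F : S1 → ℂ) c n } 1 fun F => by
    have h := MeasureTheory.norm_integral_le_of_norm_le_const
      (μ := (AddCircle.haarAddCircle : MeasureTheory.Measure S1)) (C := ‖F‖)
      (f := fun t => fourier (-n) t • F t) (MeasureTheory.ae_of_all _ fun t => by
        rw [norm_smul]
        calc ‖fourier (-n) t‖ * ‖F t‖ ≤ 1 * ‖F‖ := by
              gcongr
              · exact ((fourier (-n)).norm_coe_le_norm t).trans_eq (fourier_norm (-n))
              · exact F.norm_coe_le_norm t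
          _ = ‖F‖ := one_mul _)
    rw [MeasureTheory.probReal_univ, mul_one] at h
    rw [one_mul]
    exact h

theorem coeffL_apply (n : ℤ) (F : C(S1, ℂ)) : coeffL n F = fourierCoeff (F : S1 → ℂ) n := rfl

theorem coeffL_fourier (n k : ℤ) : coeffL n (fourier k) = if n = k then 1 else 0 := by
  rw [coeffL_apply, fourierCoeff_fourier, Pi.single_apply]

theorem coeffL_fourier_mul (n k : ℤ) (G : C(S1, ℂ)) :
    coeffL n (fourier k * G) = coeffL (n - k) G := by
  rw [coeffL_apply, coeffL_apply, fourierCoeff, fourierCoeff]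
  congr 1
  funext t
  rw [ContinuousMap.mul_apply, smul_eq_mul, smul_eq_mul, ← mul_assoc, ← fourier_add]
  congr 3
  ring

theorem hasSum_fourier {c : ℤ → ℂ} (hc : Summable c) :
    HasSum (fun n => c n • (fourier n : C(S1, ℂ))) (∑' n, c n • (fourier n : C(S1, ℂ))) := by
  refine (Summable.of_norm ?_).hasSum
  simpa [norm_smul, fourier_norm] using hc.norm

theorem coeffL_tsum {c : ℤ → ℂ} (hc : Summable c) (n : ℤ) :
    coeffL n (∑' k, c k • (fourier k : C(S1, ℂ))) = c n := by
  have h := (hasSum_fourier hc).mapL (coeffL n)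
  refine h.unique ?_
  have : (fun k => coeffL n (c k • (fourier k : C(S1, ℂ)))) =
      fun k => if k = n then c n else 0 := by
    funext k
    rw [map_smul, coeffL_fourier]
    by_cases h : k = n
    · simp [h]
    · simp [h, Ne.symm h]
  rw [this]
  exact hasSum_ite_eq n (c n)

/-- The Fourier coefficients of a product are the convolution of the Fourier coefficients. -/
theorem coeffL_mul {F : C(S1, ℂ)} (hF : Summable fun n => coeffL n F) (G : C(S1, ℂ)) (n : ℤ) :
    coeffL n (F * G) = conv (fun k => coeffL k F) (fun k => coeffL k G) n := by
  have h := hasSum_fourier_series_of_summable (f := F) hF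
  have h2 := (h.mul_right G).mapL (coeffL n)
  rw [← h2.tsum_eq, conv]
  refine tsum_congr fun k => ?_
  rw [smul_mul_assoc, map_smul, coeffL_fourier_mul, smul_eq_mul, coeffL_apply k]

/-- A real continuous function, viewed as a complex one. -/
def toComplex (f : C(S1, ℝ)) : C(S1, ℂ) := ⟨fun y => (f y : ℂ), by fun_prop⟩

theorem toComplex_apply (f : C(S1, ℝ)) (x : S1) : toComplex f x = (f x : ℂ) := rfl

theorem coeff_eq (f : C(S1, ℝ)) (n : ℤ) : coeff f n = coeffL n (toComplex f) := rfl

theorem coeff_neg (f : C(S1, ℝ)) (n : ℤ) : coeff f (-n) = starRingEnd ℂ (coeff f n) := by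
  rw [coeff, coeff, fourierCoeff, fourierCoeff, ← integral_conj]
  congr 1
  funext t
  rw [smul_eq_mul, smul_eq_mul, map_mul, Complex.conj_ofReal, fourier_neg (n := n),
    Complex.conj_conj, neg_neg]

theorem coeff_mul {f : C(S1, ℝ)} (hf : Summable (coeff f)) (g : C(S1, ℝ)) :
    coeff ⇑(f * g) = conv (coeff f) (coeff g) := by
  funext n
  have h := coeffL_mul (F := toComplex f) hf (toComplex g) n
  rw [coeff_eq]
  refine Eq.trans (congrArg _ ?_) h
  ext x
  simp [toComplex_apply]

theorem coeff_one (n : ℤ) : coeff ⇑(1 : C(S1, ℝ)) n = if n = 0 then 1 else 0 := by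
  rw [coeff_eq, ← coeffL_fourier]
  congr 1
  ext x
  simp [toComplex_apply]

/-- Functions with the same Fourier coefficients agree. -/
theorem eq_of_coeff_eq {f g : C(S1, ℝ)} (h : ∀ n, coeff f n = coeff g n) : f = g := by
  rw [← sub_eq_zero]
  apply coeff_injective
  intro n
  have := coeff_add (f - g) g n
  rw [sub_add_cancel, h] at this
  exact (left_eq_add.mp (by rw [add_comm]; exact this))

/-- The real function with given absolutely summable, conjugation symmetric Fourier
coefficients. -/
def ofCoeff (c : ℤ → ℂ) : C(S1, ℝ) :=
  ⟨fun x => ((∑' n, c n • (fourier n : C(S1, ℂ))) x).re, by fun_prop⟩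

theorem toComplex_ofCoeff {c : ℤ → ℂ} (hc : Summable c)
    (hsymm : ∀ n, c (-n) = starRingEnd ℂ (c n)) :
    toComplex (ofCoeff c) = ∑' n, c n • (fourier n : C(S1, ℂ)) := by
  ext x
  rw [toComplex_apply]
  change (((((∑' n, c n • (fourier n : C(S1, ℂ))) x).re : ℝ)) : ℂ) = _
  rw [← Complex.conj_eq_iff_re]
  have h : ∑' n, c n * fourier n x = (∑' n, c n • (fourier n : C(S1, ℂ))) x :=
    ((hasSum_fourier hc).mapL (ContinuousMap.evalCLM ℂ x)).tsum_eq
  rw [← h, Complex.conj_tsum, ← (Equiv.neg ℤ).tsum_eq]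
  refine tsum_congr fun n => ?_
  simp only [Equiv.neg_apply]
  rw [map_mul, hsymm, Complex.conj_conj, fourier_neg, Complex.conj_conj]

theorem coeff_ofCoeff {c : ℤ → ℂ} (hc : Summable c)
    (hsymm : ∀ n, c (-n) = starRingEnd ℂ (c n)) (n : ℤ) : coeff (ofCoeff c) n = c n := by
  rw [coeff_eq, toComplex_ofCoeff hc hsymm, coeffL_tsum hc]

/-! ### The Sobolev spaces as Banach spaces -/

theorem memlp_iff_sobSq_ne_top (ρ : ℝ) (c : ℤ → ℂ) :
    Memℓp (fun n => (weight ρ n : ℂ) * c n) 2 ↔ sobSq ρ c ≠ ⊤ := by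
  rw [memℓp_gen_iff (by norm_num)]
  simp only [ENNReal.toReal_ofNat, Real.rpow_ofNat, norm_mul, Complex.norm_real, Real.norm_eq_abs,
    abs_of_pos (weight_pos _ _)]
  have h : sobSq ρ c = ∑' n, ENNReal.ofReal ((weight ρ n * ‖c n‖) ^ 2) := by
    refine tsum_congr fun n => ?_
    rw [ENNReal.ofReal_pow (mul_nonneg (weight_pos _ _).le (norm_nonneg _)),
      ENNReal.ofReal_mul (weight_pos _ _).le, ofReal_norm]
  rw [h]
  constructor
  · exact fun hs => hs.tsum_ofReal_ne_top
  · intro hs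
    have h2 := ENNReal.summable_toReal hs
    refine h2.congr fun n => ?_
    rw [ENNReal.toReal_ofReal (sq_nonneg _)]

namespace Hs

variable {s : ℝ}

theorem ext_coeff {f g : Hs s} (h : ∀ n, coeff f n = coeff g n) : f = g :=
  Subtype.ext (eq_of_coeff_eq h)

theorem sobSq_ne_top (f : Hs s) : sobSq s (coeff f) ≠ ⊤ :=
  (memlp_iff_sobSq_ne_top s _).mp f.2

theorem enorm_sq (f : Hs s) : ‖f‖ₑ ^ 2 = sobSq s (coeff f) := by
  have h := (memℓp_gen_iff (by norm_num)).mp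
    (show Memℓp (fun n => (weight s n : ℂ) * coeff f n) 2 from f.2)
  simp only [ENNReal.toReal_ofNat, Real.rpow_ofNat, norm_mul, Complex.norm_real, Real.norm_eq_abs,
    abs_of_pos (weight_pos _ _)] at h
  have h1 : ‖f‖ ^ 2 = ∑' n, (weight s n * ‖coeff f n‖) ^ 2 := by
    have h2 := lp.norm_rpow_eq_tsum (p := 2) (by norm_num) (toLp s f)
    simp only [ENNReal.toReal_ofNat, Real.rpow_ofNat] at h2
    refine h2.trans (tsum_congr fun n => ?_)
    change ‖(weight s n : ℂ) * coeff f n‖ ^ 2 = _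
    rw [norm_mul, Complex.norm_real, Real.norm_eq_abs, abs_of_pos (weight_pos _ _)]
  rw [← ofReal_norm, ← ENNReal.ofReal_pow (norm_nonneg _), h1,
    ENNReal.ofReal_tsum_of_nonneg (fun n => sq_nonneg _) h]
  refine tsum_congr fun n => ?_
  rw [ENNReal.ofReal_pow (mul_nonneg (weight_pos _ _).le (norm_nonneg _)),
    ENNReal.ofReal_mul (weight_pos _ _).le, ofReal_norm]

theorem summable_coeff (hs : 1 / 2 < s) (f : Hs s) : Summable (coeff f) :=
  summable_of_sobSq_ne_top hs f.sobSq_ne_top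

/-- The element of `H^s` with given Fourier coefficients. -/
def mk (hs : 1 / 2 < s) (c : ℤ → ℂ) (hsymm : ∀ n, c (-n) = starRingEnd ℂ (c n))
    (hc : sobSq s c ≠ ⊤) : Hs s :=
  ⟨ofCoeff c, by
    have h : coeff (ofCoeff c) = c :=
      funext (coeff_ofCoeff (summable_of_sobSq_ne_top hs hc) hsymm)
    change Memℓp _ 2
    rw [h]
    exact (memlp_iff_sobSq_ne_top s c).mpr hc⟩

theorem coeff_mk (hs : 1 / 2 < s) (c : ℤ → ℂ) (hsymm : ∀ n, c (-n) = starRingEnd ℂ (c n))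
    (hc : sobSq s c ≠ ⊤) (n : ℤ) : coeff (mk hs c hsymm hc) n = c n :=
  coeff_ofCoeff (summable_of_sobSq_ne_top hs hc) hsymm n

theorem coeff_add' (f g : Hs s) (n : ℤ) : coeff (f + g : Hs s) n = coeff f n + coeff g n :=
  coeff_add f.toCont g.toCont n

theorem coeff_smul' (c : ℝ) (f : Hs s) (n : ℤ) : coeff (c • f : Hs s) n = c * coeff f n :=
  coeff_smul c f.toCont n

/-- The range of the weighted Fourier transform is the closed set of the sequences with the symmetry
of the coefficients of real functions. -/
theorem completeSpace (hs : 1 / 2 < s) : CompleteSpace (Hs s) := by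
  have hiso : Isometry (toLp s) := AddMonoidHomClass.isometry_of_norm _ fun _ => rfl
  rw [completeSpace_iff_isComplete_range hiso.isUniformInducing]
  apply IsClosed.isComplete
  have h : Set.range (toLp s) = {a | ∀ n, a (-n) = starRingEnd ℂ (a n)} := by
    ext a
    constructor
    · rintro ⟨f, rfl⟩ n
      change (weight s (-n) : ℂ) * coeff f (-n) = starRingEnd ℂ ((weight s n : ℂ) * coeff f n)
      rw [weight_neg_index, coeff_neg, map_mul, Complex.conj_ofReal]
    · intro ha
      have hw : ∀ n, (weight s n : ℂ) ≠ 0 := fun n => by exact_mod_cast (weight_pos s n).ne'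
      have e : (fun n => (weight s n : ℂ) * ((weight s n : ℂ)⁻¹ * a n)) = a := by
        funext n
        rw [mul_inv_cancel_left₀ (hw n)]
      have hc : sobSq s (fun n => (weight s n : ℂ)⁻¹ * a n) ≠ ⊤ := by
        rw [← memlp_iff_sobSq_ne_top, e]
        exact a.2
      refine ⟨mk hs (fun n => (weight s n : ℂ)⁻¹ * a n) (fun n => ?_) hc, ?_⟩
      · rw [ha n, map_mul, weight_neg_index, map_inv₀, Complex.conj_ofReal]
      · apply Subtype.ext
        refine Eq.trans (funext fun n => ?_) e
        change (weight s n : ℂ) * coeff _ n = _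
        rw [coeff_mk]
  rw [h, Set.ofPred_forall]
  refine isClosed_iInter fun n => isClosed_eq ?_ ?_
  · exact (lp.evalCLM ℂ (fun _ : ℤ => ℂ) 2 (-n)).continuous
  · exact Complex.continuous_conj.comp (lp.evalCLM ℂ (fun _ : ℤ => ℂ) 2 n).continuous

end Hs

theorem norm_le_of_enorm_sq_le {E F : Type*} [NormedAddCommGroup E] [NormedAddCommGroup F]
    {K : ℝ≥0∞} (hK : K ≠ ⊤) {x : E} {y : F} (h : ‖y‖ₑ ^ 2 ≤ K * ‖x‖ₑ ^ 2) :
    ‖y‖ ≤ Real.sqrt K.toReal * ‖x‖ := by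
  have h1 := ENNReal.toReal_mono (ENNReal.mul_ne_top hK (by simp)) h
  rw [ENNReal.toReal_mul, ENNReal.toReal_pow, ENNReal.toReal_pow, toReal_enorm, toReal_enorm] at h1
  refine (abs_le_of_sq_le_sq' ?_ (by positivity)).2
  rw [mul_pow, Real.sq_sqrt ENNReal.toReal_nonneg]
  exact h1

theorem sobSq_mono {r s : ℝ} (h : r ≤ s) (c : ℤ → ℂ) : sobSq r c ≤ sobSq s c := by
  refine ENNReal.tsum_le_tsum fun n => ?_
  gcongr
  exact weight_mono h n

/-- The sequence of Fourier coefficients of the derivative. -/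
def dcoeff (c : ℤ → ℂ) (n : ℤ) : ℂ := Complex.I * n * c n

theorem abs_le_weight_one (n : ℤ) : |(n : ℝ)| ≤ weight 1 n := by
  refine abs_le_of_sq_le_sq ?_ (weight_pos _ _).le
  rw [weight_one_sq]
  linarith

theorem enorm_intCast_le_weight_one (n : ℤ) : ‖(n : ℂ)‖ₑ ≤ ENNReal.ofReal (weight 1 n) := by
  rw [← ofReal_norm, Complex.norm_intCast]
  exact ENNReal.ofReal_le_ofReal (abs_le_weight_one n)

theorem sobSq_dcoeff_le (s : ℝ) (c : ℤ → ℂ) : sobSq (s - 1) (dcoeff c) ≤ sobSq s c := by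
  refine ENNReal.tsum_le_tsum fun n => pow_le_pow_left₀ zero_le ?_ 2
  have h : weight s n = weight (s - 1) n * weight 1 n := by rw [← weight_add, sub_add_cancel]
  rw [h, ENNReal.ofReal_mul (weight_pos _ _).le, mul_assoc, dcoeff, enorm_mul, enorm_mul,
    ← ofReal_norm Complex.I, Complex.norm_I, ENNReal.ofReal_one, one_mul]
  gcongr
  exact enorm_intCast_le_weight_one n

namespace Hs

variable {r s : ℝ}

/-- The embedding of `H^r`, `r > 1/2`, into the continuous functions. -/
def toContL (hr : 1 / 2 < r) : Hs r →L[ℝ] C(S1, ℝ) :=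
  LinearMap.mkContinuous
    { toFun := toCont
      map_add' := fun _ _ => rfl
      map_smul' := fun _ _ => rfl } (Real.sqrt (embConst r).toReal) fun f => by
    refine norm_le_of_enorm_sq_le (embConst_ne_top hr) ?_
    rw [enorm_sq]
    refine le_trans ?_ (sq_tsum_enorm_le r _)
    refine pow_le_pow_left₀ zero_le ?_ 2
    have hs := hasSum_fourier_series_of_summable (f := toComplex f.toCont) (f.summable_coeff hr)
    have h1 : ‖toComplex f.toCont‖ₑ ≤ ∑' n, ‖coeff f n‖ₑ := by
      rw [← hs.tsum_eq]
      refine enorm_tsum_le_tsum_enorm.trans (ENNReal.tsum_le_tsum fun n => ?_)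
      rw [enorm_smul, ← ofReal_norm (fourier n : C(S1, ℂ)), fourier_norm, ENNReal.ofReal_one,
        mul_one]
      exact le_rfl
    refine le_trans ?_ h1
    rw [← ofReal_norm, ← ofReal_norm]
    refine ENNReal.ofReal_le_ofReal ?_
    refine (ContinuousMap.norm_le _ (norm_nonneg _)).mpr fun x => ?_
    refine le_trans (le_of_eq ?_) ((toComplex f.toCont).norm_coe_le_norm x)
    rw [toComplex_apply, Complex.norm_real]
    rfl

theorem toContL_apply (hr : 1 / 2 < r) (f : Hs r) : toContL hr f = f.toCont := rfl

/-- A continuous function with finite Sobolev norm, as an element of `H^r`. -/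
def ofCont (g : C(S1, ℝ)) (hg : sobSq r (coeff g) ≠ ⊤) : Hs r :=
  ⟨g, (memlp_iff_sobSq_ne_top r _).mpr hg⟩

theorem toCont_ofCont (g : C(S1, ℝ)) (hg : sobSq r (coeff g) ≠ ⊤) : (ofCont g hg).toCont = g := rfl

theorem ext_toCont {f g : Hs r} (h : f.toCont = g.toCont) : f = g := Subtype.ext h

theorem toCont_add (f g : Hs r) : (f + g).toCont = f.toCont + g.toCont := rfl

theorem toCont_smul (c : ℝ) (f : Hs r) : (c • f).toCont = c • f.toCont := rfl

/-- A function in `H^s`, regarded as an element of `H^r`, `r ≤ s`. -/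
def incl (h : r ≤ s) (f : Hs s) : Hs r :=
  ofCont f.toCont (ne_top_of_le_ne_top f.sobSq_ne_top (sobSq_mono h _))

theorem toCont_incl (h : r ≤ s) (f : Hs s) : (incl h f).toCont = f.toCont := toCont_ofCont _ _

theorem enorm_incl_sq_le (h : r ≤ s) (f : Hs s) : ‖incl h f‖ₑ ^ 2 ≤ 1 * ‖f‖ₑ ^ 2 := by
  rw [enorm_sq, enorm_sq, one_mul, toCont_incl]
  exact sobSq_mono h _

/-- The inclusion `H^s ⊆ H^r`, `r ≤ s`. -/
def inclL (h : r ≤ s) : Hs s →L[ℝ] Hs r :=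
  LinearMap.mkContinuous
    { toFun := incl h
      map_add' := fun f g => ext_toCont (by
        rw [toCont_add, toCont_incl, toCont_incl, toCont_incl, toCont_add])
      map_smul' := fun c f => ext_toCont (by
        rw [RingHom.id_apply, toCont_smul, toCont_incl, toCont_incl, toCont_smul]) }
    (Real.sqrt (1 : ℝ≥0∞).toReal) fun f =>
    norm_le_of_enorm_sq_le ENNReal.one_ne_top (enorm_incl_sq_le h f)

theorem dcoeff_symm (f : C(S1, ℝ)) (n : ℤ) :
    dcoeff (coeff f) (-n) = starRingEnd ℂ (dcoeff (coeff f) n) := by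
  rw [dcoeff, dcoeff, coeff_neg, map_mul, map_mul, Complex.conj_I]
  simp

/-- The derivative of a function in `H^s`, `s > 3/2`, as an element of `H^{s-1}`. -/
def derivHs (hs : 3 / 2 < s) (f : Hs s) : Hs (s - 1) :=
  mk (by linarith) (dcoeff (coeff f)) (dcoeff_symm f.toCont)
    (ne_top_of_le_ne_top f.sobSq_ne_top (sobSq_dcoeff_le s _))

theorem coeff_derivHs (hs : 3 / 2 < s) (f : Hs s) (n : ℤ) :
    coeff (derivHs hs f) n = dcoeff (coeff f) n := by
  unfold derivHs
  rw [coeff_mk]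

theorem enorm_derivHs_sq_le (hs : 3 / 2 < s) (f : Hs s) :
    ‖derivHs hs f‖ₑ ^ 2 ≤ 1 * ‖f‖ₑ ^ 2 := by
  rw [enorm_sq, enorm_sq, one_mul, funext (coeff_derivHs hs f)]
  exact sobSq_dcoeff_le s _

/-- The derivative `H^s → H^{s-1}`, `s > 3/2`. -/
def derivL (hs : 3 / 2 < s) : Hs s →L[ℝ] Hs (s - 1) :=
  LinearMap.mkContinuous
    { toFun := derivHs hs
      map_add' := fun f g => ext_coeff fun n => by
        rw [coeff_add', coeff_derivHs, coeff_derivHs, coeff_derivHs, dcoeff, dcoeff, dcoeff,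
          coeff_add']
        ring
      map_smul' := fun c f => ext_coeff fun n => by
        rw [RingHom.id_apply, coeff_smul', coeff_derivHs, coeff_derivHs, dcoeff, dcoeff,
          coeff_smul']
        ring } (Real.sqrt (1 : ℝ≥0∞).toReal) fun f =>
    norm_le_of_enorm_sq_le ENNReal.one_ne_top (enorm_derivHs_sq_le hs f)

theorem coeff_derivL (hs : 3 / 2 < s) (f : Hs s) (n : ℤ) :
    coeff (derivL hs f) n = dcoeff (coeff f) n := coeff_derivHs hs f n

/-- The constant function `1`. -/
def one (r : ℝ) : Hs r :=
  ofCont 1 (by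
    rw [sobSq, tsum_eq_single 0]
    · rw [coeff_one, if_pos rfl]
      exact ENNReal.pow_ne_top (ENNReal.mul_ne_top ENNReal.ofReal_ne_top enorm_ne_top)
    · intro n hn
      rw [coeff_one, if_neg hn]
      simp)

theorem toCont_one (r : ℝ) : (one r).toCont = 1 := toCont_ofCont _ _

theorem mul_mem (hr : 1 / 2 < r) (f g : Hs r) :
    sobSq r (coeff ⇑(f.toCont * g.toCont)) ≠ ⊤ := by
  obtain ⟨K, hK, h⟩ := exists_sobSq_conv_le (by linarith) (le_refl r) hr
  rw [coeff_mul (f.summable_coeff hr)]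
  exact ne_top_of_le_ne_top (ENNReal.mul_ne_top hK
    (ENNReal.mul_ne_top f.sobSq_ne_top g.sobSq_ne_top)) (h _ _)

theorem toCont_inclL (h : r ≤ s) (f : Hs s) : (inclL h f).toCont = f.toCont := toCont_incl h f

/-- The product of two functions in `H^r`, `r > 1/2`. -/
def mul (hr : 1 / 2 < r) (f g : Hs r) : Hs r := ofCont (f.toCont * g.toCont) (mul_mem hr f g)

theorem toCont_mul (hr : 1 / 2 < r) (f g : Hs r) : (mul hr f g).toCont = f.toCont * g.toCont :=
  toCont_ofCont _ _

theorem exists_norm_mul_le (hr : 1 / 2 < r) :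
    ∃ C : ℝ, ∀ f g : Hs r, ‖mul hr f g‖ ≤ C * ‖f‖ * ‖g‖ := by
  obtain ⟨K, hK, h⟩ := exists_sobSq_conv_le (by linarith) (le_refl r) hr
  refine ⟨Real.sqrt K.toReal, fun f g => ?_⟩
  have h1 := h (coeff f) (coeff g)
  rw [← enorm_sq, ← enorm_sq, ← coeff_mul (f.summable_coeff hr), ← toCont_mul hr, ← enorm_sq,
    ← mul_pow, ← enorm_norm f, ← enorm_norm g, ← enorm_mul] at h1
  rw [mul_assoc]
  refine (norm_le_of_enorm_sq_le (x := ‖f‖ * ‖g‖) hK h1).trans_eq ?_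
  rw [norm_mul, norm_norm, norm_norm]

/-- Multiplication in the algebra `H^r`, `r > 1/2`. -/
def mulL (hr : 1 / 2 < r) : Hs r →L[ℝ] Hs r →L[ℝ] Hs r :=
  LinearMap.mkContinuous₂
    (LinearMap.mk₂ ℝ (mul hr)
      (fun f f' g => ext_toCont (by simp only [toCont_add, toCont_mul, add_mul]))
      (fun c f g => ext_toCont (by simp only [toCont_smul, toCont_mul, smul_mul_assoc]))
      (fun f g g' => ext_toCont (by simp only [toCont_add, toCont_mul, mul_add]))
      (fun c f g => ext_toCont (by simp only [toCont_smul, toCont_mul, mul_smul_comm])))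
    (exists_norm_mul_le hr).choose (exists_norm_mul_le hr).choose_spec

theorem toCont_mulL (hr : 1 / 2 < r) (f g : Hs r) :
    (mulL hr f g).toCont = f.toCont * g.toCont := toCont_mul hr f g

end Hs

/-! ### Differentiable functions on the circle -/

/-- `g` is the derivative of the function `f` on the circle. -/
def HasCircleDeriv {E : Type*} [NormedAddCommGroup E] [NormedSpace ℝ E] (f g : S1 → E) : Prop :=
  ∀ x : ℝ, HasDerivAt (fun τ : ℝ => f (τ : S1)) (g (x : S1)) x

theorem HasCircleDeriv.dy_eq {f g : S1 → ℝ} (h : HasCircleDeriv f g) : dy f = g := by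
  funext y
  induction y using QuotientAddGroup.induction_on with
  | H x =>
    have h1 : HasDerivAt (fun τ : ℝ => f ((x + τ : ℝ) : S1)) (g (x : S1)) 0 := by
      have h2 := h (x + 0)
      rw [add_zero] at h2
      have h3 := HasDerivAt.comp_const_add (𝕜 := ℝ) (f := fun τ : ℝ => f (τ : S1)) x 0
        (f' := g (x : S1)) (by simpa using h x)
      exact h3
    rw [dy]
    exact h1.deriv

theorem hasDerivAt_fourier_two_pi (n : ℤ) (x : ℝ) :
    HasDerivAt (fun y : ℝ => fourier n (y : S1)) (Complex.I * n * fourier n (x : S1)) x := by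
  have h := hasDerivAt_fourier (2 * Real.pi) n x
  convert h using 2
  have : (Real.pi : ℂ) ≠ 0 := by exact_mod_cast Real.pi_ne_zero
  push_cast
  field_simp

theorem integral_circleDeriv_eq_zero {F G : S1 → ℂ} (h : HasCircleDeriv F G) (hG : Continuous G) :
    ∫ x in (0 : ℝ)..0 + 2 * Real.pi, G (x : S1) = 0 := by
  rw [intervalIntegral.integral_eq_sub_of_hasDerivAt (fun x _ => h x)
    ((hG.comp (AddCircle.continuous_mk' _)).intervalIntegrable _ _)]
  simp [AddCircle.coe_period]

/-- Integration by parts: the Fourier coefficients of a derivative. -/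
theorem coeffL_circleDeriv {F G : C(S1, ℂ)} (h : HasCircleDeriv (F : S1 → ℂ) G) (n : ℤ) :
    coeffL n G = dcoeff (fun k => coeffL k F) n := by
  have h1 : HasCircleDeriv (fun x => fourier (-n) x * F x)
      (fun x => fourier (-n) x * G x - Complex.I * n * (fourier (-n) x * F x)) := fun x => by
    refine ((hasDerivAt_fourier_two_pi (-n) x).fun_mul (h x)).congr_deriv ?_
    push_cast
    ring
  have h2 := integral_circleDeriv_eq_zero h1 (by fun_prop)
  have hi : ∀ H : C(S1, ℂ), IntervalIntegrable (fun x : ℝ => fourier (-n) (x : S1) * H (x : S1))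
      MeasureTheory.volume 0 (0 + 2 * Real.pi) := fun H => by
    refine Continuous.intervalIntegrable ?_ _ _
    exact ((fourier (-n)).continuous.mul H.continuous).comp (AddCircle.continuous_mk' _)
  rw [intervalIntegral.integral_sub (hi G) ((hi F).const_mul _),
    intervalIntegral.integral_const_mul, sub_eq_zero] at h2
  rw [dcoeff, coeffL_apply, coeffL_apply, fourierCoeff_eq_intervalIntegral _ _ 0,
    fourierCoeff_eq_intervalIntegral _ _ 0]
  simp only [smul_eq_mul]
  rw [h2, Complex.real_smul, Complex.real_smul]
  ring

theorem hasSum_sq_coeffL (F : C(S1, ℂ)) :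
    HasSum (fun n => ‖coeffL n F‖ ^ 2)
      ((2 * Real.pi)⁻¹ * ∫ x in (0 : ℝ)..0 + 2 * Real.pi, ‖F (x : S1)‖ ^ 2) := by
  have h := hasSum_sq_fourierCoeff (ContinuousMap.toLp (E := ℂ) 2 AddCircle.haarAddCircle ℂ F)
  simp_rw [fourierCoeff_toLp] at h
  refine (congrArg (HasSum _) ?_).mp h
  have h1 : ∫ t : S1, ‖(ContinuousMap.toLp (E := ℂ) 2 AddCircle.haarAddCircle ℂ F) t‖ ^ 2
      ∂AddCircle.haarAddCircle = ∫ t : S1, ‖F t‖ ^ 2 ∂AddCircle.haarAddCircle := by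
    refine MeasureTheory.integral_congr_ae ?_
    filter_upwards [ContinuousMap.coeFn_toLp (p := 2) (𝕜 := ℂ) AddCircle.haarAddCircle F] with t ht
    rw [ht]
  rw [h1, AddCircle.integral_haarAddCircle, smul_eq_mul]
  congr 1
  exact (AddCircle.intervalIntegral_preimage (2 * Real.pi) 0 (fun t : S1 => ‖F t‖ ^ 2)).symm

/-- Parseval's identity. -/
theorem tsum_enorm_coeffL_sq (F : C(S1, ℂ)) :
    ∑' n, ‖coeffL n F‖ₑ ^ 2 =
      ENNReal.ofReal ((2 * Real.pi)⁻¹ * ∫ x in (0 : ℝ)..0 + 2 * Real.pi, ‖F (x : S1)‖ ^ 2) := by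
  have h := hasSum_sq_coeffL F
  rw [← h.tsum_eq, ENNReal.ofReal_tsum_of_nonneg (fun n => sq_nonneg _) h.summable]
  refine tsum_congr fun n => ?_
  rw [ENNReal.ofReal_pow (norm_nonneg _), ofReal_norm]

theorem sobSq_zero (c : ℤ → ℂ) : sobSq 0 c = ∑' n, ‖c n‖ₑ ^ 2 := by
  simp [sobSq, weight_zero]

theorem sobSq_zero_coeffL_ne_top (F : C(S1, ℂ)) : sobSq 0 (fun n => coeffL n F) ≠ ⊤ := by
  rw [sobSq_zero, tsum_enorm_coeffL_sq]
  exact ENNReal.ofReal_ne_top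

theorem sobSq_add_one (ρ : ℝ) (c : ℤ → ℂ) :
    sobSq (ρ + 1) c = sobSq ρ c + sobSq ρ (dcoeff c) := by
  rw [sobSq, sobSq, sobSq, ← ENNReal.tsum_add]
  refine tsum_congr fun n => ?_
  have h : ENNReal.ofReal (weight 1 n) ^ 2 = 1 + ‖(n : ℂ)‖ₑ ^ 2 := by
    rw [← ENNReal.ofReal_pow (weight_pos _ _).le, weight_one_sq, ← ofReal_norm,
      Complex.norm_intCast, ← ENNReal.ofReal_pow (abs_nonneg _), sq_abs,
      ENNReal.ofReal_add zero_le_one (sq_nonneg _), ENNReal.ofReal_one]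
  have hI : ‖Complex.I‖ₑ = 1 := by rw [← ofReal_norm, Complex.norm_I, ENNReal.ofReal_one]
  rw [weight_add, ENNReal.ofReal_mul (weight_pos _ _).le, mul_pow, mul_pow, h, dcoeff, enorm_mul,
    enorm_mul, hI]
  ring

/-- A continuously differentiable function has absolutely summable Fourier coefficients. -/
theorem HasCircleDeriv.summable_coeffL {F G : C(S1, ℂ)} (h : HasCircleDeriv (F : S1 → ℂ) G) :
    Summable fun n => coeffL n F := by
  refine summable_of_sobSq_ne_top (σ := 0 + 1) (by norm_num) ?_
  rw [sobSq_add_one, ← funext (coeffL_circleDeriv h)]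
  exact ENNReal.add_ne_top.mpr ⟨sobSq_zero_coeffL_ne_top F, sobSq_zero_coeffL_ne_top G⟩

theorem hasCircleDeriv_of_summable {F G : C(S1, ℂ)} (hF : Summable fun n => coeffL n F)
    (hG : Summable fun n => coeffL n G)
    (h : ∀ n, coeffL n G = dcoeff (fun k => coeffL k F) n) : HasCircleDeriv (F : S1 → ℂ) G := by
  intro x
  have hF1 := fun x : ℝ => has_pointwise_sum_fourier_series_of_summable (f := F) hF (x : S1)
  have hG1 := fun x : ℝ => has_pointwise_sum_fourier_series_of_summable (f := G) hG (x : S1)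
  have h1 := hasDerivAt_tsum (y₀ := 0) hG.norm
    (g := fun n (y : ℝ) => fourierCoeff F n • fourier n (y : S1))
    (g' := fun n (y : ℝ) => fourierCoeff G n • fourier n (y : S1)) (fun n y => by
      have h2 := (hasDerivAt_fourier_two_pi n y).const_mul (fourierCoeff F n)
      have h3 := h n
      rw [coeffL_apply, dcoeff, coeffL_apply] at h3
      refine HasDerivAt.congr_deriv h2 ?_
      rw [h3, smul_eq_mul]
      ring) (fun n y => by
      rw [norm_smul, fourier_apply, Circle.norm_coe, mul_one, coeffL_apply]) (hF1 0).summable x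
  rw [(hG1 x).tsum_eq] at h1
  simpa only [(hF1 _).tsum_eq] using h1

theorem hasCircleDeriv_of_toComplex {f g : C(S1, ℝ)}
    (h : HasCircleDeriv (toComplex f : S1 → ℂ) (toComplex g)) :
    HasCircleDeriv (f : S1 → ℝ) g := fun x =>
  (Complex.reCLM.hasFDerivAt.comp_hasDerivAt x (h x) :)

theorem Hs.hasCircleDeriv {s : ℝ} (hs : 3 / 2 < s) (f : Hs s) :
    HasCircleDeriv (f : S1 → ℝ) (derivL hs f) :=
  hasCircleDeriv_of_toComplex (hasCircleDeriv_of_summable (f.summable_coeff (by linarith))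
    ((derivL hs f).summable_coeff (by linarith)) (coeff_derivL hs f))

/-- A maximum principle for `a q - κ q' = b`: at a maximum of `|q|` the derivative vanishes. -/
theorem HasCircleDeriv.abs_le {q q' a b : S1 → ℝ} (h : HasCircleDeriv q q') {κ α β : ℝ}
    (hα : 0 < α) (ha : ∀ x, α ≤ |a x|) (hb : ∀ x, |b x| ≤ β)
    (heq : ∀ x, a x * q x - κ * q' x = b x) (x : S1) : |q x| ≤ β / α := by
  have hq : Continuous q := by
    have h1 : Continuous fun τ : ℝ => q (τ : S1) :=
      continuous_iff_continuousAt.mpr fun x => (h x).continuousAt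
    exact continuous_coinduced_dom.mpr h1
  obtain ⟨x₀, -, hx₀⟩ := isCompact_univ.exists_isMaxOn (univ_nonempty (α := S1))
    (f := fun x => q x ^ 2) (by fun_prop)
  have hmax : ∀ x, q x ^ 2 ≤ q x₀ ^ 2 := fun x => hx₀ (mem_univ x)
  have hle : |q x| ≤ |q x₀| := sq_le_sq.mp (hmax x)
  refine hle.trans ?_
  have hβ : 0 ≤ β := (abs_nonneg _).trans (hb x)
  rcases eq_or_ne (q x₀) 0 with h0 | h0
  · rw [h0, abs_zero]
    positivity
  have hq' : q' x₀ = 0 := by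
    induction x₀ using QuotientAddGroup.induction_on with
    | H y =>
      have h1 := ((h y).pow 2)
      have h2 : IsLocalMax (fun τ : ℝ => q (τ : S1) ^ 2) y :=
        Filter.Eventually.of_forall fun z => hmax (z : S1)
      have h3 := h2.hasDerivAt_eq_zero h1
      have h4 : (q (y : S1)) ≠ 0 := h0
      simpa [h4] using h3
  have h1 := heq x₀
  rw [hq', mul_zero, sub_zero] at h1
  rw [le_div_iff₀ hα]
  calc |q x₀| * α ≤ |q x₀| * |a x₀| := by gcongr; exact ha x₀
    _ = |b x₀| := by rw [← h1, abs_mul, mul_comm]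
    _ ≤ β := hb x₀

/-! ### The first-order factors of the Helmholtz operator -/

/-- A continuous periodic function on the line, as a function on the circle. -/
def ofPeriodic (p : ℝ → ℝ) (hp : Function.Periodic p (2 * Real.pi)) (hc : Continuous p) :
    C(S1, ℝ) :=
  ⟨hp.lift, continuous_coinduced_dom.mpr hc⟩

/-- For `κ = ±1` and continuous `h`, the equation `p - κ p' = h` has a continuously differentiable
solution on the circle. -/
theorem exists_resolvent {κ : ℝ} (hκ : κ ^ 2 = 1) (h : C(S1, ℝ)) :
    ∃ p : C(S1, ℝ), HasCircleDeriv (p : S1 → ℝ) fun x => κ * (p x - h x) := by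
  have hhc : Continuous fun z : ℝ => Real.exp (-κ * z) * h (z : S1) :=
    (by fun_prop : Continuous fun z : ℝ => Real.exp (-κ * z)).mul
      (h.continuous.comp (AddCircle.continuous_mk' _))
  set c : ℝ := κ / (1 - Real.exp (-κ * (2 * Real.pi))) with hcdef
  have hden : 1 - Real.exp (-κ * (2 * Real.pi)) ≠ 0 := by
    rw [sub_ne_zero, ne_comm, Ne, Real.exp_eq_one_iff]
    have : κ ≠ 0 := by rintro rfl; norm_num at hκ
    exact mul_ne_zero (neg_ne_zero.mpr this) (by positivity)
  let A : ℝ → ℝ := fun y => ∫ z in (0 : ℝ)..y, Real.exp (-κ * z) * h (z : S1)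
  have hA : ∀ y, HasDerivAt A (Real.exp (-κ * y) * h (y : S1)) y := fun y =>
    intervalIntegral.integral_hasDerivAt_right (hhc.intervalIntegrable _ _)
      (hhc.stronglyMeasurableAtFilter _ _) hhc.continuousAt
  -- variation of constants: `p y = c ∫_y^{y + 2π} exp (κ (y - z)) h z dz`, with `c` chosen
  -- such that the two boundary terms of `p'` add up to `-κ h`
  let p : ℝ → ℝ := fun y => c * Real.exp (κ * y) * (A (y + 2 * Real.pi) - A y)
  have hcoe : ∀ y : ℝ, ((y + 2 * Real.pi : ℝ) : S1) = (y : S1) := fun y =>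
    AddCircle.coe_add_period _ _
  have hpd : ∀ y, HasDerivAt p (κ * (p y - h (y : S1))) y := by
    intro y
    have h1 : HasDerivAt (fun y => c * Real.exp (κ * y)) (c * (Real.exp (κ * y) * κ)) y := by
      have := ((hasDerivAt_id y).const_mul κ).exp.const_mul c
      simpa using this
    have h2 := ((hA (y + 2 * Real.pi)).comp_add_const y (2 * Real.pi)).fun_sub (hA y)
    have h3 := h1.fun_mul h2
    refine h3.congr_deriv ?_
    rw [hcoe]
    have e1 : Real.exp (-κ * (y + 2 * Real.pi)) =
        Real.exp (-κ * y) * Real.exp (-κ * (2 * Real.pi)) := by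
      rw [← Real.exp_add]
      ring_nf
    have e2 : Real.exp (κ * y) * Real.exp (-κ * y) = 1 := by
      rw [← Real.exp_add]
      simp
    have e3 : c * (1 - Real.exp (-κ * (2 * Real.pi))) = κ := by
      rw [hcdef, div_mul_cancel₀ _ hden]
    rw [e1]
    simp only [p]
    linear_combination (-(h (y : S1)) * c * (1 - Real.exp (-κ * (2 * Real.pi)))) * e2
      - h (y : S1) * e3
  have hper : Function.Periodic p (2 * Real.pi) := by
    intro y
    have h2 : ∀ y, A (y + 2 * Real.pi + 2 * Real.pi) - A (y + 2 * Real.pi) =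
        Real.exp (-κ * (2 * Real.pi)) * (A (y + 2 * Real.pi) - A y) := by
      intro y
      simp only [A]
      rw [intervalIntegral.integral_interval_sub_left (hhc.intervalIntegrable _ _)
        (hhc.intervalIntegrable _ _), intervalIntegral.integral_interval_sub_left
        (hhc.intervalIntegrable _ _) (hhc.intervalIntegrable _ _),
        ← intervalIntegral.integral_const_mul,
        ← intervalIntegral.integral_comp_add_right _ (2 * Real.pi)]
      refine intervalIntegral.integral_congr fun z _ => ?_
      rw [hcoe, ← mul_assoc, ← Real.exp_add]
      ring_nf
    have e1 : Real.exp (κ * (y + 2 * Real.pi)) * Real.exp (-κ * (2 * Real.pi)) =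
        Real.exp (κ * y) := by
      rw [← Real.exp_add]
      ring_nf
    simp only [p]
    rw [h2, ← e1]
    ring
  have hpc : Continuous p := continuous_iff_continuousAt.mpr fun y => (hpd y).continuousAt
  exact ⟨ofPeriodic p hper hpc, fun x => hpd x⟩

/-- The operator `(1 - ∂²)⁻¹ ∂ = ½ ((1 - ∂)⁻¹ - (1 + ∂)⁻¹)` in terms of its first-order factors. -/
theorem invHelmholtzDy_eq {h p₁ p₂ : C(S1, ℝ)}
    (h₁ : HasCircleDeriv (p₁ : S1 → ℝ) fun x => p₁ x - h x)
    (h₂ : HasCircleDeriv (p₂ : S1 → ℝ) fun x => h x - p₂ x) (y : S1) :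
    invHelmholtzDy h y = (p₁ y - p₂ y) / 2 := by
  have e₁ : HasCircleDeriv (toComplex p₁ : S1 → ℂ) (toComplex p₁ - toComplex h : C(S1, ℂ)) :=
    fun x => by
      refine HasDerivAt.congr_deriv (h₁ x).ofReal_comp ?_
      simp [toComplex_apply]
  have e₂ : HasCircleDeriv (toComplex p₂ : S1 → ℂ) (toComplex h - toComplex p₂ : C(S1, ℂ)) :=
    fun x => by
      refine HasDerivAt.congr_deriv (h₂ x).ofReal_comp ?_
      simp [toComplex_apply]
  have s₁ := has_pointwise_sum_fourier_series_of_summable (f := toComplex p₁) e₁.summable_coeffL y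
  have s₂ := has_pointwise_sum_fourier_series_of_summable (f := toComplex p₂) e₂.summable_coeffL y
  have s₃ := (s₁.sub s₂).div_const 2
  have key : ∀ n : ℤ, (1 + (n : ℂ) ^ 2)⁻¹ * (Complex.I * n) * coeff h n * fourier n y =
      (fourierCoeff (toComplex p₁) n • fourier n y -
        fourierCoeff (toComplex p₂) n • fourier n y) / 2 := by
    intro n
    have c₁ := coeffL_circleDeriv e₁ n
    have c₂ := coeffL_circleDeriv e₂ n
    rw [map_sub, dcoeff] at c₁ c₂
    rw [← coeffL_apply, ← coeffL_apply, coeff_eq, smul_eq_mul, smul_eq_mul]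
    set a := coeffL n (toComplex p₁)
    set b := coeffL n (toComplex p₂)
    have hn : (1 + (n : ℂ) ^ 2) ≠ 0 := by
      have : (1 + (n : ℝ) ^ 2) ≠ 0 := by positivity
      exact_mod_cast this
    have hI := Complex.I_sq
    -- the symbols of `1 - ∂` and `1 + ∂`
    have ha : coeffL n (toComplex h) = a * (1 - Complex.I * n) := by linear_combination -c₁
    have hb : coeffL n (toComplex h) = b * (1 + Complex.I * n) := by linear_combination c₂
    have hI2 : (1 - Complex.I * n) * (1 + Complex.I * n) = 1 + (n : ℂ) ^ 2 := by
      linear_combination (-(n : ℂ) ^ 2) * hI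
    have ha' : a = (1 + (n : ℂ) ^ 2)⁻¹ * (coeffL n (toComplex h) * (1 + Complex.I * n)) := by
      rw [eq_inv_mul_iff_mul_eq₀ hn, ← hI2, ha]
      ring
    have hb' : b = (1 + (n : ℂ) ^ 2)⁻¹ * (coeffL n (toComplex h) * (1 - Complex.I * n)) := by
      rw [eq_inv_mul_iff_mul_eq₀ hn, ← hI2, hb]
      ring
    rw [ha', hb']
    ring
  rw [invHelmholtzDy, tsum_congr key, s₃.tsum_eq, toComplex_apply, toComplex_apply]
  norm_cast

/-! ### Trigonometric truncations -/

/-- The part of the Fourier series of `F` with frequencies in the finite set `S`. -/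
def trunc (S : Finset ℤ) (F : C(S1, ℂ)) : C(S1, ℂ) := ∑ n ∈ S, coeffL n F • fourier n

theorem coeffL_sum_fourier (S : Finset ℤ) (c : ℤ → ℂ) (n : ℤ) :
    coeffL n (∑ k ∈ S, c k • (fourier k : C(S1, ℂ))) = if n ∈ S then c n else 0 := by
  rw [map_sum]
  simp only [map_smul, coeffL_fourier, smul_eq_mul, mul_ite, mul_one, mul_zero]
  exact Finset.sum_ite_eq S n c

theorem coeffL_trunc (S : Finset ℤ) (F : C(S1, ℂ)) (n : ℤ) :
    coeffL n (trunc S F) = if n ∈ S then coeffL n F else 0 := coeffL_sum_fourier S _ n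

theorem summable_coeffL_sum_fourier (S : Finset ℤ) (c : ℤ → ℂ) :
    Summable fun n => coeffL n (∑ k ∈ S, c k • (fourier k : C(S1, ℂ))) := by
  refine summable_of_ne_finset_zero (s := S) fun n hn => ?_
  rw [coeffL_sum_fourier, if_neg hn]

theorem hasCircleDeriv_trunc (S : Finset ℤ) (F : C(S1, ℂ)) :
    HasCircleDeriv (trunc S F : S1 → ℂ)
      (∑ n ∈ S, dcoeff (fun k => coeffL k F) n • (fourier n : C(S1, ℂ)) : C(S1, ℂ)) := by
  refine hasCircleDeriv_of_summable (summable_coeffL_sum_fourier S _)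
    (summable_coeffL_sum_fourier S _) fun n => ?_
  rw [coeffL_sum_fourier, dcoeff, dcoeff, coeffL_trunc]
  split_ifs <;> simp

theorem sobSq_trunc_le (ρ : ℝ) (S : Finset ℤ) (F : C(S1, ℂ)) :
    sobSq ρ (fun n => coeffL n (trunc S F)) ≤ sobSq ρ fun n => coeffL n F := by
  refine ENNReal.tsum_le_tsum fun n => ?_
  simp only [coeffL_trunc]
  split_ifs <;> simp

/-- The squared Sobolev norm is lower semicontinuous under convergence of all coefficients. -/
theorem sobSq_le_of_tendsto {ι : Type*} {l : Filter ι} [l.NeBot] {ρ : ℝ} {c : ι → ℤ → ℂ}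
    {d : ℤ → ℂ} {B : ℝ≥0∞} (h : ∀ n, Tendsto (fun i => c i n) l (𝓝 (d n)))
    (hB : ∀ i, sobSq ρ (c i) ≤ B) : sobSq ρ d ≤ B := by
  rw [sobSq, ENNReal.tsum_eq_iSup_sum]
  refine iSup_le fun S => ?_
  have h1 : Tendsto (fun i => ∑ n ∈ S, (ENNReal.ofReal (weight ρ n) * ‖c i n‖ₑ) ^ 2) l
      (𝓝 (∑ n ∈ S, (ENNReal.ofReal (weight ρ n) * ‖d n‖ₑ) ^ 2)) := by
    refine tendsto_finsetSum _ fun n _ => ?_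
    exact ((ENNReal.continuous_pow 2).tendsto _).comp
      (ENNReal.Tendsto.const_mul (h n).enorm (Or.inr ENNReal.ofReal_ne_top))
  exact le_of_tendsto' h1 fun i => (ENNReal.sum_le_tsum S).trans (hB i)

theorem enorm_coeffL_sq_le (F : C(S1, ℂ)) (n : ℤ) :
    ‖coeffL n F‖ₑ ^ 2 ≤ sobSq 0 fun k => coeffL k F := by
  rw [sobSq_zero]
  exact ENNReal.le_tsum n

theorem tendsto_sobSq_sub_trunc (F : C(S1, ℂ)) :
    Tendsto (fun S => sobSq 0 fun n => coeffL n (F - trunc S F)) atTop (𝓝 0) := by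
  have h := ENNReal.tendsto_tsum_compl_atTop_zero (f := fun n => ‖coeffL n F‖ₑ ^ 2)
    (by rw [← sobSq_zero]; exact sobSq_zero_coeffL_ne_top F)
  refine h.congr fun S => ?_
  rw [sobSq_zero]
  refine (tsum_subtype {x | x ∉ S} fun n => ‖coeffL n F‖ₑ ^ 2).trans (tsum_congr fun n => ?_)
  rw [map_sub, coeffL_trunc]
  by_cases hn : n ∈ S <;> simp [hn]

/-! ### Composition with diffeomorphisms of the circle -/

/-- An orientation preserving `C¹` diffeomorphism `ζ` of the circle with its lift `Z` to the line.
The derivative is recorded as `Z' = b ∘ ζ` with a positive function `b` on the circle. -/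
structure PosDiffeo where
  /-- the diffeomorphism of the circle -/
  map : C(S1, S1)
  /-- its lift to the line -/
  lift : ℝ → ℝ
  /-- the derivative of the diffeomorphism, as a function of the image point -/
  slope : C(S1, ℝ)
  map_coe : ∀ y : ℝ, map (y : S1) = (lift y : S1)
  lift_add : ∀ y, lift (y + 2 * Real.pi) = lift y + 2 * Real.pi
  hasDerivAt_lift : ∀ y, HasDerivAt lift (slope (lift y : S1)) y
  slope_pos : ∀ x, 0 < slope x

namespace PosDiffeo

variable (ζ : PosDiffeo)

theorem hasCircleDeriv_comp {F G : C(S1, ℂ)} (h : HasCircleDeriv (F : S1 → ℂ) G) :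
    HasCircleDeriv (F.comp ζ.map : S1 → ℂ) ((toComplex ζ.slope * G).comp ζ.map) := fun y => by
  have h1 := (h (ζ.lift y)).scomp y (ζ.hasDerivAt_lift y)
  have h2 : (fun τ : ℝ => F.comp ζ.map (τ : S1)) = (fun τ : ℝ => F (τ : S1)) ∘ ζ.lift := by
    funext τ
    rw [ContinuousMap.comp_apply, ζ.map_coe]
    rfl
  rw [h2]
  refine h1.congr_deriv ?_
  rw [ContinuousMap.comp_apply, ζ.map_coe, ContinuousMap.mul_apply, toComplex_apply,
    Complex.real_smul]

theorem continuous_lift : Continuous ζ.lift :=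
  continuous_iff_continuousAt.mpr fun y => (ζ.hasDerivAt_lift y).continuousAt

/-- Composition with `ζ` is bounded in `L²`. -/
theorem exists_sobSq_zero_comp_le : ∃ K : ℝ≥0∞, K ≠ ⊤ ∧ ∀ F : C(S1, ℂ),
    sobSq 0 (fun n => coeffL n (F.comp ζ.map)) ≤ K * sobSq 0 fun n => coeffL n F := by
  obtain ⟨x₀, -, hx₀⟩ := isCompact_univ.exists_isMinOn (univ_nonempty (α := S1))
    ζ.slope.continuous.continuousOn
  set m := ζ.slope x₀ with hm
  have hmpos : 0 < m := ζ.slope_pos x₀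
  have hmle : ∀ x, m ≤ ζ.slope x := fun x => hx₀ (mem_univ x)
  refine ⟨ENNReal.ofReal m⁻¹, ENNReal.ofReal_ne_top, fun F => ?_⟩
  have hg : Continuous fun x : ℝ => ‖F (x : S1)‖ ^ 2 :=
    (F.continuous.comp (AddCircle.continuous_mk' _)).norm.pow 2
  have hs : Continuous fun y : ℝ => ζ.slope (ζ.lift y : S1) :=
    ζ.slope.continuous.comp ((AddCircle.continuous_mk' _).comp ζ.continuous_lift)
  -- substitution: `∫ |F ∘ ζ|² ζ' = ∫ |F|²`, and `ζ'` is bounded below by `m`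
  have h1 := intervalIntegral.integral_comp_mul_deriv (a := 0) (b := 0 + 2 * Real.pi)
    (fun y _ => ζ.hasDerivAt_lift y) hs.continuousOn hg
  have hper : Function.Periodic (fun x : ℝ => ‖F (x : S1)‖ ^ 2) (2 * Real.pi) := fun x => by
    simp only [AddCircle.coe_add_period]
  rw [ζ.lift_add, hper.intervalIntegral_add_eq (ζ.lift 0) 0] at h1
  rw [sobSq_zero, sobSq_zero, tsum_enorm_coeffL_sq, tsum_enorm_coeffL_sq,
    ← ENNReal.ofReal_mul (by positivity), ← h1]
  refine ENNReal.ofReal_le_ofReal ?_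
  rw [mul_left_comm]
  refine mul_le_mul_of_nonneg_left ?_ (inv_nonneg.mpr Real.two_pi_pos.le)
  rw [← intervalIntegral.integral_const_mul]
  refine intervalIntegral.integral_mono_on (by linarith [Real.two_pi_pos]) ?_ ?_ fun y _ => ?_
  · exact Continuous.intervalIntegrable
      (((F.comp ζ.map).continuous.comp (AddCircle.continuous_mk' _)).norm.pow 2) _ _
  · exact Continuous.intervalIntegrable
      (continuous_const.mul ((hg.comp ζ.continuous_lift).mul hs)) _ _
  · rw [ContinuousMap.comp_apply, ζ.map_coe, Function.comp_apply, mul_left_comm]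
    refine le_mul_of_one_le_right (sq_nonneg _) ?_
    rw [inv_mul_eq_div, one_le_div hmpos]
    exact hmle _

/-- Composition with `ζ` is bounded in `H^ρ`. -/
def CompBounded (ρ : ℝ) : Prop := ∃ K : ℝ≥0∞, K ≠ ⊤ ∧ ∀ F : C(S1, ℂ),
  sobSq ρ (fun n => coeffL n (F.comp ζ.map)) ≤ K * sobSq ρ fun n => coeffL n F

variable {ζ}

theorem coeffL_toComplex_mul {f : C(S1, ℝ)} (hf : Summable (coeff f)) (G : C(S1, ℂ)) :
    (fun n => coeffL n (toComplex f * G)) = conv (coeff f) fun k => coeffL k G := by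
  have h : coeff f = fun n => coeffL n (toComplex f) := funext (coeff_eq f)
  rw [h] at hf ⊢
  exact funext (coeffL_mul hf G)

/-- The chain rule `(F ∘ ζ)' = (b F') ∘ ζ` gains one derivative. -/
theorem CompBounded.add_one_of_hasCircleDeriv {ρ σ : ℝ} (hσ : 1 / 2 < σ)
    (hb : sobSq σ (coeff ζ.slope) ≠ ⊤) (h0 : 0 ≤ ρ) (hρσ : ρ ≤ σ) (h : ζ.CompBounded ρ) :
    ∃ K : ℝ≥0∞, K ≠ ⊤ ∧ ∀ F G : C(S1, ℂ), HasCircleDeriv (F : S1 → ℂ) G →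
      sobSq (ρ + 1) (fun n => coeffL n (F.comp ζ.map)) ≤
        K * sobSq (ρ + 1) fun n => coeffL n F := by
  obtain ⟨K, hK, hKF⟩ := h
  obtain ⟨K', hK', hmul⟩ := exists_sobSq_conv_le h0 hρσ hσ
  set B := sobSq σ (coeff ζ.slope)
  refine ⟨K + K * (K' * B), ENNReal.add_ne_top.mpr
    ⟨hK, ENNReal.mul_ne_top hK (ENNReal.mul_ne_top hK' hb)⟩, fun F G hFG => ?_⟩
  have h1 := coeffL_toComplex_mul (summable_of_sobSq_ne_top hσ hb) G
  have e1 : (fun n => coeffL n ((toComplex ζ.slope * G).comp ζ.map)) =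
      dcoeff fun n => coeffL n (F.comp ζ.map) :=
    funext (coeffL_circleDeriv (ζ.hasCircleDeriv_comp hFG))
  have e2 : (fun n => coeffL n G) = dcoeff fun n => coeffL n F := funext (coeffL_circleDeriv hFG)
  rw [sobSq_add_one, sobSq_add_one, ← e1, ← e2]
  have h2 : sobSq ρ (fun n => coeffL n ((toComplex ζ.slope * G).comp ζ.map)) ≤
      K * (K' * (B * sobSq ρ fun n => coeffL n G)) := by
    refine (hKF _).trans (mul_le_mul_right ?_ K)
    rw [h1]
    exact hmul _ _
  refine (add_le_add (hKF F) h2).trans ?_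
  rw [mul_add, ← mul_assoc K', ← mul_assoc K]
  exact add_le_add (mul_le_mul_left le_self_add _) (mul_le_mul_left le_add_self _)

variable (ζ) in
theorem compBounded_zero : ζ.CompBounded 0 := ζ.exists_sobSq_zero_comp_le

variable (ζ) in
theorem tendsto_coeffL_comp_trunc (F : C(S1, ℂ)) (n : ℤ) :
    Tendsto (fun S => coeffL n ((trunc S F).comp ζ.map)) atTop (𝓝 (coeffL n (F.comp ζ.map))) := by
  obtain ⟨K, hK, hKF⟩ := ζ.exists_sobSq_zero_comp_le
  rw [tendsto_iff_edist_tendsto_0]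
  have h1 : Tendsto (fun S => (K * sobSq 0 fun n => coeffL n (F - trunc S F)) ^ (1 / 2 : ℝ)) atTop
      (𝓝 ((K * 0) ^ (1 / 2 : ℝ))) :=
    ((ENNReal.continuous_rpow_const (y := 1 / 2)).tendsto _).comp
      (ENNReal.Tendsto.const_mul (tendsto_sobSq_sub_trunc F) (Or.inr hK))
  rw [mul_zero, ENNReal.zero_rpow_of_pos (by norm_num)] at h1
  refine tendsto_of_tendsto_of_tendsto_of_le_of_le tendsto_const_nhds h1 (fun _ => zero_le)
    fun S => ?_
  have h2 := (enorm_coeffL_sq_le ((F - trunc S F).comp ζ.map) n).trans (hKF _)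
  have h3 : edist (coeffL n ((trunc S F).comp ζ.map)) (coeffL n (F.comp ζ.map)) =
      ‖coeffL n ((F - trunc S F).comp ζ.map)‖ₑ := by
    rw [edist_comm, edist_eq_enorm_sub, ← map_sub]
    rfl
  calc edist (coeffL n ((trunc S F).comp ζ.map)) (coeffL n (F.comp ζ.map))
      = ((‖coeffL n ((F - trunc S F).comp ζ.map)‖ₑ) ^ 2) ^ (1 / 2 : ℝ) := by
        rw [h3, ← ENNReal.rpow_natCast, ← ENNReal.rpow_mul]
        norm_num
    _ ≤ _ := ENNReal.rpow_le_rpow h2 (by norm_num)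

theorem CompBounded.add_one {ρ σ : ℝ} (hσ : 1 / 2 < σ)
    (hb : sobSq σ (coeff ζ.slope) ≠ ⊤) (h0 : 0 ≤ ρ) (hρσ : ρ ≤ σ) (h : ζ.CompBounded ρ) :
    ζ.CompBounded (ρ + 1) := by
  obtain ⟨K, hK, hKF⟩ := h.add_one_of_hasCircleDeriv hσ hb h0 hρσ
  refine ⟨K, hK, fun F => ?_⟩
  refine sobSq_le_of_tendsto (ζ.tendsto_coeffL_comp_trunc F) fun S => ?_
  refine (hKF _ _ (hasCircleDeriv_trunc S F)).trans ?_
  gcongr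
  exact sobSq_trunc_le _ S F

end PosDiffeo

/-! ### Interpolation between `L²` and `H¹` -/

/-- The squared `K`-functional of the couple `(L², H¹)`, in terms of Fourier coefficients. -/
def kSq (t : ℝ) (c : ℤ → ℂ) : ℝ≥0∞ :=
  ∑' n, (ENNReal.ofReal (min 1 (t * weight 1 n)) * ‖c n‖ₑ) ^ 2

theorem kSq_add_le (t : ℝ) (c d : ℤ → ℂ) :
    kSq t (fun n => c n + d n) ≤ 2 * (kSq t c + kSq t d) := by
  rw [kSq, kSq, kSq, ← ENNReal.tsum_add, ← ENNReal.tsum_mul_left]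
  refine ENNReal.tsum_le_tsum fun n => le_trans ?_ (ennreal_add_sq_le _ _)
  rw [← mul_add]
  exact pow_le_pow_left₀ zero_le (mul_le_mul_right (enorm_add_le _ _) _) 2

theorem kSq_le_sobSq_zero (t : ℝ) (c : ℤ → ℂ) : kSq t c ≤ sobSq 0 c := by
  refine ENNReal.tsum_le_tsum fun n => ?_
  refine pow_le_pow_left₀ zero_le (mul_le_mul_left (ENNReal.ofReal_le_ofReal ?_) _) 2
  rw [weight_zero]
  exact min_le_left _ _

theorem kSq_le_sobSq_one {t : ℝ} (ht : 0 < t) (c : ℤ → ℂ) :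
    kSq t c ≤ ENNReal.ofReal t ^ 2 * sobSq 1 c := by
  rw [sobSq, ← ENNReal.tsum_mul_left]
  refine ENNReal.tsum_le_tsum fun n => ?_
  rw [← mul_pow, ← mul_assoc, ← ENNReal.ofReal_mul ht.le]
  exact pow_le_pow_left₀ zero_le
    (mul_le_mul_left (ENNReal.ofReal_le_ofReal (min_le_right _ _)) _) 2

theorem finite_setOf_mul_weight_le {t : ℝ} (ht : 0 < t) : {n : ℤ | t * weight 1 n ≤ 1}.Finite := by
  refine (Set.finite_Icc (-⌈t⁻¹⌉) ⌈t⁻¹⌉).subset fun n hn => ?_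
  have h1 : |(n : ℝ)| ≤ t⁻¹ := by
    refine (abs_le_weight_one n).trans ?_
    rw [← one_div, le_div_iff₀ ht, mul_comm]
    exact hn
  have h2 := (abs_le.mp (h1.trans (Int.le_ceil _)))
  exact ⟨by exact_mod_cast h2.1, by exact_mod_cast h2.2⟩

/-- A `K`-functional estimate follows from estimates in `L²` and `H¹`, applied to the high and to
the low frequencies. -/
theorem PosDiffeo.exists_kSq_comp_le (ζ : PosDiffeo) {σ : ℝ} (hσ : 1 / 2 < σ)
    (hb : sobSq σ (coeff ζ.slope) ≠ ⊤) : ∃ K : ℝ≥0∞, K ≠ ⊤ ∧ ∀ t, 0 < t → ∀ F : C(S1, ℂ),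
      kSq t (fun n => coeffL n (F.comp ζ.map)) ≤ K * kSq t fun n => coeffL n F := by
  obtain ⟨K₀, hK₀, h₀⟩ := ζ.compBounded_zero
  obtain ⟨K₁, hK₁, h₁⟩ := ζ.compBounded_zero.add_one_of_hasCircleDeriv hσ hb le_rfl (by linarith)
  rw [zero_add] at h₁
  refine ⟨2 * (K₀ + K₁), ENNReal.mul_ne_top (by norm_num) (ENNReal.add_ne_top.mpr ⟨hK₀, hK₁⟩),
    fun t ht F => ?_⟩
  -- `S` holds the frequencies at which the minimum in `kSq` is the `H¹` weight
  set S := (finite_setOf_mul_weight_le ht).toFinset with hS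
  have hmem : ∀ n, n ∈ S ↔ t * weight 1 n ≤ 1 := fun n => by simp [hS]
  have e : (fun n => coeffL n (F.comp ζ.map)) = fun n =>
      coeffL n ((F - trunc S F).comp ζ.map) + coeffL n ((trunc S F).comp ζ.map) := by
    funext n
    rw [← map_add]
    congr 1
    ext x
    simp
  have h2 : (sobSq 0 fun n => coeffL n (F - trunc S F)) ≤ kSq t fun n => coeffL n F := by
    refine ENNReal.tsum_le_tsum fun n => ?_
    simp only [map_sub, coeffL_trunc, weight_zero]
    split_ifs with hn
    · simp
    · rw [min_eq_left (not_le.mp fun h => hn ((hmem n).mpr h)).le, sub_zero]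
  have h3 : (ENNReal.ofReal t ^ 2 * sobSq 1 fun n => coeffL n (trunc S F)) ≤
      kSq t fun n => coeffL n F := by
    rw [sobSq, ← ENNReal.tsum_mul_left]
    refine ENNReal.tsum_le_tsum fun n => ?_
    simp only [← mul_pow, ← mul_assoc, ← ENNReal.ofReal_mul ht.le, coeffL_trunc]
    split_ifs with hn
    · rw [min_eq_right ((hmem n).mp hn)]
    · simp
  rw [e]
  refine (kSq_add_le _ _ _).trans ?_
  rw [mul_assoc]
  refine mul_le_mul_right ?_ 2
  rw [add_mul]
  refine add_le_add ?_ ?_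
  · exact (kSq_le_sobSq_zero _ _).trans ((h₀ _).trans (mul_le_mul_right h2 _))
  · refine (kSq_le_sobSq_one ht _).trans ?_
    refine (mul_le_mul_right (h₁ _ _ (hasCircleDeriv_trunc S F)) _).trans ?_
    rw [mul_left_comm]
    exact mul_le_mul_right h3 _

/-- The integrand `t ↦ t^{-1-2ρ} min(1, t)²` of the interpolation norm. -/
def interpFun (ρ t : ℝ) : ℝ := t ^ (-1 - 2 * ρ) * min 1 t ^ 2

theorem interpFun_nonneg (ρ : ℝ) {t : ℝ} (ht : 0 < t) : 0 ≤ interpFun ρ t :=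
  mul_nonneg (Real.rpow_nonneg ht.le _) (sq_nonneg _)

theorem integrableOn_interpFun {ρ : ℝ} (h0 : 0 < ρ) (h1 : ρ < 1) :
    MeasureTheory.IntegrableOn (interpFun ρ) (Ioi 0) := by
  rw [← Ioc_union_Ioi_eq_Ioi (zero_le_one (α := ℝ))]
  refine MeasureTheory.IntegrableOn.union ?_ ?_
  · have h2 : MeasureTheory.IntegrableOn (fun t : ℝ => t ^ (1 - 2 * ρ)) (Ioc 0 1) := by
      rw [← intervalIntegrable_iff_integrableOn_Ioc_of_le zero_le_one]
      exact intervalIntegral.intervalIntegrable_rpow' (by linarith)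
    refine h2.congr_fun (fun t ht => ?_) measurableSet_Ioc
    have e : 1 - 2 * ρ = -1 - 2 * ρ + ((2 : ℕ) : ℝ) := by push_cast; ring
    rw [interpFun, min_eq_right ht.2, ← Real.rpow_natCast, ← Real.rpow_add ht.1, e]
  · have h2 := integrableOn_Ioi_rpow_of_lt (a := -1 - 2 * ρ) (by linarith) zero_lt_one
    refine h2.congr_fun (fun t ht => ?_) measurableSet_Ioi
    rw [interpFun, min_eq_left (le_of_lt ht), one_pow, mul_one]

/-- The constant `∫₀^∞ t^{-1-2ρ} min(1, t)² dt`. -/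
def interpConst (ρ : ℝ) : ℝ := ∫ t in Ioi 0, interpFun ρ t

theorem interpConst_pos {ρ : ℝ} (h0 : 0 < ρ) (h1 : ρ < 1) : 0 < interpConst ρ := by
  have hpos : ∀ t ∈ Ioi (0 : ℝ), 0 < interpFun ρ t := fun t ht =>
    mul_pos (Real.rpow_pos_of_pos ht _) (pow_pos (lt_min one_pos ht) 2)
  rw [interpConst, MeasureTheory.setIntegral_pos_iff_support_of_nonneg_ae]
  · have : Function.support (interpFun ρ) ∩ Ioi 0 = Ioi 0 :=
      inter_eq_right.mpr fun t ht => (hpos t ht).ne'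
    rw [this]
    simp
  · refine (MeasureTheory.ae_restrict_iff' measurableSet_Ioi).mpr
      (MeasureTheory.ae_of_all _ fun t ht => ?_)
    exact (hpos t ht).le
  · exact integrableOn_interpFun h0 h1

theorem lintegral_interp {ρ : ℝ} (h0 : 0 < ρ) (h1 : ρ < 1) (n : ℤ) :
    ∫⁻ t in Ioi (0 : ℝ), ENNReal.ofReal (t ^ (-1 - 2 * ρ)) *
        ENNReal.ofReal (min 1 (t * weight 1 n)) ^ 2 =
      ENNReal.ofReal (weight ρ n) ^ 2 * ENNReal.ofReal (interpConst ρ) := by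
  set w := weight 1 n with hw
  have hwpos : 0 < w := weight_pos _ _
  have hwρ : w ^ (2 * ρ) = weight ρ n ^ 2 := by
    have hn : 0 ≤ 1 + (n : ℝ) ^ 2 := by positivity
    rw [sq, ← weight_add, hw, weight, weight, ← Real.rpow_mul hn]
    congr 1
    ring
  -- the substitution `t ↦ w t` moves the weight `w` out of the integral
  have hscale : ∀ t ∈ Ioi (0 : ℝ), t ^ (-1 - 2 * ρ) * min 1 (t * w) ^ 2 =
      w ^ (1 + 2 * ρ) * interpFun ρ (w * t) := by
    intro t ht
    have ht' : (0 : ℝ) < t := ht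
    rw [interpFun, Real.mul_rpow hwpos.le ht'.le, mul_comm w t, ← mul_assoc, ← mul_assoc,
      ← Real.rpow_add hwpos]
    have : 1 + 2 * ρ + (-1 - 2 * ρ) = 0 := by ring
    rw [this, Real.rpow_zero, one_mul]
  have hint : MeasureTheory.IntegrableOn (fun t => w ^ (1 + 2 * ρ) * interpFun ρ (w * t))
      (Ioi 0) := by
    refine MeasureTheory.Integrable.const_mul ?_ _
    have := (MeasureTheory.integrableOn_Ioi_comp_mul_left_iff (interpFun ρ) 0 hwpos).mpr
      (by rw [mul_zero]; exact integrableOn_interpFun h0 h1)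
    exact this
  have hval : ∫ t in Ioi (0 : ℝ), w ^ (1 + 2 * ρ) * interpFun ρ (w * t) =
      weight ρ n ^ 2 * interpConst ρ := by
    rw [MeasureTheory.integral_const_mul, MeasureTheory.integral_comp_mul_left_Ioi _ _ hwpos,
      mul_zero, smul_eq_mul, ← mul_assoc, ← hwρ, interpConst, Real.rpow_add hwpos, Real.rpow_one,
      mul_comm w, mul_assoc (w ^ (2 * ρ)), mul_inv_cancel₀ hwpos.ne', mul_one]
  rw [← ENNReal.ofReal_pow (weight_pos _ _).le, ← ENNReal.ofReal_mul (sq_nonneg _), ← hval,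
    MeasureTheory.ofReal_integral_eq_lintegral_ofReal hint]
  · refine MeasureTheory.setLIntegral_congr_fun measurableSet_Ioi fun t ht => ?_
    have ht' : (0 : ℝ) < t := ht
    rw [← hscale t ht, ENNReal.ofReal_mul (Real.rpow_nonneg ht'.le _),
      ENNReal.ofReal_pow (le_min zero_le_one (mul_pos ht' hwpos).le)]
  · refine (MeasureTheory.ae_restrict_iff' measurableSet_Ioi).mpr
      (MeasureTheory.ae_of_all _ fun t ht => ?_)
    exact mul_nonneg (Real.rpow_nonneg hwpos.le _) (interpFun_nonneg _ (mul_pos hwpos ht))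

/-- The Sobolev norm of order `ρ ∈ (0, 1)` as an integral of the `K`-functional. -/
theorem lintegral_kSq {ρ : ℝ} (h0 : 0 < ρ) (h1 : ρ < 1) (c : ℤ → ℂ) :
    ∫⁻ t in Ioi (0 : ℝ), ENNReal.ofReal (t ^ (-1 - 2 * ρ)) * kSq t c =
      ENNReal.ofReal (interpConst ρ) * sobSq ρ c := by
  simp only [kSq, ← ENNReal.tsum_mul_left]
  rw [MeasureTheory.lintegral_tsum fun n => by fun_prop, sobSq, ← ENNReal.tsum_mul_left]
  refine tsum_congr fun n => ?_
  simp only [mul_pow, ← mul_assoc]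
  rw [MeasureTheory.lintegral_mul_const _ (by fun_prop), lintegral_interp h0 h1, mul_comm _
    (ENNReal.ofReal (interpConst ρ))]

namespace PosDiffeo

variable {ζ : PosDiffeo}

/-- Integration of the estimate of the `K`-functional over `t`. -/
theorem compBounded_of_lt_one {σ ρ : ℝ} (hσ : 1 / 2 < σ) (hb : sobSq σ (coeff ζ.slope) ≠ ⊤)
    (h0 : 0 < ρ) (h1 : ρ < 1) : ζ.CompBounded ρ := by
  obtain ⟨K, hK, h⟩ := ζ.exists_kSq_comp_le hσ hb
  refine ⟨K, hK, fun F => ?_⟩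
  have hc : ENNReal.ofReal (interpConst ρ) ≠ 0 := by
    simpa using interpConst_pos h0 h1
  rw [← ENNReal.mul_le_mul_iff_right hc ENNReal.ofReal_ne_top, mul_left_comm,
    ← lintegral_kSq h0 h1, ← lintegral_kSq h0 h1, ← MeasureTheory.lintegral_const_mul' _ _ hK]
  refine MeasureTheory.setLIntegral_mono' measurableSet_Ioi fun t ht => ?_
  rw [mul_left_comm]
  exact mul_le_mul_right (h t ht F) _

/-- Composition with a diffeomorphism whose slope is of class `H^σ`, `σ > 1/2`, is bounded in
`H^ρ` for `0 ≤ ρ ≤ σ + 1`: interpolation gives the fractional orders in `(0, 1)`, and the chain rule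
raises the order by one. -/
theorem compBounded {σ : ℝ} (hσ : 1 / 2 < σ) (hb : sobSq σ (coeff ζ.slope) ≠ ⊤) {ρ : ℝ}
    (h0 : 0 ≤ ρ) (h1 : ρ ≤ σ + 1) : ζ.CompBounded ρ := by
  obtain ⟨k, hk⟩ := exists_nat_gt ρ
  induction k generalizing ρ with
  | zero => exact absurd hk (by push_cast; linarith)
  | succ k ih =>
    push_cast at hk
    rcases lt_or_ge ρ 1 with h | h
    · rcases h0.eq_or_lt with rfl | h0
      · exact ζ.compBounded_zero
      · exact compBounded_of_lt_one hσ hb h0 h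
    · have := (ih (ρ := ρ - 1) (by linarith) (by linarith) (by linarith)).add_one hσ hb
        (by linarith) (by linarith)
      rwa [sub_add_cancel] at this

end PosDiffeo

/-! ### Perturbations of the identity are diffeomorphisms of class `H^s` -/

theorem norm_coe_le_abs (t : ℝ) : ‖(t : S1)‖ ≤ |t| :=
  QuotientAddGroup.norm_mk_le_norm

theorem exists_coe_eq_norm_eq (x : S1) : ∃ t : ℝ, (t : S1) = x ∧ ‖x‖ = |t| := by
  induction x using QuotientAddGroup.induction_on with
  | H y =>
    refine ⟨y - round ((2 * Real.pi)⁻¹ * y) * (2 * Real.pi), ?_, AddCircle.norm_eq _⟩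
    rw [AddCircle.coe_sub, sub_eq_self, ← zsmul_eq_mul, AddCircle.coe_zsmul, AddCircle.coe_period,
      smul_zero]

theorem HasCircleDeriv.abs_sub_le {f g : S1 → ℝ} (h : HasCircleDeriv f g) {C : ℝ}
    (hC : ∀ x, |g x| ≤ C) (x y : S1) : |f x - f y| ≤ C * dist x y := by
  obtain ⟨t, ht, hn⟩ := exists_coe_eq_norm_eq (x - y)
  induction y using QuotientAddGroup.induction_on with
  | H b =>
    have hx : x = ((b + t : ℝ) : S1) := by
      rw [AddCircle.coe_add, ht]
      exact (add_sub_cancel (b : S1) x).symm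
    have h1 := Convex.norm_image_sub_le_of_norm_hasDerivWithin_le (C := C) (s := univ)
      (f := fun τ : ℝ => f (τ : S1)) (fun z _ => (h z).hasDerivWithinAt) (fun z _ => hC z)
      convex_univ (mem_univ b) (mem_univ (b + t))
    rw [dist_eq_norm, hn]
    simpa [hx] using h1

theorem contractingWith_sub {f g : S1 → ℝ} (h : HasCircleDeriv f g) (hg : ∀ x, |g x| ≤ 1 / 2)
    (y : S1) : ContractingWith (1 / 2) fun x : S1 => y - (f x : S1) := by
  refine ⟨by rw [← NNReal.coe_lt_coe]; norm_num, LipschitzWith.of_dist_le_mul fun x x' => ?_⟩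
  rw [dist_sub_left, dist_eq_norm, ← AddCircle.coe_sub]
  refine (norm_coe_le_abs _).trans ((h.abs_sub_le hg x x').trans_eq ?_)
  norm_num

theorem bijective_add_of_abs_deriv_le {f g : S1 → ℝ} (h : HasCircleDeriv f g)
    (hg : ∀ x, |g x| ≤ 1 / 2) : Function.Bijective fun x : S1 => x + (f x : S1) := by
  rw [Function.bijective_iff_existsUnique]
  intro y
  have hc := contractingWith_sub h hg y
  refine ⟨hc.fixedPoint, ?_, fun x hx => ?_⟩
  · have h1 : y - (f hc.fixedPoint : S1) = hc.fixedPoint := hc.fixedPoint_isFixedPt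
    exact (eq_add_of_sub_eq h1).symm
  · exact hc.fixedPoint_unique (sub_eq_of_eq_add hx.symm : y - (f x : S1) = x)

namespace Ds

variable {s : ℝ}

/-- A small perturbation `x ↦ x + f(x)` of the identity is in `𝒟^s(S¹)`. The function `z` is the
reciprocal of its derivative. The inverse `ζ = id - f ∘ ζ` is of class `H^s` because composition
with `ζ`, whose derivative is `z ∘ ζ`, is bounded in `H^s`. -/
theorem exists_eq_add (hs : 3 / 2 < s) (f : Hs s) (hf : ∀ x, |Hs.derivL hs f x| ≤ 1 / 2)
    (z : Hs (s - 1)) (hz : ∀ x, (1 + Hs.derivL hs f x) * z x = 1) :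
    ∃ η : Ds s, ∀ x, η x = x + ((f x : ℝ) : S1) := by
  have hd := f.hasCircleDeriv hs
  let η : S1 ≃ S1 := Equiv.ofBijective _ (bijective_add_of_abs_deriv_le hd hf)
  have hη : ∀ x, η x = x + ((f x : ℝ) : S1) := fun x => rfl
  have hηc : Continuous η :=
    continuous_id.add ((AddCircle.continuous_mk' _).comp f.toCont.continuous)
  have hζc : Continuous η.symm := (hηc.homeoOfEquivCompactToT2 (f := η)).symm.continuous
  have hζ : ∀ y, η.symm y = y - ((f (η.symm y) : ℝ) : S1) := fun y => by
    rw [eq_sub_iff_add_eq, ← hη, η.apply_symm_apply]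
  let Z : ℝ → ℝ := fun y => y - f (η.symm (y : S1))
  have hcoe : ∀ y : ℝ, η.symm (y : S1) = (Z y : S1) := fun y => hζ y
  have hZc : Continuous Z :=
    continuous_id.sub (f.toCont.continuous.comp (hζc.comp (AddCircle.continuous_mk' _)))
  have hpos : ∀ x, 0 < z x := fun x => by
    have h1 := (abs_le.mp (hf x)).1
    have h2 : 0 < 1 + Hs.derivL hs f x := by linarith
    exact pos_of_mul_pos_right (by rw [hz x]; exact one_pos) h2.le
  have hZ : ∀ y, HasDerivAt Z (z (Z y : S1)) y := fun y => by
    have hne : 1 + Hs.derivL hs f (Z y : S1) ≠ 0 := left_ne_zero_of_mul_eq_one (hz _)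
    have h1 : HasDerivAt (fun τ : ℝ => τ + f (τ : S1)) (1 + Hs.derivL hs f (Z y : S1)) (Z y) :=
      (hasDerivAt_id _).add (hd (Z y))
    have h2 := h1.of_local_left_inverse hZc.continuousAt hne (Eventually.of_forall fun y' => by
      rw [← hcoe]
      exact sub_add_cancel _ _)
    rwa [inv_eq_of_mul_eq_one_right (hz _)] at h2
  let ζ : PosDiffeo :=
    { map := ⟨η.symm, hζc⟩
      lift := Z
      slope := z.toCont
      map_coe := hcoe
      lift_add := fun y => by
        simp only [Z, AddCircle.coe_add_period]
        ring
      hasDerivAt_lift := hZ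
      slope_pos := hpos }
  obtain ⟨K, hK, hcomp⟩ := PosDiffeo.compBounded (ζ := ζ) (σ := s - 1) (ρ := s) (by linarith)
    z.sobSq_ne_top (by linarith) (by linarith)
  have hmem : sobSq s (coeff (f.toCont.comp ζ.map)) ≠ ⊤ :=
    ne_top_of_le_ne_top (ENNReal.mul_ne_top hK f.sobSq_ne_top) (hcomp (toComplex f.toCont))
  refine ⟨⟨η, ⟨1, f, fun x => by rw [hη, one_smul]⟩, ⟨1, -Hs.ofCont _ hmem, fun y => ?_⟩⟩, hη⟩
  rw [one_smul, hζ y, sub_eq_add_neg, ← AddCircle.coe_neg]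
  rfl

end Ds

end FourierSeries

/-! ### Superposition operators on spaces of continuous functions -/

section Superposition

variable {X E G : Type} [TopologicalSpace X] [NormedAddCommGroup E] [NormedAddCommGroup G]

open Classical in
/-- The superposition operator `γ ↦ F ∘ γ` on continuous functions, with the value `0` if `F ∘ γ`
is not continuous. -/
def superpose (F : E → G) (γ : C(X, E)) : C(X, G) :=
  if h : Continuous (F ∘ γ) then ⟨F ∘ γ, h⟩ else 0

variable (X) in
/-- The continuous functions with values in `Ω`. -/
def valuedIn (Ω : Set E) : Set C(X, E) := {γ | MapsTo γ univ Ω}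

theorem superpose_apply {F : E → G} {Ω : Set E} (hF : ContinuousOn F Ω) {γ : C(X, E)}
    (hγ : γ ∈ valuedIn X Ω) (r : X) : superpose F γ r = F (γ r) := by
  have h : Continuous (F ∘ γ) := hF.comp_continuous γ.continuous fun r => hγ (mem_univ r)
  rw [superpose, dif_pos h]
  rfl

variable [CompactSpace X]

theorem isOpen_valuedIn {Ω : Set E} (hΩ : IsOpen Ω) : IsOpen (valuedIn X Ω) :=
  ContinuousMap.isOpen_setOfPred_mapsTo isCompact_univ hΩ

/-- Uniform continuity near the compact range of `γ`. -/
theorem exists_forall_dist_lt {F : E → G} {Ω : Set E} (hΩ : IsOpen Ω) (hF : ContinuousOn F Ω)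
    {γ : C(X, E)} (hγ : γ ∈ valuedIn X Ω) {ε : ℝ} (hε : 0 < ε) :
    ∃ δ > 0, ∀ r : X, ∀ y, dist y (γ r) < δ → dist (F y) (F (γ r)) < ε := by
  have h1 := (isCompact_range γ.continuous).uniformContinuousAt_of_continuousAt F
    (by
      rintro _ ⟨r, rfl⟩
      exact hF.continuousAt (hΩ.mem_nhds (hγ (mem_univ r)))) (Metric.dist_mem_uniformity hε)
  obtain ⟨δ, hδ, h2⟩ := Metric.mem_uniformity_dist.mp h1
  refine ⟨δ, hδ, fun r y hy => ?_⟩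
  rw [dist_comm] at hy ⊢
  exact h2 hy ⟨r, rfl⟩

theorem continuousOn_superpose {F : E → G} {Ω : Set E} (hΩ : IsOpen Ω) (hF : ContinuousOn F Ω) :
    ContinuousOn (superpose F) (valuedIn X Ω) := by
  intro γ hγ
  refine ContinuousAt.continuousWithinAt (Metric.continuousAt_iff.mpr fun ε hε => ?_)
  obtain ⟨δ, hδ, h⟩ := exists_forall_dist_lt hΩ hF hγ (half_pos hε)
  obtain ⟨δ', hδ', h'⟩ := Metric.isOpen_iff.mp (isOpen_valuedIn (X := X) hΩ) γ hγ
  refine ⟨min δ δ', lt_min hδ hδ', fun {γ'} hd => ?_⟩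
  have hγ' : γ' ∈ valuedIn X Ω := h' (hd.trans_le (min_le_right _ _))
  refine lt_of_le_of_lt ((ContinuousMap.dist_le (half_pos hε).le).mpr fun r => ?_) (half_lt_self hε)
  rw [superpose_apply hF hγ, superpose_apply hF hγ']
  exact (h r _ ((ContinuousMap.dist_apply_le_dist r).trans_lt
    (hd.trans_le (min_le_left _ _)))).le

variable [NormedSpace ℝ E] [NormedSpace ℝ G]

/-- Pointwise application of operator-valued continuous functions. -/
def pointwiseApply : C(X, E →L[ℝ] G) →L[ℝ] C(X, E) →L[ℝ] C(X, G) :=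
  LinearMap.mkContinuous₂
    (LinearMap.mk₂ ℝ (fun (A : C(X, E →L[ℝ] G)) (h : C(X, E)) =>
        (⟨fun r => A r (h r), by fun_prop⟩ : C(X, G)))
      (fun A B h => by ext r; rfl)
      (fun c A h => by ext r; rfl)
      (fun A h k => by ext r; exact map_add (A r) (h r) (k r))
      (fun c A h => by ext r; exact map_smul (A r) c (h r))) 1 fun A h => by
    rw [one_mul]
    refine (ContinuousMap.norm_le _ (by positivity)).mpr fun r => ?_
    exact (A r).le_of_opNorm_le_of_le (A.norm_coe_le_norm r) (h.norm_coe_le_norm r)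

theorem pointwiseApply_apply (A : C(X, E →L[ℝ] G)) (h : C(X, E)) (r : X) :
    pointwiseApply A h r = A r (h r) := rfl

theorem hasFDerivAt_superpose {F : E → G} {Ω : Set E} (hΩ : IsOpen Ω)
    (hF : DifferentiableOn ℝ F Ω) (hF' : ContinuousOn (fderiv ℝ F) Ω) {γ : C(X, E)}
    (hγ : γ ∈ valuedIn X Ω) :
    HasFDerivAt (superpose F) (pointwiseApply (superpose (fderiv ℝ F) γ)) γ := by
  rw [hasFDerivAt_iff_isLittleO, Asymptotics.isLittleO_iff]
  intro ε hε
  obtain ⟨δ, hδ, h⟩ := exists_forall_dist_lt hΩ hF' hγ hε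
  have hid : ContinuousOn (id : E → E) Ω := continuousOn_id
  obtain ⟨δ', hδ', h'⟩ := Metric.isOpen_iff.mp (isOpen_valuedIn (X := X) hΩ) γ hγ
  obtain ⟨d, hd, hball⟩ : ∃ d > 0, ∀ r : X, Metric.ball (γ r) d ⊆ Ω := by
    obtain ⟨d, hd, hd'⟩ := (isCompact_range γ.continuous).exists_thickening_subset_open hΩ
      (by rintro _ ⟨r, rfl⟩; exact hγ (mem_univ r))
    exact ⟨d, hd, fun r => (Metric.ball_subset_thickening (mem_range_self r) d).trans hd'⟩
  filter_upwards [Metric.ball_mem_nhds γ (lt_min hδ (lt_min hδ' hd))] with γ' hγ'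
  have hlt : dist γ' γ < min δ (min δ' d) := hγ'
  have hγ'Ω : γ' ∈ valuedIn X Ω := h' (hlt.trans_le ((min_le_right _ _).trans (min_le_left _ _)))
  refine (ContinuousMap.norm_le _ (by positivity)).mpr fun r => ?_
  have hr : dist (γ' r) (γ r) < min δ d :=
    (ContinuousMap.dist_apply_le_dist r).trans_lt (hlt.trans_le
      (le_min (min_le_left _ _) ((min_le_right _ _).trans (min_le_right _ _))))
  have hmv := (convex_ball (γ r) (min δ d)).norm_image_sub_le_of_norm_fderiv_le' (𝕜 := ℝ)
    (f := F) (φ := fderiv ℝ F (γ r)) (C := ε) (x := γ r) (y := γ' r)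
    (fun x hx => (hF.differentiableAt (hΩ.mem_nhds
      (hball r (Metric.ball_subset_ball (min_le_right _ _) hx)))))
    (fun x hx => by
      rw [← dist_eq_norm]
      exact (h r x (lt_of_lt_of_le hx (min_le_left _ _))).le)
    (Metric.mem_ball_self (lt_min hδ hd)) hr
  simp only [ContinuousMap.sub_apply]
  rw [superpose_apply hF.continuousOn hγ, superpose_apply hF.continuousOn hγ'Ω,
    pointwiseApply_apply, superpose_apply hF' hγ]
  refine hmv.trans ?_
  gcongr
  exact (γ' - γ).norm_coe_le_norm r

/-- The derivative of a superposition operator is composed of a bounded bilinear map and the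
superposition operator of the derivative, which allows for an induction with variable range `G`. -/
theorem contDiffOn_superpose_nat (n : ℕ) : ∀ {G : Type} [NormedAddCommGroup G] [NormedSpace ℝ G]
    {F : E → G} {Ω : Set E}, IsOpen Ω → ContDiffOn ℝ n F Ω →
      ContDiffOn ℝ n (superpose F : C(X, E) → C(X, G)) (valuedIn X Ω) := by
  induction n with
  | zero =>
    intro G _ _ F Ω hΩ hF
    exact contDiffOn_zero.mpr (continuousOn_superpose hΩ (contDiffOn_zero.mp hF))
  | succ n ih =>
    intro G _ _ F Ω hΩ hF
    push_cast at hF ⊢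
    obtain ⟨hd, -, hd'⟩ := (contDiffOn_succ_iff_fderiv_of_isOpen hΩ).mp hF
    have hder : ∀ γ ∈ valuedIn X Ω,
        HasFDerivAt (superpose F) (pointwiseApply (superpose (fderiv ℝ F) γ)) γ :=
      fun γ hγ => hasFDerivAt_superpose hΩ hd hd'.continuousOn hγ
    rw [contDiffOn_succ_iff_fderiv_of_isOpen (isOpen_valuedIn hΩ)]
    refine ⟨fun γ hγ => (hder γ hγ).differentiableAt.differentiableWithinAt, by simp, ?_⟩
    refine ContDiffOn.congr ?_ fun γ hγ => (hder γ hγ).fderiv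
    exact (pointwiseApply (X := X) (E := E) (G := G)).contDiff.comp_contDiffOn (ih hΩ hd')

theorem contDiffOn_superpose {F : E → G} {Ω : Set E} (hΩ : IsOpen Ω) (hF : ContDiffOn ℝ ∞ F Ω) :
    ContDiffOn ℝ ∞ (superpose F : C(X, E) → C(X, G)) (valuedIn X Ω) :=
  contDiffOn_infty.mpr fun n => contDiffOn_superpose_nat n hΩ (contDiffOn_infty.mp hF n)

end Superposition

/-! ### A smooth implicit function on a neighbourhood -/

/-- The implicit function theorem, with a solution that is smooth on a whole neighbourhood and is
the only one near the base point. -/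
theorem exists_contDiffOn_implicit {P V W : Type*} [NormedAddCommGroup P] [NormedSpace ℝ P]
    [CompleteSpace P] [NormedAddCommGroup V] [NormedSpace ℝ V] [CompleteSpace V]
    [NormedAddCommGroup W] [NormedSpace ℝ W] [CompleteSpace W] {Φ : P × V → W} {O : Set (P × V)}
    (hO : IsOpen O) (hΦ : ContDiffOn ℝ ∞ Φ O) {u : P × V} (hu : u ∈ O) (hu0 : Φ u = 0)
    (hinv : (fderiv ℝ Φ u ∘L ContinuousLinearMap.inr ℝ P V).IsInvertible) :
    ∃ ψ : P → V, ψ u.1 = u.2 ∧ (∀ᶠ q in 𝓝 u, Φ q = 0 → ψ q.1 = q.2) ∧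
      ∀ᶠ p in 𝓝 u.1, ContDiffAt ℝ ∞ ψ p ∧ (p, ψ p) ∈ O ∧ Φ (p, ψ p) = 0 := by
  have hne : (∞ : WithTop ℕ∞) ≠ 0 := by simp
  have hcd : ∀ q ∈ O, ContDiffAt ℝ ∞ Φ q := fun q hq => hΦ.contDiffAt (hO.mem_nhds hq)
  set ψ := (hcd u hu).implicitFunction hne hinv with hψ
  have hψu : ψ u.1 = u.2 := (hcd u hu).implicitFunction_apply_self hne hinv
  have hψc : ContDiffAt ℝ ∞ ψ u.1 := (hcd u hu).contDiffAt_implicitFunction hne hinv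
  have hzero : ∀ᶠ p in 𝓝 u.1, Φ (p, ψ p) = 0 := by
    filter_upwards [(hcd u hu).eventually_apply_implicitFunction hne hinv] with p hp
    rw [hp, hu0]
  refine ⟨ψ, hψu, ?_, ?_⟩
  · filter_upwards [(hcd u hu).eventually_apply_eq_iff_implicitFunction hne hinv] with q hq h0
    exact hq.mp (h0.trans hu0.symm)
  have hgraph : Tendsto (fun p => (p, ψ p)) (𝓝 u.1) (𝓝 u) := by
    have := (continuousAt_id.prodMk hψc.continuousAt : ContinuousAt (fun p => (p, ψ p)) u.1)
    rwa [ContinuousAt, hψu] at this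
  have hinv' : ∀ᶠ q in 𝓝 u, (fderiv ℝ Φ q ∘L ContinuousLinearMap.inr ℝ P V).IsInvertible := by
    have hc : ContinuousAt (fun q => fderiv ℝ Φ q ∘L ContinuousLinearMap.inr ℝ P V) u := by
      have h1 : ContinuousAt (fderiv ℝ Φ) u :=
        ((hcd u hu).fderiv_right (m := 0) (by simp)).continuousAt
      exact h1.clm_comp continuousAt_const
    obtain ⟨L, hL⟩ := hinv
    have hopen := ContinuousLinearEquiv.isOpen (𝕜 := ℝ) (E := V) (F := W)
    filter_upwards [hc (hopen.mem_nhds ⟨L, hL⟩)] with q hq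
    exact hq
  have hcont : ∀ᶠ p in 𝓝 u.1, ContinuousAt ψ p := by
    have h1 : ContDiffAt ℝ 1 ψ u.1 := hψc.of_le (by simp)
    filter_upwards [h1.eventually (by simp)] with p hp
    exact hp.continuousAt
  filter_upwards [hgraph (hO.mem_nhds hu), hgraph hinv', eventually_eventually_nhds.mpr hzero,
    hcont] with p hpO hpinv hp0 hpc
  refine ⟨?_, hpO, hp0.self_of_nhds⟩
  have hloc := (hcd _ hpO).eventually_apply_eq_iff_implicitFunction hne hpinv
  have hgraph' : Tendsto (fun p => (p, ψ p)) (𝓝 p) (𝓝 (p, ψ p)) :=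
    (continuousAt_id.prodMk hpc : ContinuousAt (fun p => (p, ψ p)) p)
  -- near `p`, `ψ` agrees with the implicit function based at `(p, ψ p)`
  have heq : ψ =ᶠ[𝓝 p] (hcd _ hpO).implicitFunction hne hpinv := by
    filter_upwards [hgraph'.eventually hloc, hp0] with q hq hq0
    exact (hq.mp (hq0.trans hp0.self_of_nhds.symm)).symm
  exact ((hcd _ hpO).contDiffAt_implicitFunction hne hpinv).congr_of_eventuallyEq heq

/-! ### The flow of a smooth vector field on a Banach space -/

section Flow

variable {E : Type} [NormedAddCommGroup E] [NormedSpace ℝ E]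

/-- Integration from `0`, as an operator on `C([0, 1], E)`. -/
def integrateL [CompleteSpace E] : C(unitInterval, E) →L[ℝ] C(unitInterval, E) :=
  LinearMap.mkContinuous
    { toFun := fun γ => ⟨fun r => ∫ σ in (0 : ℝ)..r, ContinuousMap.IccExtend zero_le_one γ σ, by
        have h := intervalIntegral.continuous_primitive (μ := MeasureTheory.volume)
          (f := ContinuousMap.IccExtend zero_le_one γ)
          (fun a b => (ContinuousMap.continuous _).intervalIntegrable a b) 0
        exact h.comp continuous_subtype_val⟩
      map_add' := fun γ γ' => by
        ext r
        exact intervalIntegral.integral_add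
          ((ContinuousMap.IccExtend zero_le_one γ).continuous.intervalIntegrable _ _)
          ((ContinuousMap.IccExtend zero_le_one γ').continuous.intervalIntegrable _ _)
      map_smul' := fun c γ => by
        ext r
        exact intervalIntegral.integral_smul c _ } 1 fun γ => by
    rw [one_mul]
    refine (ContinuousMap.norm_le _ (norm_nonneg _)).mpr fun r => ?_
    refine (intervalIntegral.norm_integral_le_of_norm_le_const (C := ‖γ‖) fun σ _ =>
      γ.norm_coe_le_norm _).trans ?_
    rw [sub_zero, abs_of_nonneg r.2.1]
    exact mul_le_of_le_one_right (norm_nonneg _) r.2.2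

theorem integrateL_apply [CompleteSpace E] (γ : C(unitInterval, E)) (r : unitInterval) :
    integrateL γ r = ∫ σ in (0 : ℝ)..r, γ (projIcc 0 1 zero_le_one σ) := rfl

/-- Constant functions, as a continuous linear map. -/
def constantL : E →L[ℝ] C(unitInterval, E) :=
  LinearMap.mkContinuous
    { toFun := ContinuousMap.const unitInterval
      map_add' := fun _ _ => rfl
      map_smul' := fun _ _ => rfl } 1 fun x => by
    rw [one_mul]
    exact (ContinuousMap.norm_le _ (norm_nonneg _)).mpr fun r => le_rfl

theorem constantL_apply (x : E) (r : unitInterval) : constantL x r = x := rfl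

/-- A path and its slowed down versions `r ↦ γ (λ r)`. -/
def slowDown (l : unitInterval) (γ : C(unitInterval, E)) : C(unitInterval, E) :=
  ⟨fun r => γ (l * r), by fun_prop⟩

/-- The local flow of a smooth vector field depends smoothly on time and on the initial value.
The implicit function theorem is applied in `C([0, 1], E)` to `γ = w + τ ∫ F(γ)`, near `τ = 0`,
where the solution is constant; then `φ (τ, w) = γ 1`. -/
theorem exists_smooth_flow [CompleteSpace E] {F : E → E} {Ω : Set E} (hΩ : IsOpen Ω)
    (hF : ContDiffOn ℝ ∞ F Ω) {x₀ : E} (hx₀ : x₀ ∈ Ω) :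
    ∃ T > 0, ∃ U : Set E, IsOpen U ∧ x₀ ∈ U ∧ ∃ φ : ℝ × E → E,
      ContDiffOn ℝ ∞ φ (Ioo (-T) T ×ˢ U) ∧ ∀ w ∈ U, φ (0, w) = w ∧
        ∀ t ∈ Ioo (-T) T, φ (t, w) ∈ Ω ∧
          HasDerivAt (fun τ => φ (τ, w)) (F (φ (t, w))) t := by
  let O : Set ((ℝ × E) × C(unitInterval, E)) := Prod.snd ⁻¹' valuedIn unitInterval Ω
  let Φ : (ℝ × E) × C(unitInterval, E) → C(unitInterval, E) := fun q =>
    q.2 - constantL q.1.2 - q.1.1 • integrateL (superpose F q.2)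
  have hO : IsOpen O := (isOpen_valuedIn hΩ).preimage continuous_snd
  have hΦ : ContDiffOn ℝ ∞ Φ O := by
    have h1 : ContDiffOn ℝ ∞ (fun q : (ℝ × E) × C(unitInterval, E) =>
        integrateL (superpose F q.2)) O :=
      integrateL.contDiff.comp_contDiffOn
        ((contDiffOn_superpose hΩ hF).comp contDiff_snd.contDiffOn fun q hq => hq)
    have h2 : ContDiff ℝ ∞ fun q : (ℝ × E) × C(unitInterval, E) => q.2 - constantL q.1.2 :=
      contDiff_snd.sub ((constantL (E := E)).contDiff.comp (contDiff_snd.comp contDiff_fst))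
    exact h2.contDiffOn.sub ((contDiff_fst.comp contDiff_fst).contDiffOn.smul h1)
  let u : (ℝ × E) × C(unitInterval, E) := ((0, x₀), constantL x₀)
  have hu : u ∈ O := fun r _ => hx₀
  have hu0 : Φ u = 0 := by simp [Φ, u]
  -- at `τ = 0` the equation reads `γ - w = 0`
  have hinv : (fderiv ℝ Φ u ∘L
      ContinuousLinearMap.inr ℝ (ℝ × E) C(unitInterval, E)).IsInvertible := by
    have h1 : HasFDerivAt Φ (fderiv ℝ Φ u) u :=
      ((hΦ.contDiffAt (hO.mem_nhds hu)).differentiableAt (by simp)).hasFDerivAt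
    have h2 : HasFDerivAt (fun γ : C(unitInterval, E) => (((0, x₀) : ℝ × E), γ))
        (ContinuousLinearMap.inr ℝ (ℝ × E) C(unitInterval, E)) (constantL x₀) :=
      hasFDerivAt_prodMk_right _ _
    have h3 := HasFDerivAt.comp (constantL x₀) h1 h2
    have h4 : HasFDerivAt (fun γ : C(unitInterval, E) => γ - constantL x₀)
        (ContinuousLinearMap.id ℝ C(unitInterval, E)) (constantL x₀) :=
      (hasFDerivAt_id _).sub_const _
    have h5 : Φ ∘ (fun γ : C(unitInterval, E) => (((0, x₀) : ℝ × E), γ)) =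
        fun γ : C(unitInterval, E) => γ - constantL x₀ := by
      funext γ
      simp [Φ]
    rw [h5] at h3
    rw [h3.unique h4]
    exact ⟨ContinuousLinearEquiv.refl ℝ _, rfl⟩
  obtain ⟨ψ, hψu, huniq, hψ⟩ := exists_contDiffOn_implicit hO hΦ hu hu0 hinv
  have hψc : ContinuousAt ψ u.1 := (hψ.self_of_nhds).1.continuousAt
  -- a product neighbourhood on which solutions are unique
  obtain ⟨δ, hδ, hball⟩ := Metric.eventually_nhds_iff_ball.mp huniq
  have hclose : ∀ᶠ p in 𝓝 u.1, dist (ψ p) (constantL x₀) < δ := by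
    have := hψc (Metric.ball_mem_nhds _ hδ)
    rw [hψu] at this
    exact this
  obtain ⟨T', hT', hgood⟩ := Metric.eventually_nhds_iff_ball.mp (hψ.and hclose)
  set T := min T' δ with hTdef
  have hT : 0 < T := lt_min hT' hδ
  have hprod : ∀ t ∈ Ioo (-T) T, ∀ w ∈ Metric.ball x₀ T, ((t, w) : ℝ × E) ∈ Metric.ball u.1 T := by
    intro t ht w hw
    rw [Metric.mem_ball, Prod.dist_eq]
    refine max_lt ?_ hw
    simpa [u, Real.dist_eq, abs_lt] using ht
  have hgood' : ∀ t ∈ Ioo (-T) T, ∀ w ∈ Metric.ball x₀ T, _ := fun t ht w hw =>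
    hgood (t, w) (Metric.ball_subset_ball (min_le_left _ _) (hprod t ht w hw))
  have heq : ∀ t ∈ Ioo (-T) T, ∀ w ∈ Metric.ball x₀ T, ∀ r : unitInterval,
      ψ (t, w) r = w + t • ∫ σ in (0 : ℝ)..r, F (ψ (t, w) (projIcc 0 1 zero_le_one σ)) := by
    intro t ht w hw r
    obtain ⟨⟨-, hΩt, h0⟩, -⟩ := hgood' t ht w hw
    have h1 := congrArg (fun γ : C(unitInterval, E) => γ r) h0
    simp only [Φ, ContinuousMap.sub_apply, ContinuousMap.smul_apply, constantL_apply,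
      ContinuousMap.zero_apply, integrateL_apply] at h1
    rw [sub_sub, sub_eq_zero] at h1
    rw [h1]
    congr 2
    refine intervalIntegral.integral_congr fun σ _ => ?_
    exact superpose_apply hF.continuousOn hΩt _
  -- the slowed down path solves the equation for the time `l t`, hence it is `ψ (l t, w)`
  have hslow : ∀ t ∈ Ioo (-T) T, ∀ w ∈ Metric.ball x₀ T, ∀ l : unitInterval,
      ψ ((l : ℝ) * t, w) 1 = ψ (t, w) l := by
    intro t ht w hw l
    have hlt : (l : ℝ) * t ∈ Ioo (-T) T := by
      rw [mem_Ioo, ← abs_lt] at ht ⊢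
      rw [abs_mul, abs_of_nonneg l.2.1]
      exact (mul_le_of_le_one_left (abs_nonneg _) l.2.2).trans_lt ht
    obtain ⟨⟨-, hΩt, h0⟩, hdist⟩ := hgood' t ht w hw
    have hΩs : slowDown l (ψ (t, w)) ∈ valuedIn unitInterval Ω := fun r _ => hΩt (mem_univ _)
    have h1 : Φ (((l : ℝ) * t, w), slowDown l (ψ (t, w))) = 0 := by
      ext r
      simp only [Φ, ContinuousMap.sub_apply, ContinuousMap.smul_apply, constantL_apply,
        ContinuousMap.zero_apply, integrateL_apply]
      rw [sub_sub, sub_eq_zero]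
      have h2 : slowDown l (ψ (t, w)) r = ψ (t, w) (l * r) := rfl
      rw [h2, heq t ht w hw]
      congr 1
      rw [mul_comm (l : ℝ) t, mul_smul]
      congr 1
      have h3 := intervalIntegral.smul_integral_comp_mul_left (a := 0) (b := r)
        (fun σ => F (ψ (t, w) (projIcc 0 1 zero_le_one σ))) (l : ℝ)
      rw [mul_zero] at h3
      rw [Set.Icc.coe_mul, ← h3]
      congr 1
      refine intervalIntegral.integral_congr fun σ hσ => ?_
      rw [uIcc_of_le r.2.1] at hσ
      have hσ1 : σ ∈ Icc (0 : ℝ) 1 := ⟨hσ.1, hσ.2.trans r.2.2⟩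
      have hσ2 : (l : ℝ) * σ ∈ Icc (0 : ℝ) 1 :=
        ⟨mul_nonneg l.2.1 hσ.1, mul_le_one₀ l.2.2 hσ.1 hσ1.2⟩
      rw [superpose_apply hF.continuousOn hΩs, projIcc_of_mem _ hσ1, projIcc_of_mem _ hσ2]
      rfl
    have h2 : (((l : ℝ) * t, w), slowDown l (ψ (t, w))) ∈ Metric.ball u δ := by
      rw [Metric.mem_ball, Prod.dist_eq]
      refine max_lt ?_ ?_
      · exact (Metric.mem_ball.mp (hprod _ hlt w hw)).trans_le (min_le_right _ _)
      · refine lt_of_le_of_lt ((ContinuousMap.dist_le dist_nonneg).mpr fun r => ?_) hdist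
        exact ContinuousMap.dist_apply_le_dist (f := ψ (t, w)) (g := constantL x₀) (l * r)
    have h3 := hball _ h2 h1
    simp only at h3
    rw [h3]
    change ψ (t, w) (l * 1) = _
    rw [mul_one]
  let φ : ℝ × E → E := fun p => ψ p 1
  have hφint : ∀ t ∈ Ioo (-T) T, ∀ w ∈ Metric.ball x₀ T,
      φ (t, w) = w + ∫ σ in (0 : ℝ)..t, F (φ (σ, w)) := by
    intro t ht w hw
    have h1 := heq t ht w hw 1
    have h3 := intervalIntegral.smul_integral_comp_mul_left (a := 0) (b := 1)
      (fun σ => F (φ (σ, w))) t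
    rw [mul_zero, mul_one] at h3
    rw [← h3]
    simp only [φ]
    rw [h1]
    congr 2
    refine intervalIntegral.integral_congr fun σ hσ => ?_
    have hσ' : σ ∈ Icc (0 : ℝ) 1 := by simpa using hσ
    rw [projIcc_of_mem _ hσ', ← hslow t ht w hw ⟨σ, hσ'⟩, mul_comm]
  have hφsm : ContDiffOn ℝ ∞ φ (Ioo (-T) T ×ˢ Metric.ball x₀ T) := by
    rintro ⟨t, w⟩ ⟨ht, hw⟩
    have h1 : ContDiffAt ℝ ∞ ψ (t, w) := (hgood' t ht w hw).1.1
    exact ((ContinuousMap.evalCLM ℝ (1 : unitInterval)).contDiff.contDiffAt.comp (t, w)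
      h1).contDiffWithinAt
  have hφΩ : ∀ t ∈ Ioo (-T) T, ∀ w ∈ Metric.ball x₀ T, φ (t, w) ∈ Ω := fun t ht w hw =>
    (hgood' t ht w hw).1.2.1 (mem_univ 1)
  refine ⟨T, hT, Metric.ball x₀ T, Metric.isOpen_ball, Metric.mem_ball_self hT, φ, hφsm,
    fun w hw => ⟨?_, fun t ht => ⟨hφΩ t ht w hw, ?_⟩⟩⟩
  · have := hφint 0 ⟨by linarith, hT⟩ w hw
    simpa using this
  have hcont : ContinuousOn (fun σ => F (φ (σ, w))) (Ioo (-T) T) := by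
    refine hF.continuousOn.comp ?_ fun σ hσ => hφΩ σ hσ w hw
    exact hφsm.continuousOn.comp (by fun_prop) fun σ hσ => ⟨hσ, hw⟩
  have hsub : uIcc 0 t ⊆ Ioo (-T) T :=
    (convex_Ioo (-T) T).ordConnected.uIcc_subset ⟨by linarith, hT⟩ ht
  have hder := (intervalIntegral.integral_hasDerivAt_right
    (hcont.mono hsub).intervalIntegrable
    (hcont.stronglyMeasurableAtFilter isOpen_Ioo t ht)
    (hcont.continuousAt (isOpen_Ioo.mem_nhds ht))).const_add w
  refine hder.congr_of_eventuallyEq ?_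
  filter_upwards [isOpen_Ioo.mem_nhds ht] with τ hτ
  exact hφint τ hτ w hw

end Flow

/-! ### The Camassa-Holm spray through first-order equations -/

theorem eq_zero_of_coe_eq_zero {t : ℝ} (h : (t : S1) = 0) (ht : |t| < 2 * Real.pi) : t = 0 := by
  obtain ⟨n, hn⟩ := AddCircle.coe_eq_zero_iff (2 * Real.pi) |>.mp h
  have hπ := Real.two_pi_pos
  rw [← hn, zsmul_eq_mul, abs_mul, abs_of_pos hπ, mul_lt_iff_lt_one_left hπ] at ht
  have h0 : n = 0 := by
    have : |n| < 1 := by exact_mod_cast ht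
    exact Int.abs_lt_one_iff.mp this
  rw [← hn, h0, zero_smul]

/-- A map of the circle whose lift to the line is differentiable. -/
theorem HasCircleDeriv.comp_lift {p p' : S1 → ℝ} (h : HasCircleDeriv p p') {φ : S1 → S1}
    {X : ℝ → ℝ} {c : S1 → ℝ} (hX : ∀ x : ℝ, φ (x : S1) = (X x : S1))
    (hd : ∀ x : ℝ, HasDerivAt X (c (x : S1)) x) :
    HasCircleDeriv (fun x => p (φ x)) fun x => c x * p' (φ x) := fun x => by
  have h1 := (h (X x)).scomp x (hd x)
  have h2 : (fun τ : ℝ => p (φ (τ : S1))) = (fun τ : ℝ => p (τ : S1)) ∘ X := by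
    funext τ
    rw [hX]
    rfl
  rw [h2]
  refine h1.congr_deriv ?_
  beta_reduce
  rw [hX, smul_eq_mul]

section Spray

variable {s : ℝ} (hs : 3 / 2 < s)

theorem hasDerivAt_lift (d : ℤ) (f : Hs s) (x : ℝ) :
    HasDerivAt (fun τ : ℝ => d * τ + f (τ : S1)) (d + Hs.derivL hs f x) x := by
  have h1 := ((hasDerivAt_id x).const_mul (d : ℝ)).add (f.hasCircleDeriv hs x)
  rw [mul_one] at h1
  exact h1

theorem coe_lift (d : ℤ) (t y : ℝ) : ((d * t + y : ℝ) : S1) = d • (t : S1) + (y : S1) := by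
  rw [AddCircle.coe_add, ← zsmul_eq_mul, AddCircle.coe_zsmul]

theorem continuous_of_eq {φ : S1 → S1} {d : ℤ} {f : Hs s}
    (h : ∀ x, φ x = d • x + ((f x : ℝ) : S1)) : Continuous φ := by
  rw [funext h]
  exact (continuous_zsmul d).add ((AddCircle.continuous_mk' _).comp f.toCont.continuous)

/-- The chain rule for `η ∘ η⁻¹ = id`. -/
theorem slope_mul_slope_inv {η : S1 ≃ S1} {d d' : ℤ} {f g : Hs s}
    (hη : ∀ x, η x = d • x + ((f x : ℝ) : S1))
    (hζ : ∀ y, η.symm y = d' • y + ((g y : ℝ) : S1)) (y : S1) :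
    (d + Hs.derivL hs f (η.symm y)) * (d' + Hs.derivL hs g y) = 1 := by
  induction y using QuotientAddGroup.induction_on with
  | H y =>
    have hZ : ∀ y : ℝ, η.symm (y : S1) = ((d' * y + g (y : S1) : ℝ) : S1) := fun y => by
      rw [hζ, coe_lift]
    have hX : ∀ x : ℝ, η (x : S1) = ((d * x + f (x : S1) : ℝ) : S1) := fun x => by
      rw [hη, coe_lift]
    have h1 := (hasDerivAt_lift hs d f _).comp y (hasDerivAt_lift hs d' g y)
    set G : ℝ → ℝ := (fun τ : ℝ => d * τ + f (τ : S1)) ∘ fun τ : ℝ => d' * τ + g (τ : S1) with hG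
    have hGcoe : ∀ y : ℝ, (G y : S1) = (y : S1) := fun y => by
      rw [hG, Function.comp_apply, ← hX, ← hZ, η.apply_symm_apply]
    have h2 := h1.fun_sub (hasDerivAt_id' y)
    -- `G - id` is continuous with values in `2πℤ`, hence locally constant
    have h3 : ∀ᶠ z in 𝓝 y, G z - z = G y - y := by
      have hc := h2.continuousAt
      filter_upwards [Metric.continuousAt_iff'.mp hc (2 * Real.pi) Real.two_pi_pos] with z hz
      rw [Real.dist_eq] at hz
      refine sub_eq_zero.mp (eq_zero_of_coe_eq_zero ?_ hz)
      simp only [AddCircle.coe_sub, hGcoe, sub_self]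
    have h4 := h2.congr_of_eventuallyEq (f₁ := fun _ => G y - y) (by
      filter_upwards [h3] with z hz
      exact hz.symm)
    have h5 := h4.unique (hasDerivAt_const y (G y - y))
    have h6 := sub_eq_zero.mp h5
    rw [← hZ] at h6
    exact h6

/-- The derivative of a diffeomorphism of class `H^s` does not vanish. -/
theorem Ds.slope_ne_zero (η : Ds s) {d : ℤ} {f : Hs s}
    (hη : ∀ x, η x = d • x + ((f x : ℝ) : S1)) (x : S1) : (d : ℝ) + Hs.derivL hs f x ≠ 0 := by
  obtain ⟨d', g, hζ⟩ := η.2.2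
  have h := slope_mul_slope_inv hs hη hζ (η x)
  rw [η.1.symm_apply_apply] at h
  exact left_ne_zero_of_mul_eq_one h

/-- `u² + ½ u_y²`, pulled back by `η` and multiplied by the derivative `a` of `η`, in terms of the
velocity `v = u ∘ η` and its derivative `v₁ = a (u_y ∘ η)`. -/
def density (a v v₁ : ℝ) : ℝ := a * (v ^ 2 + 1 / 2 * (v₁ / a) ^ 2)

/-- The spray in terms of the solutions `q₁`, `q₂` of `a q₁ - q₁' = b`, `a q₂ + q₂' = b`, where `a`
is the derivative of `η` and `b` is the density. With `h = u² + ½ u_y²`, these are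
`q₁ = ((1 - ∂)⁻¹ h) ∘ η` and `q₂ = ((1 + ∂)⁻¹ h) ∘ η`. -/
theorem exists_chSpray_eq (η : Ds s) (v : Hs s) {d : ℤ} {f : Hs s}
    (hη : ∀ x, η x = d • x + ((f x : ℝ) : S1)) {a b : S1 → ℝ}
    (ha : ∀ x, a x = d + Hs.derivL hs f x)
    (hb : ∀ x, b x = density (a x) (v x) (Hs.derivL hs v x)) :
    ∃ q₁ q₂ : S1 → ℝ, HasCircleDeriv q₁ (fun x => a x * q₁ x - b x) ∧
      HasCircleDeriv q₂ (fun x => b x - a x * q₂ x) ∧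
      ∀ x, chSpray η v x = (q₂ x - q₁ x) / 2 := by
  obtain ⟨d', g, hζ⟩ := η.2.2
  have hane : ∀ x, a x ≠ 0 := fun x => by
    rw [ha]
    exact η.slope_ne_zero hs hη x
  have hac : Continuous a := by
    rw [funext ha]
    exact continuous_const.add (Hs.derivL hs f).toCont.continuous
  have hζc : Continuous η.inv := continuous_of_eq hζ
  have hu : HasCircleDeriv (fun y => v (η.inv y))
      fun y => (d' + Hs.derivL hs g y) * Hs.derivL hs v (η.inv y) :=
    (v.hasCircleDeriv hs).comp_lift (X := fun τ : ℝ => d' * τ + g (τ : S1))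
      (fun y => by rw [Ds.inv, hζ, coe_lift]) (hasDerivAt_lift hs d' g)
  have hslope : ∀ y, d' + Hs.derivL hs g y = (a (η.inv y))⁻¹ := fun y => by
    rw [ha]
    exact eq_inv_of_mul_eq_one_right (slope_mul_slope_inv hs hη hζ y)
  let w : C(S1, ℝ) := ⟨fun x => v x ^ 2 + 1 / 2 * (Hs.derivL hs v x / a x) ^ 2, by
    have h1 := v.toCont.continuous
    have h2 := (Hs.derivL hs v).toCont.continuous.div hac hane
    fun_prop⟩
  let h : C(S1, ℝ) := w.comp ⟨η.inv, hζc⟩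
  have hh : (fun y => v (η.inv y) ^ 2 + 1 / 2 * dy (fun y => v (η.inv y)) y ^ 2) = h := by
    funext y
    rw [hu.dy_eq]
    beta_reduce
    rw [hslope, inv_mul_eq_div]
    rfl
  have hhη : ∀ x, h (η x) = w x := fun x => by
    have : η.inv (η x) = x := η.1.symm_apply_apply x
    change w (η.inv (η x)) = w x
    rw [this]
  have hbw : ∀ x, b x = a x * w x := hb
  obtain ⟨p₁, hp₁⟩ := exists_resolvent (κ := 1) (by norm_num) h
  obtain ⟨p₂, hp₂⟩ := exists_resolvent (κ := -1) (by norm_num) h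
  have hη' : ∀ x : ℝ, η (x : S1) = ((d * x + f (x : S1) : ℝ) : S1) := fun x => by
    rw [hη, coe_lift]
  have hd : ∀ x : ℝ, HasDerivAt (fun τ : ℝ => d * τ + f (τ : S1)) (a (x : S1)) x := fun x => by
    rw [ha]
    exact hasDerivAt_lift hs d f x
  refine ⟨fun x => p₁ (η x), fun x => p₂ (η x), ?_, ?_, fun x => ?_⟩
  · intro x
    refine (hp₁.comp_lift hη' hd x).congr_deriv ?_
    beta_reduce
    rw [hhη, hbw]
    ring
  · intro x
    refine (hp₂.comp_lift hη' hd x).congr_deriv ?_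
    beta_reduce
    rw [hhη, hbw]
    ring
  · have h1 : HasCircleDeriv (p₁ : S1 → ℝ) fun x => p₁ x - h x := fun x =>
      (hp₁ x).congr_deriv (one_mul _)
    have h2 : HasCircleDeriv (p₂ : S1 → ℝ) fun x => h x - p₂ x := fun x =>
      (hp₂ x).congr_deriv (by ring)
    have h3 := invHelmholtzDy_eq h1 h2 (η x)
    simp only [chSpray]
    rw [hh, h3]
    ring

end Spray

/-! ### The spray as a smooth vector field near the identity -/

section VectorField

open scoped ENNReal

variable {s : ℝ} (hs : 3 / 2 < s)

theorem half_lt_sub_one {s : ℝ} (hs : 3 / 2 < s) : 1 / 2 < s - 1 := by linarith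

/-- The derivative `1 + f'` of `x ↦ x + f(x)`, in `H^{s-1}`. -/
def slopeHs (f : Hs s) : Hs (s - 1) := Hs.one (s - 1) + Hs.derivL hs f

theorem slopeHs_apply (f : Hs s) (x : S1) : slopeHs hs f x = 1 + Hs.derivL hs f x := by
  have h : (slopeHs hs f).toCont = (Hs.one (s - 1)).toCont + (Hs.derivL hs f).toCont := rfl
  rw [h, Hs.toCont_one]
  rfl

/-- Multiplication by `1 + f'` on `H^{s-1}`. -/
def mulSlope (f : Hs s) : Hs (s - 1) →L[ℝ] Hs (s - 1) :=
  Hs.mulL (half_lt_sub_one hs) (slopeHs hs f)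

/-- The first-order operator `q ↦ (1 + f') q - κ q'` from `H^s` to `H^{s-1}`. -/
def firstOrderL (κ : ℝ) (f : Hs s) : Hs s →L[ℝ] Hs (s - 1) :=
  mulSlope hs f ∘L Hs.inclL (sub_le_self s zero_le_one) - κ • Hs.derivL hs

theorem contDiff_mulSlope {n : WithTop ℕ∞} : ContDiff ℝ n (mulSlope hs) :=
  (Hs.mulL (half_lt_sub_one hs)).contDiff.comp (contDiff_const.add (Hs.derivL hs).contDiff)

theorem contDiff_firstOrderL {n : WithTop ℕ∞} (κ : ℝ) : ContDiff ℝ n (firstOrderL hs κ) :=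
  ((contDiff_mulSlope hs).clm_comp contDiff_const).sub contDiff_const

theorem mulSlope_apply (f : Hs s) (g : Hs (s - 1)) (x : S1) :
    mulSlope hs f g x = (1 + Hs.derivL hs f x) * g x := by
  rw [← slopeHs_apply, mulSlope, Hs.toCont_mulL]
  rfl

theorem firstOrderL_apply (κ : ℝ) (f q : Hs s) (x : S1) :
    firstOrderL hs κ f q x = (1 + Hs.derivL hs f x) * q x - κ * Hs.derivL hs q x := by
  have h : (firstOrderL hs κ f q).toCont =
      (mulSlope hs f (Hs.inclL (sub_le_self s zero_le_one) q)).toCont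
      - κ • (Hs.derivL hs q).toCont := rfl
  rw [h, ContinuousMap.sub_apply, mulSlope_apply, Hs.toCont_inclL]
  rfl

theorem Hs.ext_apply {r : ℝ} {f g : Hs r} (h : ∀ x, f x = g x) : f = g :=
  Hs.ext_toCont (ContinuousMap.ext h)

theorem Hs.zero_apply {r : ℝ} (x : S1) : (0 : Hs r) x = 0 := rfl

theorem mulSlope_zero : mulSlope hs 0 = 1 := by
  refine ContinuousLinearMap.ext fun g => Hs.ext_apply fun x => ?_
  rw [mulSlope_apply, map_zero, Hs.zero_apply, add_zero, one_mul]
  rfl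

theorem Hs.coeff_sub_smul {r : ℝ} (f g : Hs r) (κ : ℝ) (n : ℤ) :
    coeff (f - κ • g : Hs r) n = coeff f n - κ * coeff g n := by
  have h : f - κ • g = f + (-κ) • g := by module
  rw [h, Hs.coeff_add', Hs.coeff_smul']
  push_cast
  ring

theorem coeff_firstOrderL_zero (κ : ℝ) (f : Hs s) (n : ℤ) :
    coeff (firstOrderL hs κ 0 f) n = (1 - κ * (Complex.I * n)) * coeff f n := by
  have h : firstOrderL hs κ 0 f =
      Hs.inclL (sub_le_self s zero_le_one) f - κ • Hs.derivL hs f := by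
    rw [firstOrderL, mulSlope_zero]
    rfl
  rw [h, Hs.coeff_sub_smul, Hs.coeff_derivL, Hs.toCont_inclL, dcoeff]
  ring

theorem norm_symbol {κ : ℝ} (hκ : κ ^ 2 = 1) (n : ℤ) :
    ‖1 - κ * (Complex.I * n)‖ = weight 1 n := by
  rw [← sq_eq_sq₀ (norm_nonneg _) (weight_pos _ _).le, weight_one_sq, Complex.sq_norm,
    Complex.normSq_apply]
  simp
  linear_combination (n : ℝ) ^ 2 * hκ

theorem symbol_ne_zero {κ : ℝ} (hκ : κ ^ 2 = 1) (n : ℤ) : (1 - κ * (Complex.I * n) : ℂ) ≠ 0 := by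
  rw [← norm_pos_iff, norm_symbol hκ]
  exact weight_pos _ _

/-- At the identity, the first-order operators `1 ∓ ∂` are isomorphisms. -/
theorem isInvertible_firstOrderL_zero {κ : ℝ} (hκ : κ ^ 2 = 1) :
    (firstOrderL hs κ 0).IsInvertible := by
  have := Hs.completeSpace (s := s) (by linarith)
  have := Hs.completeSpace (half_lt_sub_one hs)
  have hinj : LinearMap.ker (firstOrderL hs κ 0 : Hs s →ₗ[ℝ] Hs (s - 1)) = ⊥ := by
    rw [LinearMap.ker_eq_bot']
    intro f hf
    refine Hs.ext_coeff fun n => ?_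
    have h1 : coeff (firstOrderL hs κ 0 f) n = coeff (0 : Hs (s - 1)) n :=
      congrArg (fun g : Hs (s - 1) => coeff g n) hf
    have h0 : ∀ r : ℝ, coeff (0 : Hs r) n = 0 := fun r => by
      have := Hs.coeff_smul' 0 (0 : Hs r) n
      simpa using this
    rw [coeff_firstOrderL_zero, h0] at h1
    rw [h0]
    exact (mul_eq_zero.mp h1).resolve_left (symbol_ne_zero hκ n)
  have hsurj : LinearMap.range (firstOrderL hs κ 0 : Hs s →ₗ[ℝ] Hs (s - 1)) = ⊤ := by
    rw [LinearMap.range_eq_top]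
    intro g
    let c : ℤ → ℂ := fun n => (1 - κ * (Complex.I * n))⁻¹ * coeff g n
    have hc : sobSq s c ≠ ⊤ := by
      refine ne_top_of_le_ne_top g.sobSq_ne_top (ENNReal.tsum_le_tsum fun n => ?_)
      refine pow_le_pow_left₀ zero_le (le_of_eq ?_) 2
      have hw : weight s n = weight (s - 1) n * weight 1 n := by
        rw [← weight_add, sub_add_cancel]
      have hw1 := weight_pos 1 n
      rw [← ofReal_norm, ← ofReal_norm, ← ENNReal.ofReal_mul (weight_pos _ _).le,
        ← ENNReal.ofReal_mul (weight_pos _ _).le, norm_mul, norm_inv, norm_symbol hκ, hw]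
      congr 1
      field_simp
    refine ⟨Hs.mk (by linarith) c (fun n => ?_) hc, Hs.ext_coeff fun n => ?_⟩
    · simp only [c]
      rw [coeff_neg, map_mul, map_inv₀]
      congr 2
      simp
    · refine (coeff_firstOrderL_zero hs κ _ n).trans ?_
      rw [Hs.coeff_mk, mul_inv_cancel_left₀ (symbol_ne_zero hκ n)]
  exact ⟨ContinuousLinearEquiv.ofBijective _ hinj hsurj,
    ContinuousLinearEquiv.coe_ofBijective _ _ _⟩

/-- The density of `exists_chSpray_eq` as an element of `H^{s-1}`, for `η = id + f` and the velocity
`v`. -/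
def densityHs (p : Hs s × Hs s) : Hs (s - 1) :=
  let J : Hs s →L[ℝ] Hs (s - 1) := Hs.inclL (sub_le_self s zero_le_one)
  mulSlope hs p.1 (Hs.mulL (half_lt_sub_one hs) (J p.2) (J p.2)) +
    (1 / 2 : ℝ) • Ring.inverse (mulSlope hs p.1)
      (Hs.mulL (half_lt_sub_one hs) (Hs.derivL hs p.2) (Hs.derivL hs p.2))

/-- The spray at `(id + f, v)` as an element of `H^s`. It has the junk value `0` in place of an
inverse that does not exist, which is excluded on the set `admissible`. -/
def sprayHs (p : Hs s × Hs s) : Hs s :=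
  (1 / 2 : ℝ) • ((firstOrderL hs (-1) p.1).inverse (densityHs hs p) -
    (firstOrderL hs 1 p.1).inverse (densityHs hs p))

/-- The pairs `(f, v)` for which `id + f` is a diffeomorphism near the identity and the operators in
the definition of the spray are invertible. -/
def admissible : Set (Hs s × Hs s) :=
  {p | ‖Hs.toContL (half_lt_sub_one hs) (Hs.derivL hs p.1)‖ < 1 / 2 ∧ IsUnit (mulSlope hs p.1) ∧
    (firstOrderL hs 1 p.1).IsInvertible ∧ (firstOrderL hs (-1) p.1).IsInvertible}

theorem isOpen_admissible : IsOpen (admissible hs) := by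
  have := Hs.completeSpace (s := s) (by linarith)
  have := Hs.completeSpace (half_lt_sub_one hs)
  have hinv : ∀ κ : ℝ, IsOpen {p : Hs s × Hs s | (firstOrderL hs κ p.1).IsInvertible} := fun κ =>
    ContinuousLinearEquiv.isOpen.preimage
      ((contDiff_firstOrderL hs κ (n := 0)).continuous.comp continuous_fst)
  refine IsOpen.inter ?_ (IsOpen.inter ?_ (IsOpen.inter (hinv 1) (hinv (-1))))
  · exact isOpen_lt (((Hs.toContL (half_lt_sub_one hs)).continuous.comp
      ((Hs.derivL hs).continuous.comp continuous_fst)).norm) continuous_const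
  · exact Units.isOpen.preimage ((contDiff_mulSlope hs (n := 0)).continuous.comp continuous_fst)

theorem zero_mem_admissible (v : Hs s) : ((0, v) : Hs s × Hs s) ∈ admissible hs := by
  refine ⟨?_, ?_, isInvertible_firstOrderL_zero hs (by norm_num),
    isInvertible_firstOrderL_zero hs (by norm_num)⟩
  · simp
  · simp only [mulSlope_zero]
    exact isUnit_one

theorem contDiffOn_sprayHs : ContDiffOn ℝ ∞ (sprayHs hs) (admissible hs) := by
  have := Hs.completeSpace (s := s) (by linarith)
  have := Hs.completeSpace (half_lt_sub_one hs)
  rintro p ⟨-, hu, h1, h2⟩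
  refine ContDiffAt.contDiffWithinAt ?_
  have hinv : ∀ κ : ℝ, (firstOrderL hs κ p.1).IsInvertible →
      ContDiffAt ℝ ∞ (fun q : Hs s × Hs s => (firstOrderL hs κ q.1).inverse) p := by
    rintro κ ⟨e, he⟩
    have h3 : ContDiffAt ℝ ∞ ContinuousLinearMap.inverse (firstOrderL hs κ p.1) := by
      rw [← he]
      exact contDiffAt_map_inverse e
    exact h3.comp p ((contDiff_firstOrderL hs κ).comp contDiff_fst).contDiffAt
  have hring : ContDiffAt ℝ ∞ (fun q : Hs s × Hs s => Ring.inverse (mulSlope hs q.1)) p := by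
    obtain ⟨x, hx⟩ := hu
    have h3 : ContDiffAt ℝ ∞ Ring.inverse (mulSlope hs p.1) := by
      rw [← hx]
      exact contDiffAt_ringInverse ℝ x
    exact h3.comp p ((contDiff_mulSlope hs).comp contDiff_fst).contDiffAt
  have hsl : ContDiffAt ℝ ∞ (fun q : Hs s × Hs s => mulSlope hs q.1) p :=
    ((contDiff_mulSlope hs).comp contDiff_fst).contDiffAt
  have hsq : ∀ L : Hs s →L[ℝ] Hs (s - 1), ContDiffAt ℝ ∞ (fun q : Hs s × Hs s =>
      Hs.mulL (half_lt_sub_one hs) (L q.2) (L q.2)) p := fun L => by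
    have hL : ContDiff ℝ ∞ fun q : Hs s × Hs s => L q.2 := L.contDiff.comp contDiff_snd
    exact (((Hs.mulL (half_lt_sub_one hs)).contDiff.comp hL).clm_apply hL).contDiffAt
  have hb : ContDiffAt ℝ ∞ (densityHs hs) p :=
    (hsl.clm_apply (hsq _)).add ((hring.clm_apply (hsq _)).const_smul _)
  exact ((hinv (-1) h2).clm_apply hb |>.sub ((hinv 1 h1).clm_apply hb)).const_smul _

theorem densityHs_apply {p : Hs s × Hs s} (hp : p ∈ admissible hs) (x : S1) :
    densityHs hs p x = density (1 + Hs.derivL hs p.1 x) (p.2 x) (Hs.derivL hs p.2 x) := by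
  set g := Hs.mulL (half_lt_sub_one hs) (Hs.derivL hs p.2) (Hs.derivL hs p.2) with hg
  set k := Ring.inverse (mulSlope hs p.1) g with hk
  have h1 : mulSlope hs p.1 k = g := by
    have := congrArg (fun L => L g) (Ring.mul_inverse_cancel _ hp.2.1)
    exact this
  have h2 : (1 + Hs.derivL hs p.1 x) * k x = Hs.derivL hs p.2 x * Hs.derivL hs p.2 x := by
    rw [← mulSlope_apply, h1, hg, Hs.toCont_mulL]
    rfl
  have hne : 1 + Hs.derivL hs p.1 x ≠ 0 := by
    have h3 := (Hs.toContL (half_lt_sub_one hs) (Hs.derivL hs p.1)).norm_coe_le_norm x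
    have h4 := abs_lt.mp (lt_of_le_of_lt h3 hp.1)
    rw [Hs.toContL_apply] at h4
    linarith [h4.1]
  have h3 : densityHs hs p x = (1 + Hs.derivL hs p.1 x) * (p.2 x * p.2 x) + 1 / 2 * k x := by
    have h4 : (densityHs hs p).toCont = (mulSlope hs p.1 (Hs.mulL (half_lt_sub_one hs)
      (Hs.inclL (sub_le_self s zero_le_one) p.2) (Hs.inclL (sub_le_self s zero_le_one) p.2))).toCont
      + (1 / 2 : ℝ) • k.toCont := rfl
    rw [h4, ContinuousMap.add_apply, mulSlope_apply, Hs.toCont_mulL, Hs.toCont_inclL]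
    rfl
  have h5 : k x = Hs.derivL hs p.2 x * Hs.derivL hs p.2 x / (1 + Hs.derivL hs p.1 x) := by
    rw [eq_div_iff hne, ← h2]
    ring
  rw [h3, h5, density]
  field_simp

/-- Uniqueness of differentiable solutions of `a q - κ q' = b`. -/
theorem HasCircleDeriv.eq_of_firstOrder {q q' p p' a b : S1 → ℝ} (h : HasCircleDeriv q q')
    (h' : HasCircleDeriv p p') {κ α : ℝ} (hα : 0 < α) (ha : ∀ x, α ≤ |a x|)
    (hq : ∀ x, a x * q x - κ * q' x = b x) (hp : ∀ x, a x * p x - κ * p' x = b x) (x : S1) :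
    q x = p x := by
  have h1 : HasCircleDeriv (fun x => q x - p x) fun x => q' x - p' x := fun x =>
    (h x).fun_sub (h' x)
  have h2 := h1.abs_le (b := fun _ => 0) (β := 0) hα ha (by simp)
    (fun x => by linear_combination hq x - hp x) x
  rw [zero_div] at h2
  exact sub_eq_zero.mp (abs_nonpos_iff.mp h2)

/-- The vector field `sprayHs` is the Camassa-Holm spray: by the maximum principle, the solutions of
the first-order equations in `H^s` are the functions of `exists_chSpray_eq`. -/
theorem sprayHs_apply {p : Hs s × Hs s} (hp : p ∈ admissible hs) {η : Ds s}
    (hη : ∀ x, η x = x + ((p.1 x : ℝ) : S1)) (x : S1) :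
    sprayHs hs p x = chSpray η p.2 x := by
  have hη' : ∀ x, η x = (1 : ℤ) • x + ((p.1 x : ℝ) : S1) := fun x => by rw [one_smul, hη]
  obtain ⟨q₁, q₂, h₁, h₂, heq⟩ := exists_chSpray_eq hs η p.2 hη' (a := fun x =>
    1 + Hs.derivL hs p.1 x) (b := densityHs hs p) (fun x => by simp)
    (densityHs_apply hs hp)
  have hne : ∀ x, 1 / 2 ≤ |1 + Hs.derivL hs p.1 x| := fun x => by
    have h3 := (Hs.toContL (half_lt_sub_one hs) (Hs.derivL hs p.1)).norm_coe_le_norm x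
    have h4 := abs_lt.mp (lt_of_le_of_lt h3 hp.1)
    rw [Hs.toContL_apply] at h4
    rw [le_abs]
    left
    linarith [h4.1]
  have key : ∀ κ : ℝ, (firstOrderL hs κ p.1).IsInvertible → ∀ x,
      (1 + Hs.derivL hs p.1 x) * (firstOrderL hs κ p.1).inverse (densityHs hs p) x -
        κ * Hs.derivL hs ((firstOrderL hs κ p.1).inverse (densityHs hs p)) x =
      densityHs hs p x := by
    rintro κ ⟨e, he⟩ x
    rw [← firstOrderL_apply, ← he, ContinuousLinearMap.inverse_equiv]
    simp
  have e₁ := (Hs.hasCircleDeriv hs _).eq_of_firstOrder h₁ (by norm_num) hne (key 1 hp.2.2.1)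
    (fun x => by ring) x
  have e₂ := (Hs.hasCircleDeriv hs _).eq_of_firstOrder h₂ (by norm_num) hne (key (-1) hp.2.2.2)
    (fun x => by ring) x
  have h5 : sprayHs hs p x = 1 / 2 * ((firstOrderL hs (-1) p.1).inverse (densityHs hs p) x -
      (firstOrderL hs 1 p.1).inverse (densityHs hs p) x) := rfl
  rw [h5, e₁, e₂, heq]
  ring

/-- The reciprocal of `1 + f'` is of class `H^{s-1}`. -/
theorem exists_inv_slope {p : Hs s × Hs s} (hp : p ∈ admissible hs) :
    ∃ z : Hs (s - 1), ∀ x, (1 + Hs.derivL hs p.1 x) * z x = 1 := by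
  refine ⟨Ring.inverse (mulSlope hs p.1) (Hs.one (s - 1)), fun x => ?_⟩
  have h1 : mulSlope hs p.1 (Ring.inverse (mulSlope hs p.1) (Hs.one (s - 1))) = Hs.one (s - 1) :=
    congrArg (fun L => L (Hs.one (s - 1))) (Ring.mul_inverse_cancel _ hp.2.1)
  rw [← mulSlope_apply, h1, Hs.toCont_one]
  rfl

theorem exists_diffeo {p : Hs s × Hs s} (hp : p ∈ admissible hs) :
    ∃ η : Ds s, ∀ x, η x = x + ((p.1 x : ℝ) : S1) := by
  obtain ⟨z, hz⟩ := exists_inv_slope hs hp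
  refine Ds.exists_eq_add hs p.1 (fun x => ?_) z hz
  exact ((Hs.toContL (half_lt_sub_one hs) (Hs.derivL hs p.1)).norm_coe_le_norm x).trans hp.1.le

end VectorField

/-! ### Lipschitz estimates for the spray in `C¹` -/

/-- Lipschitz dependence, in the sup norm, of the solution of `a q - κ q' = b` on `a` and `b`. -/
theorem abs_sub_le_of_firstOrder {q q' p p' a b a' b' : S1 → ℝ} (h : HasCircleDeriv q q')
    (h' : HasCircleDeriv p p') {κ α β γ B : ℝ} (hα : 0 < α) (ha : ∀ x, α ≤ |a x|)
    (ha' : ∀ x, α ≤ |a' x|) (hq : ∀ x, a x * q x - κ * q' x = b x)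
    (hp : ∀ x, a' x * p x - κ * p' x = b' x) (hB : ∀ x, |b' x| ≤ B)
    (hβ : ∀ x, |b x - b' x| ≤ β) (hγ : ∀ x, |a x - a' x| ≤ γ) (x : S1) :
    |q x - p x| ≤ (β + γ * (B / α)) / α := by
  have h1 : HasCircleDeriv (fun x => q x - p x) fun x => q' x - p' x := fun x =>
    (h x).fun_sub (h' x)
  refine h1.abs_le (κ := κ) (b := fun x => b x - b' x - (a x - a' x) * p x) hα ha (fun x => ?_)
    (fun x => by linear_combination hq x - hp x) x
  refine (abs_sub _ _).trans (add_le_add (hβ x) ?_)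
  rw [abs_mul]
  exact mul_le_mul (hγ x) (h'.abs_le hα ha' hB hp x) (abs_nonneg _) ((abs_nonneg _).trans (hγ x))

theorem density_eq {a : ℝ} (ha : a ≠ 0) (v v₁ : ℝ) :
    density a v v₁ = a * v ^ 2 + 1 / 2 * (v₁ ^ 2 / a) := by
  rw [density]
  field_simp

theorem abs_density_le {α M a v v₁ : ℝ} (hα : 0 < α) (ha : α ≤ |a|) (haM : |a| ≤ M)
    (hv : |v| ≤ M) (hv₁ : |v₁| ≤ M) : |density a v v₁| ≤ M ^ 3 + M ^ 2 / α := by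
  have hM : 0 ≤ M := (abs_nonneg _).trans hv
  rw [density_eq (abs_pos.mp (hα.trans_le ha))]
  refine (abs_add_le _ _).trans (add_le_add ?_ ?_)
  · rw [abs_mul, abs_pow]
    calc |a| * |v| ^ 2 ≤ M * M ^ 2 := by gcongr
      _ = M ^ 3 := by ring
  · rw [abs_mul, abs_of_pos (by norm_num : (0 : ℝ) < 1 / 2), abs_div, abs_pow]
    calc 1 / 2 * (|v₁| ^ 2 / |a|) ≤ 1 * (M ^ 2 / α) := by
          gcongr
          norm_num
      _ = _ := one_mul _

theorem abs_density_sub_le {α M N a v v₁ a' v' v₁' : ℝ} (hα : 0 < α) (ha : α ≤ |a|)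
    (ha' : α ≤ |a'|) (haM' : |a'| ≤ M) (hv : |v| ≤ M) (hv' : |v'| ≤ M)
    (hv₁ : |v₁| ≤ M) (hv₁' : |v₁'| ≤ M) (hda : |a - a'| ≤ N) (hdv : |v - v'| ≤ N)
    (hdv₁ : |v₁ - v₁'| ≤ N) :
    |density a v v₁ - density a' v' v₁'| ≤ (3 * M ^ 2 + M / α + M ^ 2 / (α * α)) * N := by
  have hM : 0 ≤ M := (abs_nonneg _).trans hv
  have hN : 0 ≤ N := (abs_nonneg _).trans hda
  have hane : a ≠ 0 := abs_pos.mp (hα.trans_le ha)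
  have hane' : a' ≠ 0 := abs_pos.mp (hα.trans_le ha')
  have e : density a v v₁ - density a' v' v₁' =
      (a - a') * v ^ 2 + a' * ((v - v') * (v + v')) + 1 / 2 * ((v₁ - v₁') * (v₁ + v₁') / a) +
        1 / 2 * (v₁' ^ 2 * (a' - a) / (a * a')) := by
    rw [density_eq hane, density_eq hane']
    field_simp
    ring
  have hs : |v + v'| ≤ 2 * M := (abs_add_le _ _).trans (by linarith)
  have hs₁ : |v₁ + v₁'| ≤ 2 * M := (abs_add_le _ _).trans (by linarith)
  have t1 : |(a - a') * v ^ 2| ≤ M ^ 2 * N := by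
    rw [abs_mul, abs_pow, mul_comm]
    gcongr
  have t2 : |a' * ((v - v') * (v + v'))| ≤ 2 * M ^ 2 * N := by
    rw [abs_mul, abs_mul]
    calc |a'| * (|v - v'| * |v + v'|) ≤ M * (N * (2 * M)) := by gcongr
      _ = _ := by ring
  have t3 : |1 / 2 * ((v₁ - v₁') * (v₁ + v₁') / a)| ≤ M / α * N := by
    rw [abs_mul, abs_of_pos (by norm_num : (0 : ℝ) < 1 / 2), abs_div, abs_mul]
    calc 1 / 2 * (|v₁ - v₁'| * |v₁ + v₁'| / |a|) ≤ 1 / 2 * (N * (2 * M) / α) := by gcongr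
      _ = _ := by ring
  have t4 : |1 / 2 * (v₁' ^ 2 * (a' - a) / (a * a'))| ≤ M ^ 2 / (α * α) * N := by
    rw [abs_mul, abs_of_pos (by norm_num : (0 : ℝ) < 1 / 2), abs_div, abs_mul, abs_mul, abs_pow,
      abs_sub_comm a' a]
    calc 1 / 2 * (|v₁'| ^ 2 * |a - a'| / (|a| * |a'|)) ≤ 1 * (M ^ 2 * N / (α * α)) := by
          gcongr
          norm_num
      _ = _ := by ring
  rw [e]
  calc _ ≤ M ^ 2 * N + 2 * M ^ 2 * N + M / α * N + M ^ 2 / (α * α) * N :=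
        (abs_add_le _ _).trans (add_le_add ((abs_add_le _ _).trans (add_le_add
          ((abs_add_le _ _).trans (add_le_add t1 t2)) t3)) t4)
    _ = _ := by ring

section Lipschitz

variable {s : ℝ} (hs : 3 / 2 < s)

/-- The spray and its derivative are Lipschitz functions of the derivative of `η`, of `v` and of the
derivative of `v`, in the sup norm, as long as these are bounded by `M` and the derivative of `η` is
bounded below by `α`. -/
theorem exists_spray_lipschitz {α M : ℝ} (hα : 0 < α) :
    ∃ K : ℝ, 0 ≤ K ∧ ∀ (η η' : Ds s) (d : ℤ) (f f' v v' A A' : Hs s) (N : ℝ),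
      (∀ x, η x = d • x + ((f x : ℝ) : S1)) → (∀ x, η' x = d • x + ((f' x : ℝ) : S1)) →
      (∀ x, A x = chSpray η v x) → (∀ x, A' x = chSpray η' v' x) →
      (∀ x, α ≤ |d + Hs.derivL hs f x| ∧ |d + Hs.derivL hs f x| ≤ M) →
      (∀ x, α ≤ |d + Hs.derivL hs f' x| ∧ |d + Hs.derivL hs f' x| ≤ M) →
      (∀ x, |v x| ≤ M ∧ |Hs.derivL hs v x| ≤ M) →
      (∀ x, |v' x| ≤ M ∧ |Hs.derivL hs v' x| ≤ M) →
      (∀ x, |Hs.derivL hs f x - Hs.derivL hs f' x| ≤ N) →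
      (∀ x, |v x - v' x| ≤ N ∧ |Hs.derivL hs v x - Hs.derivL hs v' x| ≤ N) →
      ∀ x, |A x - A' x| ≤ K * N ∧ |Hs.derivL hs A x - Hs.derivL hs A' x| ≤ K * N := by
  -- a negative bound `M` is contradictory
  wlog hM : 0 ≤ M
  · refine ⟨0, le_rfl, fun η η' d f f' v v' A A' N _ _ _ _ _ _ hv _ _ _ x => ?_⟩
    exact absurd ((abs_nonneg _).trans (hv x).1) hM
  set L := 3 * M ^ 2 + M / α + M ^ 2 / (α * α) with hL
  set B := M ^ 3 + M ^ 2 / α with hB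
  set K₁ := (L + B / α) / α with hK₁
  have hL0 : 0 ≤ L := by positivity
  have hB0 : 0 ≤ B := by positivity
  have hK₁0 : 0 ≤ K₁ := by positivity
  have hBα : 0 ≤ B / α := by positivity
  refine ⟨L + M * K₁ + B / α + K₁, by positivity,
    fun η η' d f f' v v' A A' N hη hη' hA hA' hf hf' hv hv' hdf hdv => ?_⟩
  set a : S1 → ℝ := fun x => d + Hs.derivL hs f x with ha
  set a' : S1 → ℝ := fun x => d + Hs.derivL hs f' x with ha'
  set b : S1 → ℝ := fun x => density (a x) (v x) (Hs.derivL hs v x) with hb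
  set b' : S1 → ℝ := fun x => density (a' x) (v' x) (Hs.derivL hs v' x) with hb'
  obtain ⟨q₁, q₂, h₁, h₂, hq⟩ := exists_chSpray_eq hs η v hη (a := a) (b := b)
    (fun _ => rfl) (fun _ => rfl)
  obtain ⟨p₁, p₂, k₁, k₂, hp⟩ := exists_chSpray_eq hs η' v' hη' (a := a') (b := b')
    (fun _ => rfl) (fun _ => rfl)
  have hda : ∀ x, |a x - a' x| ≤ N := fun x => by
    rw [ha, ha', add_sub_add_left_eq_sub]
    exact hdf x
  have hN : 0 ≤ N := (abs_nonneg _).trans (hda 0)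
  have hdb : ∀ x, |b x - b' x| ≤ L * N := fun x =>
    abs_density_sub_le hα (hf x).1 (hf' x).1 (hf' x).2 (hv x).1 (hv' x).1 (hv x).2 (hv' x).2
      (hda x) (hdv x).1 (hdv x).2
  have hbB : ∀ x, |b' x| ≤ B := fun x =>
    abs_density_le hα (hf' x).1 (hf' x).2 (hv' x).1 (hv' x).2
  have e1 : (L * N + N * (B / α)) / α = K₁ * N := by rw [hK₁]; ring
  have d₁ : ∀ x, |q₁ x - p₁ x| ≤ K₁ * N := fun x => by
    rw [← e1]
    exact abs_sub_le_of_firstOrder h₁ k₁ (κ := 1) hα (fun x => (hf x).1) (fun x => (hf' x).1)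
      (fun x => by ring) (fun x => by ring) hbB hdb hda x
  have d₂ : ∀ x, |q₂ x - p₂ x| ≤ K₁ * N := fun x => by
    rw [← e1]
    exact abs_sub_le_of_firstOrder h₂ k₂ (κ := -1) hα (fun x => (hf x).1) (fun x => (hf' x).1)
      (fun x => by ring) (fun x => by ring) hbB hdb hda x
  have m₁ : ∀ x, |p₁ x| ≤ B / α := fun x =>
    k₁.abs_le (κ := 1) hα (fun x => (hf' x).1) hbB (fun x => by ring) x
  have m₂ : ∀ x, |p₂ x| ≤ B / α := fun x =>
    k₂.abs_le (κ := -1) hα (fun x => (hf' x).1) hbB (fun x => by ring) x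
  -- the derivatives of `q₁` and `q₂` in `(q₂ - q₁) / 2` are replaced by means of their equations
  have hder : ∀ {C : Hs s} {r₁ r₂ c e : S1 → ℝ}, HasCircleDeriv r₁ (fun x => c x * r₁ x - e x) →
      HasCircleDeriv r₂ (fun x => e x - c x * r₂ x) → (∀ x, C x = (r₂ x - r₁ x) / 2) →
      ∀ x, Hs.derivL hs C x = e x - c x * (r₁ x + r₂ x) / 2 := by
    intro C r₁ r₂ c e g₁ g₂ hC x
    induction x using QuotientAddGroup.induction_on with
    | H y =>
      have h3 := ((g₂ y).fun_sub (g₁ y)).div_const 2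
      have h4 := C.hasCircleDeriv hs y
      simp only [hC] at h4
      rw [h4.unique h3]
      change _ = e (y : S1) - c (y : S1) * (r₁ (y : S1) + r₂ (y : S1)) / 2
      ring
  intro x
  have hK : K₁ * N ≤ (L + M * K₁ + B / α + K₁) * N := by
    gcongr
    have : 0 ≤ M * K₁ := by positivity
    linarith
  constructor
  · rw [hA, hA', hq, hp]
    refine le_trans ?_ hK
    have e2 : (q₂ x - q₁ x) / 2 - (p₂ x - p₁ x) / 2 = ((q₂ x - p₂ x) - (q₁ x - p₁ x)) / 2 := by ring
    rw [e2, abs_div, abs_two]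
    have := abs_sub (q₂ x - p₂ x) (q₁ x - p₁ x)
    linarith [d₁ x, d₂ x]
  · rw [hder h₁ h₂ (fun x => (hA x).trans (hq x)) x, hder k₁ k₂ (fun x => (hA' x).trans (hp x)) x]
    have e2 : b x - a x * (q₁ x + q₂ x) / 2 - (b' x - a' x * (p₁ x + p₂ x) / 2) =
        (b x - b' x) - (a x * ((q₁ x - p₁ x) + (q₂ x - p₂ x)) / 2 +
          (a x - a' x) * (p₁ x + p₂ x) / 2) := by ring
    have s1 : |a x * ((q₁ x - p₁ x) + (q₂ x - p₂ x)) / 2| ≤ M * (K₁ * N) := by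
      rw [abs_div, abs_mul, abs_two]
      have h5 : |(q₁ x - p₁ x) + (q₂ x - p₂ x)| ≤ 2 * (K₁ * N) :=
        (abs_add_le _ _).trans (by linarith [d₁ x, d₂ x])
      calc |a x| * |(q₁ x - p₁ x) + (q₂ x - p₂ x)| / 2 ≤ M * (2 * (K₁ * N)) / 2 := by
            gcongr
            exact (hf x).2
        _ = _ := by ring
    have s2 : |(a x - a' x) * (p₁ x + p₂ x) / 2| ≤ N * (B / α) := by
      rw [abs_div, abs_mul, abs_two]
      have h5 : |p₁ x + p₂ x| ≤ 2 * (B / α) := (abs_add_le _ _).trans (by linarith [m₁ x, m₂ x])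
      calc |a x - a' x| * |p₁ x + p₂ x| / 2 ≤ N * (2 * (B / α)) / 2 := by
            gcongr
            exact hda x
        _ = _ := by ring
    rw [e2]
    refine (abs_sub _ _).trans ((add_le_add (hdb x) ((abs_add_le _ _).trans
      (add_le_add s1 s2))).trans ?_)
    have : 0 ≤ K₁ * N := by positivity
    linarith

end Lipschitz

/-! ### Uniqueness -/

theorem eq_zero_of_norm_deriv_le_of_le {E : Type*} [NormedAddCommGroup E] [NormedSpace ℝ E]
    {f f' : ℝ → E} {I : Set ℝ} (hI : I.OrdConnected) {t₀ ε K : ℝ} (ht₀ : t₀ ∈ I)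
    (hd : ∀ τ ∈ I, |τ - t₀| < ε → HasDerivWithinAt f (f' τ) I τ ∧ ‖f' τ‖ ≤ K * ‖f τ‖)
    (h0 : f t₀ = 0) {τ : ℝ} (hτ : τ ∈ I) (hτε : |τ - t₀| < ε) (hle : t₀ ≤ τ) : f τ = 0 := by
  have hsub : Icc t₀ τ ⊆ I := hI.out ht₀ hτ
  have hε : ∀ x ∈ Icc t₀ τ, |x - t₀| < ε := fun x hx => by
    rw [abs_of_nonneg (sub_nonneg.mpr hx.1)]
    rw [abs_of_nonneg (sub_nonneg.mpr hle)] at hτε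
    linarith [hx.2]
  refine eq_zero_of_abs_deriv_le_mul_abs_self_of_eq_zero_right (f' := f') (K := K)
    (fun x hx => ((hd x (hsub hx) (hε x hx)).1.mono hsub).continuousWithinAt)
    (fun x hx => ?_) h0 (fun x hx => (hd x (hsub ⟨hx.1, hx.2.le⟩) (hε x ⟨hx.1, hx.2.le⟩)).2) τ
    ⟨hle, le_rfl⟩
  have h1 := (hd x (hsub ⟨hx.1, hx.2.le⟩) (hε x ⟨hx.1, hx.2.le⟩)).1
  refine h1.mono_of_mem_nhdsWithin (mem_of_superset (Icc_mem_nhdsGE hx.2) ?_)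
  exact fun y hy => hsub ⟨hx.1.trans hy.1, hy.2⟩

/-- Grönwall's inequality for a function that vanishes at `t₀`, on both sides of `t₀`. -/
theorem eq_zero_of_norm_deriv_le {E : Type*} [NormedAddCommGroup E] [NormedSpace ℝ E]
    {f f' : ℝ → E} {I : Set ℝ} (hI : I.OrdConnected) {t₀ ε K : ℝ} (ht₀ : t₀ ∈ I)
    (hd : ∀ τ ∈ I, |τ - t₀| < ε → HasDerivWithinAt f (f' τ) I τ ∧ ‖f' τ‖ ≤ K * ‖f τ‖)
    (h0 : f t₀ = 0) {τ : ℝ} (hτ : τ ∈ I) (hτε : |τ - t₀| < ε) : f τ = 0 := by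
  rcases le_total t₀ τ with hle | hle
  · exact eq_zero_of_norm_deriv_le_of_le hI ht₀ hd h0 hτ hτε hle
  · have hI' : (Neg.neg ⁻¹' I).OrdConnected := ⟨fun x hx y hy z hz =>
      hI.out hy hx ⟨neg_le_neg hz.2, neg_le_neg hz.1⟩⟩
    have habs : ∀ x : ℝ, |(-x) - t₀| = |x - -t₀| := fun x => by
      rw [← abs_neg]
      ring_nf
    have h1 := eq_zero_of_norm_deriv_le_of_le (f := fun x => f (-x)) (f' := fun x => -f' (-x))
      (K := K) (ε := ε) (t₀ := -t₀) (τ := -τ) hI' (by simpa using ht₀) (fun x hx hxε => by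
        obtain ⟨h2, h3⟩ := hd (-x) hx (by rwa [habs])
        refine ⟨?_, by rwa [norm_neg]⟩
        have h4 := h2.scomp x (hasDerivAt_neg x).hasDerivWithinAt (s := Neg.neg ⁻¹' I)
          (fun y hy => hy)
        rwa [neg_one_smul] at h4) (by simpa using h0) (by simpa using hτ)
        (by rw [← habs, neg_neg]; exact hτε) (neg_le_neg hle)
    simpa using h1

variable {s : ℝ}

theorem one_half_lt (hs : 3 / 2 < s) : 1 / 2 < s := by linarith

/-- The embedding `f ↦ (f, f')` of `H^s` into `C(S¹) × C(S¹)`, that is, of `H^s` into `C¹`. -/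
def c1L (hs : 3 / 2 < s) : Hs s →L[ℝ] C(S1, ℝ) × C(S1, ℝ) :=
  (Hs.toContL (one_half_lt hs)).prod (Hs.toContL (half_lt_sub_one hs) ∘L Hs.derivL hs)

theorem abs_le_norm_c1L (hs : 3 / 2 < s) (f : Hs s) (x : S1) :
    |f x| ≤ ‖c1L hs f‖ ∧ |Hs.derivL hs f x| ≤ ‖c1L hs f‖ :=
  ⟨((c1L hs f).1.norm_coe_le_norm x).trans (norm_fst_le _),
    ((c1L hs f).2.norm_coe_le_norm x).trans (norm_snd_le _)⟩

theorem norm_c1L_le (hs : 3 / 2 < s) {f : Hs s} {C : ℝ} (hC : 0 ≤ C)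
    (h : ∀ x, |f x| ≤ C ∧ |Hs.derivL hs f x| ≤ C) : ‖c1L hs f‖ ≤ C :=
  norm_prod_le_iff.mpr ⟨(ContinuousMap.norm_le _ hC).mpr fun x => (h x).1,
    (ContinuousMap.norm_le _ hC).mpr fun x => (h x).2⟩

theorem c1L_injective (hs : 3 / 2 < s) : Function.Injective (c1L hs) := fun _ _ h =>
  Hs.ext_toCont (congrArg Prod.fst h)

/-- The chart around one point of a curve in `𝒟^s` represents the velocity at nearby times too:
the transition maps between the charts are translations. -/
theorem Ds.exists_chart (hs : 3 / 2 < s) {I : Set ℝ} {η : ℝ → Ds s} {v : ℝ → Hs s}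
    (hv : ∀ t ∈ I, Ds.HasVelocityWithinAt η (v t) I t) {t₀ : ℝ} (ht₀ : t₀ ∈ I) :
    ∃ g : ℝ → Hs s, ∃ ε > 0, g t₀ = 0 ∧ ∀ τ ∈ I, |τ - t₀| < ε →
      (∀ x, η τ x = η t₀ x + ((g τ x : ℝ) : S1)) ∧ HasDerivWithinAt g (v τ) I τ := by
  have hsmall : ∀ {g : ℝ → Hs s} {w : Hs s} {t : ℝ}, g t = 0 → HasDerivWithinAt g w I t →
      ∀ᶠ τ in 𝓝[I] t, ∀ x, |g τ x| < 1 := by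
    intro g w t h0 hg
    have h1 : Tendsto (fun τ => ‖c1L hs (g τ)‖) (𝓝[I] t) (𝓝 ‖c1L hs (g t)‖) :=
      ((c1L hs).continuous.norm.tendsto _).comp hg.continuousWithinAt
    rw [h0, map_zero, norm_zero] at h1
    filter_upwards [h1.eventually (gt_mem_nhds zero_lt_one)] with τ hτ x
    exact (abs_le_norm_c1L hs (g τ) x).1.trans_lt hτ
  obtain ⟨g, hg0, hgη, hgd⟩ := hv t₀ ht₀
  obtain ⟨ε, hε, hball⟩ := Metric.eventually_nhds_iff.mp
    (eventually_nhdsWithin_iff.mp (hgη.and (hsmall hg0 hgd)))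
  refine ⟨g, ε, hε, hg0, fun τ hτ hτε => ⟨(hball hτε hτ).1, ?_⟩⟩
  obtain ⟨k, hk0, hkη, hkd⟩ := hv τ hτ
  have hnear : ∀ᶠ σ in 𝓝[I] τ, |σ - t₀| < ε :=
    nhdsWithin_le_nhds (((continuous_id.sub continuous_const).abs.tendsto τ).eventually
      (gt_mem_nhds hτε))
  -- both sides represent `η σ`; they are equal modulo `2π` and differ by less than `3`
  have heq : g =ᶠ[𝓝[I] τ] fun σ => g τ + k σ := by
    filter_upwards [hkη, hsmall hk0 hkd, hnear, self_mem_nhdsWithin] with σ h1 h2 h3 h4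
    refine Hs.ext_apply fun x => ?_
    have e1 : η t₀ x + ((g σ x : ℝ) : S1) = η t₀ x + ((g τ x : ℝ) : S1) + ((k σ x : ℝ) : S1) := by
      rw [← (hball h3 h4).1, ← (hball hτε hτ).1, h1]
    rw [add_assoc, add_right_inj] at e1
    have e2 : g σ x - (g τ x + k σ x) = 0 := by
      refine eq_zero_of_coe_eq_zero ?_ ?_
      · rw [AddCircle.coe_sub, AddCircle.coe_add, e1, sub_self]
      · have b1 := (hball h3 h4).2 x
        have b2 := (hball hτε hτ).2 x
        have b3 := h2 x
        have hπ := Real.pi_gt_three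
        rw [abs_lt] at *
        constructor <;> linarith [b1.1, b1.2, b2.1, b2.2, b3.1, b3.2]
    change g σ x = g τ x + k σ x
    linarith
  exact (hkd.const_add (g τ)).congr_of_eventuallyEq heq (by rw [hk0, add_zero])

/-- Two solutions that agree at one time agree at nearby times: near it both stay in a region
where the spray is Lipschitz in the `C¹` norm. -/
theorem IsSolution.eventually_eq (hs : 3 / 2 < s) {I : Set ℝ} (hI : I.OrdConnected) {u₀ : Hs s}
    {η η' : ℝ → Ds s} {v v' : ℝ → Hs s} (h : IsSolution s I u₀ η v)
    (h' : IsSolution s I u₀ η' v') {t₀ : ℝ} (ht₀ : t₀ ∈ I) (hη : η t₀ = η' t₀)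
    (hv : v t₀ = v' t₀) : ∀ᶠ τ in 𝓝[I] t₀, η τ = η' τ ∧ v τ = v' τ := by
  obtain ⟨g, ε₁, hε₁, hg0, hg⟩ := Ds.exists_chart hs h.velocity ht₀
  obtain ⟨g', ε₂, hε₂, hg0', hg'⟩ := Ds.exists_chart hs h'.velocity ht₀
  obtain ⟨a, -, ha⟩ := h.acceleration
  obtain ⟨a', -, ha'⟩ := h'.acceleration
  obtain ⟨d, f₀, hf₀⟩ := (η t₀).2.1
  have hslope : Continuous fun x => |(d : ℝ) + Hs.derivL hs f₀ x| :=
    (continuous_const.add (Hs.derivL hs f₀).toCont.continuous).abs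
  obtain ⟨x₀, -, hx₀⟩ := isCompact_univ.exists_isMinOn ⟨(0 : S1), mem_univ _⟩ hslope.continuousOn
  set α := |(d : ℝ) + Hs.derivL hs f₀ x₀| / 2 with hαdef
  have hα : 0 < α := half_pos (abs_pos.mpr ((η t₀).slope_ne_zero hs hf₀ x₀))
  have hmin : ∀ x, 2 * α ≤ |(d : ℝ) + Hs.derivL hs f₀ x| := fun x => by
    rw [hαdef, mul_div_cancel₀ _ two_ne_zero]
    exact hx₀ (mem_univ x)
  set M := |(d : ℝ)| + ‖c1L hs f₀‖ + α + (‖c1L hs (v t₀)‖ + 1) with hM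
  obtain ⟨K, -, hlip⟩ := exists_spray_lipschitz hs (M := M) hα
  have hcont : ∀ {u : ℝ → Hs s} {w : Hs s} {r : ℝ}, HasDerivWithinAt u w I t₀ →
      ‖c1L hs (u t₀)‖ < r → ∀ᶠ τ in 𝓝[I] t₀, ‖c1L hs (u τ)‖ < r := fun hu hr =>
    (((c1L hs).continuous.norm.tendsto _).comp hu.continuousWithinAt).eventually
      (gt_mem_nhds hr)
  have hgα := hcont (r := α) (hg t₀ ht₀ (by simpa using hε₁)).2 (by simpa [hg0] using hα)
  have hgα' := hcont (r := α) (hg' t₀ ht₀ (by simpa using hε₂)).2 (by simpa [hg0'] using hα)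
  have hvM := hcont (ha t₀ ht₀).1 (lt_add_one _)
  have hvM' := hcont (ha' t₀ ht₀).1 (lt_add_one _)
  rw [← hv] at hvM'
  obtain ⟨ε₃, hε₃, hball⟩ := Metric.eventually_nhds_iff.mp
    (eventually_nhdsWithin_iff.mp (hgα.and (hgα'.and (hvM.and hvM'))))
  have hfd : ∀ {k : Hs s}, ‖c1L hs k‖ < α → ∀ x, α ≤ |(d : ℝ) + Hs.derivL hs (f₀ + k) x| ∧
      |(d : ℝ) + Hs.derivL hs (f₀ + k) x| ≤ M := by
    intro k hk x
    have e : (d : ℝ) + Hs.derivL hs (f₀ + k) x = d + Hs.derivL hs f₀ x + Hs.derivL hs k x := by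
      rw [map_add, Hs.toCont_add, ContinuousMap.add_apply, add_assoc]
    have h1 := (abs_le_norm_c1L hs k x).2
    rw [e]
    constructor
    · have := abs_sub_abs_le_abs_add (d + Hs.derivL hs f₀ x) (Hs.derivL hs k x)
      linarith [hmin x]
    · have := abs_add_le (d + Hs.derivL hs f₀ x) (Hs.derivL hs k x)
      have := abs_add_le (d : ℝ) (Hs.derivL hs f₀ x)
      linarith [(abs_le_norm_c1L hs f₀ x).2, norm_nonneg (c1L hs (v t₀))]
  set ε := min ε₁ (min ε₂ ε₃) with hεdef
  have hε : 0 < ε := lt_min hε₁ (lt_min hε₂ hε₃)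
  -- the difference of the two solutions in `C¹`, to which Grönwall's inequality applies
  set Δ : ℝ → (C(S1, ℝ) × C(S1, ℝ)) × (C(S1, ℝ) × C(S1, ℝ)) :=
    fun τ => (c1L hs (g τ - g' τ), c1L hs (v τ - v' τ)) with hΔ
  have hzero : ∀ τ ∈ I, |τ - t₀| < ε → Δ τ = 0 := by
    intro τ hτ hτε
    refine eq_zero_of_norm_deriv_le (K := max 1 K) (ε := ε)
      (f' := fun τ => (c1L hs (v τ - v' τ), c1L hs (a τ - a' τ))) hI ht₀
      (fun σ hσ hσε => ?_) (by simp [hΔ, hg0, hg0', hv]) hτ hτε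
    obtain ⟨h1, h1'⟩ := hg σ hσ (hσε.trans_le (min_le_left _ _))
    obtain ⟨h2, h2'⟩ := hg' σ hσ (hσε.trans_le ((min_le_right _ _).trans (min_le_left _ _)))
    obtain ⟨b1, b2, b3, b4⟩ :=
      hball (hσε.trans_le ((min_le_right _ _).trans (min_le_right _ _))) hσ
    obtain ⟨h3, h3'⟩ := ha σ hσ
    obtain ⟨h4, h4'⟩ := ha' σ hσ
    have hη₁ : ∀ x, η σ x = d • x + (((f₀ + g σ) x : ℝ) : S1) := fun x => by
      rw [h1, hf₀, Hs.toCont_add, ContinuousMap.add_apply, AddCircle.coe_add, add_assoc]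
    have hη₂ : ∀ x, η' σ x = d • x + (((f₀ + g' σ) x : ℝ) : S1) := fun x => by
      rw [h2, ← hη, hf₀, Hs.toCont_add, ContinuousMap.add_apply, AddCircle.coe_add, add_assoc]
    have hsub : ∀ (p q : Hs s) x, |p x - q x| ≤ ‖c1L hs (p - q)‖ ∧
        |Hs.derivL hs p x - Hs.derivL hs q x| ≤ ‖c1L hs (p - q)‖ := fun p q x => by
      have := abs_le_norm_c1L hs (p - q) x
      rw [map_sub (Hs.derivL hs)] at this
      exact this
    have hvb : ∀ {w : Hs s}, ‖c1L hs w‖ < ‖c1L hs (v t₀)‖ + 1 →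
        ∀ x, |w x| ≤ M ∧ |Hs.derivL hs w x| ≤ M := fun {w} hw x => by
      have h5 := abs_le_norm_c1L hs w x
      have h6 := abs_nonneg (d : ℝ)
      have h7 := norm_nonneg (c1L hs f₀)
      exact ⟨by linarith [h5.1], by linarith [h5.2]⟩
    have hΔ₁ : ‖c1L hs (g σ - g' σ)‖ ≤ ‖Δ σ‖ := norm_fst_le (Δ σ)
    have hΔ₂ : ‖c1L hs (v σ - v' σ)‖ ≤ ‖Δ σ‖ := norm_snd_le (Δ σ)
    have hA := hlip (η σ) (η' σ) d (f₀ + g σ) (f₀ + g' σ) (v σ) (v' σ) (a σ) (a' σ) ‖Δ σ‖ hη₁ hη₂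
      h3' h4' (hfd b1) (hfd b2) (hvb b3) (hvb b4)
      (fun x => by
        refine (hsub _ _ x).2.trans ?_
        rwa [add_sub_add_left_eq_sub])
      (fun x => ⟨(hsub _ _ x).1.trans hΔ₂, (hsub _ _ x).2.trans hΔ₂⟩)
    constructor
    · exact ((c1L hs).hasFDerivAt.comp_hasDerivWithinAt σ (h1'.sub h2')).prodMk
        ((c1L hs).hasFDerivAt.comp_hasDerivWithinAt σ (h3.sub h4))
    · refine norm_prod_le_iff.mpr ⟨?_, ?_⟩
      · exact hΔ₂.trans (le_mul_of_one_le_left (norm_nonneg _) (le_max_left _ _))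
      · refine le_trans (norm_c1L_le hs ((abs_nonneg _).trans (hA 0).1) fun x => ?_)
          (mul_le_mul_of_nonneg_right (le_max_right _ _) (norm_nonneg _))
        rw [map_sub (Hs.derivL hs)]
        exact hA x
  rw [eventually_nhdsWithin_iff, Metric.eventually_nhds_iff]
  refine ⟨ε, hε, fun τ hτε hτ => ?_⟩
  have h0 := hzero τ hτ hτε
  have e1 : g τ = g' τ := sub_eq_zero.mp (c1L_injective hs
    ((congrArg Prod.fst h0).trans (map_zero (c1L hs)).symm))
  have e2 : v τ = v' τ := sub_eq_zero.mp (c1L_injective hs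
    ((congrArg Prod.snd h0).trans (map_zero (c1L hs)).symm))
  refine ⟨Subtype.ext (Equiv.ext fun x => ?_), e2⟩
  have h1 := (hg τ hτ (hτε.trans_le (min_le_left _ _))).1 x
  have h2 := (hg' τ hτ (hτε.trans_le ((min_le_right _ _).trans (min_le_left _ _)))).1 x
  rw [← hη, ← e1] at h2
  exact h1.trans h2.symm

theorem IsSolution.continuousOn_apply (hs : 3 / 2 < s) {I : Set ℝ} {u₀ : Hs s} {η : ℝ → Ds s}
    {v : ℝ → Hs s} (h : IsSolution s I u₀ η v) (x : S1) : ContinuousOn (fun t => η t x) I := by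
  intro t ht
  obtain ⟨g, hg0, hg, hgd⟩ := h.velocity t ht
  have h1 : Tendsto (fun τ => g τ x) (𝓝[I] t) (𝓝 (g t x)) :=
    (((ContinuousMap.evalCLM ℝ x ∘L Hs.toContL (one_half_lt hs)).continuous.tendsto _).comp
      hgd.continuousWithinAt)
  have h2 : Tendsto (fun τ => η t x + ((g τ x : ℝ) : S1)) (𝓝[I] t) (𝓝 (η t x)) := by
    have h3 := ((AddCircle.continuous_mk' (2 * Real.pi)).tendsto _).comp h1 |>.const_add (η t x)
    rw [hg0, Hs.zero_apply, QuotientAddGroup.mk'_apply, QuotientAddGroup.mk_zero, add_zero] at h3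
    exact h3
  exact h2.congr' (hg.mono fun τ hτ => (hτ x).symm)

theorem IsSolution.unique (hs : 3 / 2 < s) {I : Set ℝ} (hI : I.OrdConnected) (h0 : (0 : ℝ) ∈ I)
    {u₀ : Hs s} {η η' : ℝ → Ds s} {v v' : ℝ → Hs s} (h : IsSolution s I u₀ η v)
    (h' : IsSolution s I u₀ η' v') : ∀ t ∈ I, η t = η' t ∧ v t = v' t := by
  have hvc : ∀ {η v}, IsSolution s I u₀ η v → Continuous fun t : I => v t := fun k =>
    continuousOn_iff_continuous_domRestrict.mp fun t ht =>
      (k.acceleration.choose_spec.2 t ht).1.continuousWithinAt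
  have hηc : ∀ {η v}, IsSolution s I u₀ η v → ∀ x, Continuous fun t : I => η t x := fun k x =>
    continuousOn_iff_continuous_domRestrict.mp (k.continuousOn_apply hs x)
  have : PreconnectedSpace I := isPreconnected_iff_preconnectedSpace.mp hI.isPreconnected
  -- the set of times of agreement is open and closed in the interval `I`
  set A : Set I := {t | η t = η' t ∧ v t = v' t} with hA
  have hA' : A = (⋂ x, {t : I | η t x = η' t x}) ∩ {t : I | v t = v' t} := by
    ext t
    rw [mem_inter_iff, mem_iInter]
    exact and_congr_left fun _ => ⟨fun e x => by rw [mem_ofPred_eq, e],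
      fun e => Subtype.ext (Equiv.ext e)⟩
  have hclosed : IsClosed A := by
    rw [hA']
    exact (isClosed_iInter fun x => isClosed_eq (hηc h x) (hηc h' x)).inter
      (isClosed_eq (hvc h) (hvc h'))
  have hopen : IsOpen A := isOpen_iff_mem_nhds.mpr fun t ht =>
    eventually_nhds_subtype_iff I t _ |>.mpr (h.eventually_eq hs hI h' t.2 ht.1 ht.2)
  have huniv : A = univ := IsClopen.eq_univ ⟨hclosed, hopen⟩
    ⟨⟨0, h0⟩, h.init_pos.trans h'.init_pos.symm, h.init_vel.trans h'.init_vel.symm⟩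
  exact fun t ht => huniv.ge (mem_univ ⟨t, ht⟩)

/-! ### Existence -/

/-- The Camassa-Holm equation as a first-order system: the vector field `(f, v) ↦ (v, S(f, v))` on
`H^s × H^s`, in the chart `f ↦ id + f` around the identity. -/
def sprayField (hs : 3 / 2 < s) (p : Hs s × Hs s) : Hs s × Hs s := (p.2, sprayHs hs p)

/-- Points of `𝒟^s` that stem from one smooth map into the chart around the identity form a smooth
map into `𝒟^s`. -/
theorem Ds.isContDiffOn_of_eq {E : Type*} [NormedAddCommGroup E] [NormedSpace ℝ E] {k : ℕ∞}
    {Φ : E → Ds s} {A : Set E} {f : E → Hs s} (hf : ContDiffOn ℝ k f A)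
    (h : ∀ p ∈ A, ∀ x, Φ p x = x + ((f p x : ℝ) : S1)) : Ds.IsContDiffOn k Φ A := by
  intro p hp
  refine ⟨fun q => f q - f p, sub_self _, ?_, (hf p hp).sub contDiffWithinAt_const⟩
  filter_upwards [self_mem_nhdsWithin] with q hq x
  rw [h q hq, h p hp]
  change _ = x + ((f p x : ℝ) : S1) + ((f q x - f p x : ℝ) : S1)
  rw [add_assoc, ← AddCircle.coe_add, add_sub_cancel]

theorem exists_solution_flow (hs : 3 / 2 < s) (u₀ : Hs s) :
    ∃ T : ℝ, 0 < T ∧ ∃ U : Set (Hs s), IsOpen U ∧ u₀ ∈ U ∧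
      ∃ (η : ℝ → Hs s → Ds s) (v : ℝ → Hs s → Hs s),
        (∀ w ∈ U, IsSolution s (Ioo (-T) T) w (fun t => η t w) (fun t => v t w)) ∧
        (Ds.IsContDiffOn 1 (fun p : ℝ × Hs s => η p.1 p.2) (Ioo (-T) T ×ˢ U) ∧
          ContDiffOn ℝ 1 (fun p : ℝ × Hs s => v p.1 p.2) (Ioo (-T) T ×ˢ U)) ∧
        ∀ t ∈ Ioo (-T) T, Ds.IsContDiffOn ⊤ (η t) U ∧ ContDiffOn ℝ ∞ (v t) U := by
  have : CompleteSpace (Hs s) := Hs.completeSpace (one_half_lt hs)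
  have hF : ContDiffOn ℝ ∞ (sprayField hs) (admissible hs) :=
    contDiff_snd.contDiffOn.prodMk (contDiffOn_sprayHs hs)
  obtain ⟨T, hT, V, hV, hu₀, φ, hφ, hflow⟩ :=
    exists_smooth_flow (isOpen_admissible hs) hF (zero_mem_admissible hs u₀)
  set U : Set (Hs s) := (fun w => ((0 : Hs s), w)) ⁻¹' V with hU
  have h0 : (0 : ℝ) ∈ Ioo (-T) T := ⟨neg_neg_iff_pos.mpr hT, hT⟩
  have hadm : ∀ t ∈ Ioo (-T) T, ∀ w ∈ U, φ (t, (0, w)) ∈ admissible hs := fun t ht w hw =>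
    ((hflow _ hw).2 t ht).1
  let ψ : ℝ × Hs s → Hs s × Hs s := fun p => φ (p.1, (0, p.2))
  have hψ : ContDiffOn ℝ ∞ ψ (Ioo (-T) T ×ˢ U) :=
    hφ.comp (contDiff_fst.prodMk (contDiff_const.prodMk contDiff_snd)).contDiffOn
      fun p hp => ⟨hp.1, hp.2⟩
  have hψt : ∀ t ∈ Ioo (-T) T, ContDiffOn ℝ ∞ (fun w => ψ (t, w)) U := fun t ht =>
    hψ.comp (contDiff_const.prodMk contDiff_id).contDiffOn fun w hw => ⟨ht, hw⟩
  have hex : ∀ p : ℝ × Hs s, ∃ ζ : Ds s, p ∈ Ioo (-T) T ×ˢ U →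
      ∀ x, ζ x = x + (((ψ p).1 x : ℝ) : S1) := fun p => by
    by_cases hp : p ∈ Ioo (-T) T ×ˢ U
    · obtain ⟨ζ, hζ⟩ := exists_diffeo hs (hadm p.1 hp.1 p.2 hp.2)
      exact ⟨ζ, fun _ => hζ⟩
    · exact ⟨Ds.e s, fun h => absurd h hp⟩
  -- outside the domain of the flow the values of `ζ` are arbitrary
  choose ζ hζ using hex
  have h1 : ((1 : ℕ∞) : WithTop ℕ∞) ≤ ∞ := by exact_mod_cast le_top
  refine ⟨T, hT, U, hV.preimage (Continuous.prodMk_right 0), hu₀, fun t w => ζ (t, w),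
    fun t w => (ψ (t, w)).2, fun w hw => ?_, ⟨?_, ?_⟩, fun t ht => ⟨?_, ?_⟩⟩
  · have hinit : ψ (0, w) = (0, w) := (hflow _ hw).1
    have hder : ∀ t ∈ Ioo (-T) T, HasDerivAt (fun τ => ψ (τ, w)) (sprayField hs (ψ (t, w))) t :=
      fun t ht => ((hflow _ hw).2 t ht).2
    refine ⟨?_, congrArg Prod.snd hinit, fun t ht => ?_,
      fun t => sprayHs hs (ψ (t, w)), ?_, fun t ht => ⟨?_, ?_⟩⟩
    · refine Subtype.ext (Equiv.ext fun x => ?_)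
      have h2 := hζ (0, w) ⟨h0, hw⟩ x
      rw [hinit, Hs.zero_apply, QuotientAddGroup.mk_zero, add_zero] at h2
      exact h2
    · refine ⟨fun τ => (ψ (τ, w)).1 - (ψ (t, w)).1, sub_self _, ?_,
        ((hasFDerivAt_fst.comp_hasDerivAt t (hder t ht)).sub_const _).hasDerivWithinAt⟩
      filter_upwards [self_mem_nhdsWithin] with τ hτ x
      rw [hζ _ ⟨hτ, hw⟩, hζ _ ⟨ht, hw⟩]
      change _ = x + (((ψ (t, w)).1 x : ℝ) : S1) + (((ψ (τ, w)).1 x - (ψ (t, w)).1 x : ℝ) : S1)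
      rw [add_assoc, ← AddCircle.coe_add, add_sub_cancel]
    · exact (contDiffOn_sprayHs hs).continuousOn.comp
        (fun t ht => (hder t ht).continuousAt.continuousWithinAt) fun t ht => hadm t ht w hw
    · exact (hasFDerivAt_snd.comp_hasDerivAt t (hder t ht)).hasDerivWithinAt
    · exact sprayHs_apply hs (hadm t ht w hw) (hζ _ ⟨ht, hw⟩)
  · exact Ds.isContDiffOn_of_eq (hψ.fst.of_le h1) hζ
  · exact hψ.snd.of_le h1
  · exact Ds.isContDiffOn_of_eq (hψt t ht).fst fun w hw => hζ _ ⟨ht, hw⟩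
  · exact (hψt t ht).snd

end CamassaHolm

end

/-- Local well-posedness of the Lagrangian Camassa-Holm Cauchy problem on the circle. -/
theorem theorem3p3 (s : ℝ) (hs : 3 / 2 < s) :
    -- uniqueness: two solutions on the same interval of times around `0` agree there
    (∀ (u₀ : CamassaHolm.Hs s) (I : Set ℝ), I.OrdConnected → (0 : ℝ) ∈ I →
      ∀ (η η' : ℝ → CamassaHolm.Ds s) (v v' : ℝ → CamassaHolm.Hs s),
        CamassaHolm.IsSolution s I u₀ η v → CamassaHolm.IsSolution s I u₀ η' v' →
          ∀ t ∈ I, η t = η' t ∧ v t = v' t) ∧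
    -- existence on a finite interval, and regularity in time and in the initial data
    ∀ u₀ : CamassaHolm.Hs s, ∃ T : ℝ, 0 < T ∧ ∃ U : Set (CamassaHolm.Hs s), IsOpen U ∧ u₀ ∈ U ∧
      ∃ (η : ℝ → CamassaHolm.Hs s → CamassaHolm.Ds s)
        (v : ℝ → CamassaHolm.Hs s → CamassaHolm.Hs s),
        (∀ w ∈ U, CamassaHolm.IsSolution s (Ioo (-T) T) w (fun t => η t w) (fun t => v t w)) ∧
        (CamassaHolm.Ds.IsContDiffOn 1 (fun p : ℝ × CamassaHolm.Hs s => η p.1 p.2)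
            (Ioo (-T) T ×ˢ U) ∧
          ContDiffOn ℝ 1 (fun p : ℝ × CamassaHolm.Hs s => v p.1 p.2) (Ioo (-T) T ×ˢ U)) ∧
        ∀ t ∈ Ioo (-T) T,
          CamassaHolm.Ds.IsContDiffOn ⊤ (η t) U ∧ ContDiffOn ℝ ∞ (v t) U := by
  exact ⟨fun u₀ I hI h0 η η' v v' h h' => h.unique hs hI h0 h',
    fun u₀ => CamassaHolm.exists_solution_flow hs u₀⟩
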